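/- **Setting.** Let $\Pi_0=(\Sigma_0,\mathsf{Pred})$ be an effectively given signature, $\mathcal T_0$ a (first-order) theory over $\Pi_0$, $\Sigma_1$ an effectively given set of new function symbols, and $C$ a countably infinite set of fresh constants. Atoms may be equations $s\approx t$. Let $\mathcal K$ be a set of universally closed clauses over $\Sigma_0\cup\Sigma_1,\mathsf{Pred}$, let $\mathcal T=\mathcal T_0\cup\mathcal K$, and let $P\subseteq\mathsf{Pred}\cup\{\approx\}$ be a set of binary predicate symbols. *Convexity.* A theory is convex with respect to a set $Q$ of predicate symbols if, whenever a finite conjunction $\Gamma$ of ground atoms (with constants in $C$) entails a non-empty disjunction of ground atoms with predicate symbols in $Q$, it entails one of the disjuncts; it is convex if it is convex with respect to $\mathsf{Pred}\cup\{\approx\}$. *Sharing and interpolation.* For extension functions write $f\sim_{\mathcal K}g$ if $f,g$ occur in a common clause of $\mathcal K$; let $\sim^*_{\mathcal K}$ be the generated equivalence relation and $\Theta_{\mathcal K}(\Sigma)=\{g\in\Sigma_1\mid f\sim^*_{\mathcal K}g\text{ for some }f\in\Sigma\}$. If $\Sigma_A,\Sigma_B\subseteq\Sigma_1$ are the extension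 functions occurring in $A$ and $B$, the $\Theta_{\mathcal K}$-shared function symbols of $A,B$ are those of $\Sigma_0$ and those of $\Theta_{\mathcal K}(\Sigma_A)\cap\Theta_{\mathcal K}(\Sigma_B)$. An $\{R\}$-convex theory is $R$-interpolating if for all conjunctions $A,B$ of ground atoms and all constants $a\in C$ of $A$ and $b\in C$ of $B$ with $A\wedge B\models a\,R\,b$ there is an interpolating term, i.e. a ground term $t$ that contains only constants of $C$ common to $A$ and $B$ and only shared function symbols, with $A\wedge B\models a\,R\,t\wedge t\,R\,b$. It is $P$-interpolating if it is $R$-interpolating for all $R\in P$. For $\mathcal T_0$ all function symbols count as shared; for $\mathcal T$ the $\Theta_{\mathcal K}$-shared ones. *Locality.* Let $\Psi$ map every finite set of ground terms to a finite set of ground terms containing it. $\mathrm{est}(\mathcal K,G)$ is the set of ground terms starting with a symbol of $\Sigma_1$ that occur in $G$ or $\mathcal K$, and $\mathcal K[S]$ is the set of ground instances of clauses of $\mathcal K$ in which all terms starting with a symbol of $\Sigma_1$ are in $S$. $\mathcal T_0\subseteq\mathcal T_0\cup\mathcal K$ is $\Psi$-local if for every finite set $G$ of ground clauses (with constants in $C$),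 $\mathcal T_0\cup\mathcal K\cup G$ is unsatisfiable iff $\mathcal T_0\cup\mathcal K[\Psi(\mathrm{est}(\mathcal K,G))]\cup G$ is. We say that $\Psi$ introduces no mixed terms if for all finite sets $S_A,S_B$ of terms $f(c_1,\dots,c_n)$ with $f\in\Sigma_1$, $c_i\in C$, each term of $\Psi(S_A\cup S_B)$ contains only constants of $C$ that occur in $S_A$ and only extension functions in the $\Theta_{\mathcal K}$-closure of those occurring in $S_A$, or satisfies the same condition with $S_B$ in place of $S_A$. **Theorem.** Assume: 1. $\mathcal T_0$ is convex, $P$-interpolating and $\approx$-interpolating, satisfiability of finite sets of ground clauses with respect to $\mathcal T_0$ is decidable, and interpolating terms for $\mathcal T_0$ (for $R\in P\cup\{\approx\}$) can be effectively computed. 2. Every clause of $\mathcal K$ has the form $$x_1R_1s_1\wedge\dots\wedge x_nR_ns_n\to f(x_1,\dots,x_n)\,R\,g(y_1,\dots,y_n),$$ where $n\ge1$, $x_1,\dots,x_n,y_1,\dots,y_n$ are pairwise distinct variables, $f,g\in\Sigma_1$, $R_1,\dots,R_n\in P$, $R\in\mathsf{Pred}\cup\{\approx\}$ is a binary predicate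 symbol that is transitive in $\mathcal T_0$, and each $s_i$ is one of the variables $y_j$ or a term $h_i(z_1,\dots,z_k)$ with $k\ge1$, $h_i\in\Sigma_1$ and $z_1,\dots,z_k\in\{y_1,\dots,y_n\}$; and together with each such clause $\mathcal K$ contains the monotonicity clause $$x_1R_1y_1\wedge\dots\wedge x_nR_ny_n\to f(x_1,\dots,x_n)\,R\,f(y_1,\dots,y_n).$$ 3. $\mathcal T_0\subseteq\mathcal T_0\cup\mathcal K$ is a $\Psi$-local extension, where $\Psi$ introduces no mixed terms. Then $\mathcal T=\mathcal T_0\cup\mathcal K$ is $P$-interpolating with $\Theta_{\mathcal K}$-sharing. Moreover, if $\mathcal K$ is recursively enumerable (for instance finite), interpolating terms for $\mathcal T$ (for $R\in P$) can be effectively computed, and hierarchically: there is an algorithm which, given $A,B$ and $a\,R\,b$ with $R\in P$, $a$ a constant of $A$, $b$ a constant of $B$ and $A\wedge B\models_{\mathcal T}a\,R\,b$, returns conjunctions $A_0,B_0$ of ground atoms in the signature of $\mathcal T_0$ (with constants in $C$), such that $a$ occurs in $A_0$, $b$ occurs in $B_0$ and $A_0\wedge B_0\models_{\mathcal T_0}a\,R\,b$,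 together with a finite list of replacements of constants by terms, such that these replacements turn every interpolating term for $A_0\wedge B_0\models_{\mathcal T_0}a\,R\,b$ into an interpolating term for $A\wedge B\models_{\mathcal T}a\,R\,b$. -/

import Mathlib

open FirstOrder FirstOrder.Language

namespace LocalInterp

/-! ## Ground syntax

The countable set `C` of additional constants is `ℕ`.  A ground `Π^C`-term is a term of type
`L.Term ℕ`, the element `c : ℕ` being read as the constant `c`; accordingly a `Π^C`-structure is
an `L`-structure `M` together with an interpretation `v : ℕ → M` of the constants.
The same type `L.Term ℕ` is used for terms with variables in axioms (universally closed clauses),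
where `x : ℕ` is read as a variable. -/

/-- Atoms: equations `s ≈ t` and atoms `R(t₁, …, tₙ)`. -/
abbrev Atom (L : FirstOrder.Language.{0, 0}) : Type :=
  (L.Term ℕ × L.Term ℕ) ⊕ (Σ R : (Σ n, L.Relations n), (Fin R.1 → L.Term ℕ))

/-- Predicate symbols including equality, which is `none`. -/
abbrev PredSym (L : FirstOrder.Language.{0, 0}) : Type := Option (Σ n, L.Relations n)

/-- Binary predicate symbols including equality, which is `none`. -/
abbrev BinRel (L : FirstOrder.Language.{0, 0}) : Type := Option (L.Relations 2)

/-- `(true, α)` is the literal `α`, and `(false, α)` is the literal `¬ α`. -/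
abbrev Literal (L : FirstOrder.Language.{0, 0}) : Type := Bool × Atom L

/-- A clause is the disjunction of a finite list of literals. -/
abbrev Clause (L : FirstOrder.Language.{0, 0}) : Type := List (Literal L)

section TermSyntax

variable {L : FirstOrder.Language.{0, 0}}

/-- The predicate symbol of an atom. -/
def Atom.sym : Atom L → PredSym L
  | Sum.inl _ => none
  | Sum.inr ⟨R, _⟩ => some R

/-- A binary predicate symbol as a predicate symbol. -/
def BinRel.sym (R : BinRel L) : PredSym L := R.map fun r => ⟨2, r⟩

/-- The atom `s R t`. -/
def BinRel.atom (R : BinRel L) (s t : L.Term ℕ) : Atom L :=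
  match R with
  | none => Sum.inl (s, t)
  | some r => Sum.inr ⟨⟨2, r⟩, ![s, t]⟩

/-- The set of subterms of a term (including the term itself). -/
def subterms : L.Term ℕ → Set (L.Term ℕ)
  | Term.var x => {Term.var x}
  | Term.func f ts => {Term.func f ts} ∪ ⋃ i, subterms (ts i)

/-- All terms occurring in an atom. -/
def Atom.terms : Atom L → Set (L.Term ℕ)
  | Sum.inl (s, t) => subterms s ∪ subterms t
  | Sum.inr ⟨_, ts⟩ => ⋃ i, subterms (ts i)

/-- All terms occurring in a list of atoms. -/
def atomsTerms (A : List (Atom L)) : Set (L.Term ℕ) := ⋃ α ∈ A, Atom.terms α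

/-- All terms occurring in a clause. -/
def clauseTerms (D : Clause L) : Set (L.Term ℕ) := ⋃ l ∈ D, Atom.terms l.2

/-- The constants of `C` (respectively the variables) among a set of terms. -/
def constsIn (S : Set (L.Term ℕ)) : Set ℕ := {c | Term.var c ∈ S}

/-- The function symbols at the root of some term of a set of terms. -/
def symbolsIn (S : Set (L.Term ℕ)) : Set (Σ n, L.Functions n) :=
  {s | ∃ ts : Fin s.1 → L.Term ℕ, Term.func s.2 ts ∈ S}

/-- Substitution in atoms. -/
def Atom.subst (σ : ℕ → L.Term ℕ) : Atom L → Atom L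
  | Sum.inl (s, t) => Sum.inl (s.subst σ, t.subst σ)
  | Sum.inr ⟨R, ts⟩ => Sum.inr ⟨R, fun i => (ts i).subst σ⟩

/-- Substitution in clauses. -/
def Clause.subst (σ : ℕ → L.Term ℕ) (D : Clause L) : Clause L :=
  D.map fun l => (l.1, Atom.subst σ l.2)

/-- The substitution given by a finite list of replacements `c ↦ t`; every other constant
is left unchanged. -/
def replacement : List (ℕ × L.Term ℕ) → ℕ → L.Term ℕ
  | [], c => Term.var c
  | (d, t) :: l, c => if c = d then t else replacement l c

end TermSyntax

/-! ## Semantics -/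

section Semantics

variable {L : FirstOrder.Language.{0, 0}}

/-- Truth of an atom. -/
def Atom.Holds {M : Type} [L.Structure M] (v : ℕ → M) : Atom L → Prop
  | Sum.inl (s, t) => s.realize v = t.realize v
  | Sum.inr ⟨R, ts⟩ => Structure.RelMap R.2 fun i => (ts i).realize v

/-- Truth of a literal. -/
def Literal.Holds {M : Type} [L.Structure M] (v : ℕ → M) (l : Literal L) : Prop :=
  if l.1 then Atom.Holds v l.2 else ¬ Atom.Holds v l.2

/-- Truth of a clause. -/
def Clause.Holds {M : Type} [L.Structure M] (v : ℕ → M) (D : Clause L) : Prop :=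
  ∃ l ∈ D, Literal.Holds v l

/-- The interpretation of a binary predicate symbol (`≈` is interpreted by equality). -/
def BinRel.Rel (R : BinRel L) (M : Type) [L.Structure M] (x y : M) : Prop :=
  match R with
  | none => x = y
  | some r => Structure.RelMap r ![x, y]

/-- A class of `L`-structures, used for the class of models of a theory. Structures are
nonempty whenever they carry an interpretation `ℕ → M` of the constants. -/
abbrev Models (L : FirstOrder.Language.{0, 0}) : Type 1 := ∀ (M : Type) [L.Structure M], Prop

/-- The models of a first-order theory. -/
def modelsOf (T : L.Theory) : Models L := fun M _ => Nonempty M ∧ M ⊨ T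

/-- `Γ ⊨_T ⋁ Δ` for lists of ground atoms, `Γ` read conjunctively. -/
def EntailsDisj (T : Models L) (Γ Δ : List (Atom L)) : Prop :=
  ∀ (M : Type) [L.Structure M], T M → ∀ v : ℕ → M,
    (∀ γ ∈ Γ, Atom.Holds v γ) → ∃ δ ∈ Δ, Atom.Holds v δ

/-- `Γ ⊨_T α`. -/
def Entails (T : Models L) (Γ : List (Atom L)) (α : Atom L) : Prop :=
  ∀ (M : Type) [L.Structure M], T M → ∀ v : ℕ → M,
    (∀ γ ∈ Γ, Atom.Holds v γ) → Atom.Holds v α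

/-- A set of ground clauses has a model in `T`. -/
def Satisfiable (T : Models L) (G : Set (Clause L)) : Prop :=
  ∃ (M : Type) (_ : L.Structure M) (v : ℕ → M), T M ∧ ∀ D ∈ G, Clause.Holds v D

/-- Convexity with respect to a set of predicate symbols. -/
def ConvexWrt (T : Models L) (P : Set (PredSym L)) : Prop :=
  ∀ Γ Δ : List (Atom L), Δ ≠ [] → (∀ δ ∈ Δ, Atom.sym δ ∈ P) →
    EntailsDisj T Γ Δ → ∃ δ ∈ Δ, Entails T Γ δ

/-- Convexity: convexity with respect to all predicate symbols and equality. -/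
def ConvexTheory (T : Models L) : Prop := ConvexWrt T Set.univ

/-- `R` is transitive in all models of `T`. -/
def TransIn (T : Models L) (R : BinRel L) : Prop :=
  ∀ (M : Type) [L.Structure M], T M → ∀ x y z : M, R.Rel M x y → R.Rel M y z → R.Rel M x z

end Semantics

/-! ## Interpolation -/

section Interpolation

variable {L : FirstOrder.Language.{0, 0}}

/-- A notion of sharing: the function symbols that an interpolating term for `A`, `B` may
contain. -/
abbrev Sharing (L : FirstOrder.Language.{0, 0}) : Type :=
  List (Atom L) → List (Atom L) → Set (Σ n, L.Functions n)

/-- The notion of sharing for which all function symbols are interpreted. -/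
def allShared : Sharing L := fun _ _ => Set.univ

/-- `A` and `B` are conjunctions of ground atoms, `a` is a constant of `A`, `b` a constant of `B`,
and `A ∧ B ⊨_T a R b`. -/
def IsProblem (T : Models L) (R : BinRel L) (A B : List (Atom L)) (a b : ℕ) : Prop :=
  a ∈ constsIn (atomsTerms A) ∧ b ∈ constsIn (atomsTerms B) ∧
    Entails T (A ++ B) (R.atom (Term.var a) (Term.var b))

/-- `t` contains only common constants of `A` and `B` and only shared function symbols, and
`A ∧ B ⊨_T a R t ∧ t R b`. -/
def IsInterpolatingTerm (T : Models L) (sh : Sharing L) (R : BinRel L)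
    (A B : List (Atom L)) (a b : ℕ) (t : L.Term ℕ) : Prop :=
  constsIn (subterms t) ⊆ constsIn (atomsTerms A) ∩ constsIn (atomsTerms B) ∧
  symbolsIn (subterms t) ⊆ sh A B ∧
  Entails T (A ++ B) (R.atom (Term.var a) t) ∧ Entails T (A ++ B) (R.atom t (Term.var b))

/-- The `R`-interpolation property of an `{R}`-convex theory. -/
def RInterpolating (T : Models L) (sh : Sharing L) (R : BinRel L) : Prop :=
  ConvexWrt T {R.sym} ∧
  ∀ (A B : List (Atom L)) (a b : ℕ), IsProblem T R A B a b →
    ∃ t, IsInterpolatingTerm T sh R A B a b t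

/-- The `P`-interpolation property. -/
def PInterpolating (T : Models L) (sh : Sharing L) (P : Set (BinRel L)) : Prop :=
  ∀ R ∈ P, RInterpolating T sh R

end Interpolation

/-! ## Effectiveness -/

section Effectiveness

variable {L : FirstOrder.Language.{0, 0}} [Encodable (Σ n, L.Functions n)] [Encodable (Σ n, L.Relations n)]

/-- Satisfiability in `T` of finite sets of ground clauses is decidable. -/
def DecidableGroundSat (T : Models L) : Prop :=
  ∃ f : ℕ → Bool, Computable f ∧
    ∀ G : List (Clause L), f (Encodable.encode G) = true ↔ Satisfiable T {D | D ∈ G}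

/-- The algorithm `f` computes interpolating terms for all `R ∈ P`: given `A`, `B` and `a R b`
with `A ∧ B ⊨_T a R b`, it returns an interpolating term. -/
def ComputesInterpolants (T : Models L) (sh : Sharing L) (P : Set (BinRel L))
    (f : ℕ →. ℕ) : Prop :=
  ∀ R ∈ P, ∀ (A B : List (Atom L)) (a b : ℕ), IsProblem T R A B a b →
    ∃ t, IsInterpolatingTerm T sh R A B a b t ∧
      Encodable.encode t ∈
        f (Encodable.encode (A, B, BinRel.atom R (Term.var a) (Term.var b)))

/-- Interpolating terms for all `R ∈ P` can be effectively computed. -/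
def EffectivelyInterpolating (T : Models L) (sh : Sharing L) (P : Set (BinRel L)) : Prop :=
  ∃ f : ℕ →. ℕ, Nat.Partrec f ∧ ComputesInterpolants T sh P f

end Effectiveness

/-! ## Theory extensions -/

/-- The extension of a signature by new function symbols. -/
@[reducible]
def extLang (L : FirstOrder.Language.{0, 0}) (F : ℕ → Type) : FirstOrder.Language.{0, 0} :=
  ⟨fun n => L.Functions n ⊕ F n, L.Relations⟩

instance extFunctionsPrimcodable (L : FirstOrder.Language.{0, 0}) (F : ℕ → Type)
    [Primcodable (Σ n, L.Functions n)] [Primcodable (Σ n, F n)] :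
    Primcodable (Σ n, (extLang L F).Functions n) :=
  Primcodable.ofEquiv ((Σ n, L.Functions n) ⊕ (Σ n, F n)) (Equiv.sigmaSumDistrib L.Functions F)

instance extRelationsPrimcodable (L : FirstOrder.Language.{0, 0}) (F : ℕ → Type)
    [Primcodable (Σ n, L.Relations n)] : Primcodable (Σ n, (extLang L F).Relations n) :=
  inferInstanceAs (Primcodable (Σ n, L.Relations n))

section Extension

variable {L : FirstOrder.Language.{0, 0}} {F : ℕ → Type}

/-- The inclusion of the base signature. -/
def baseHom (L : FirstOrder.Language.{0, 0}) (F : ℕ → Type) : L →ᴸ extLang L F where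
  onFunction := fun _ f => Sum.inl f
  onRelation := fun _ r => r

/-- A base predicate symbol, as a symbol of the extended signature. -/
def BinRel.ext (F : ℕ → Type) (R : BinRel L) : BinRel (extLang L F) := R

/-- The models of `T₀ ∪ K`: structures whose reduct to the base signature is a model of `T₀`, and
in which every clause of `K` is true under all assignments of the variables. -/
def extModels (T₀ : L.Theory) (K : Set (Clause (extLang L F))) : Models (extLang L F) :=
  fun M _ => (@modelsOf L T₀ M ((baseHom L F).reduct M)) ∧
    ∀ D ∈ K, ∀ v : ℕ → M, Clause.Holds v D

/-- A term starting with an extension function. -/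
def IsExt (t : (extLang L F).Term ℕ) : Prop :=
  ∃ (n : ℕ) (f : F n) (ts : Fin n → (extLang L F).Term ℕ),
    t = Term.func (L := extLang L F) (Sum.inr f) ts

/-- The extension symbols at the root of some term of a set of terms. -/
def extSymbolsIn (S : Set ((extLang L F).Term ℕ)) : Set (Σ n, F n) :=
  {s | ⟨s.1, Sum.inr s.2⟩ ∈ symbolsIn S}

/-- The ground terms starting with an extension function that occur in `G` or in `K`. -/
def est (K : Set (Clause (extLang L F))) (G : List (Clause (extLang L F))) :
    Set ((extLang L F).Term ℕ) :=
  {t | IsExt t ∧ ((∃ D ∈ G, t ∈ clauseTerms D) ∨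
    (∃ D ∈ K, t ∈ clauseTerms D ∧ constsIn (subterms t) = ∅))}

/-- `K[S]`: the ground instances of the clauses of `K` in which all terms starting with an
extension function are in `S`. -/
def instances (K : Set (Clause (extLang L F))) (S : Set ((extLang L F).Term ℕ)) :
    Set (Clause (extLang L F)) :=
  {D' | ∃ D ∈ K, ∃ σ : ℕ → (extLang L F).Term ℕ, D' = Clause.subst σ D ∧
    ∀ t ∈ clauseTerms D', IsExt t → t ∈ S}

/-- `Ψ` maps every finite set of ground terms to a finite set of ground terms containing it. -/
def IsTermMap (Ψ : Set ((extLang L F).Term ℕ) → Set ((extLang L F).Term ℕ)) : Prop :=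
  ∀ S, S.Finite → (Ψ S).Finite ∧ S ⊆ Ψ S

/-- `T₀ ⊆ T₀ ∪ K` is a `Ψ`-local extension. -/
def PsiLocal (T₀ : L.Theory) (K : Set (Clause (extLang L F)))
    (Ψ : Set ((extLang L F).Term ℕ) → Set ((extLang L F).Term ℕ)) : Prop :=
  ∀ G : List (Clause (extLang L F)),
    ¬ Satisfiable (extModels T₀ K) {D | D ∈ G} ↔
    ¬ Satisfiable (extModels T₀ (∅ : Set (Clause (extLang L F))))
        (instances K (Ψ (est K G)) ∪ {D | D ∈ G})

/-- `f ∼_K g`: the extension functions `f`, `g` occur together in a clause of `K`. -/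
def Linked (K : Set (Clause (extLang L F))) (f g : Σ n, F n) : Prop :=
  ∃ D ∈ K, f ∈ extSymbolsIn (clauseTerms D) ∧ g ∈ extSymbolsIn (clauseTerms D)

/-- The closure operator `Θ_K`. -/
def Theta (K : Set (Clause (extLang L F))) (S : Set (Σ n, F n)) : Set (Σ n, F n) :=
  {g | ∃ f ∈ S, Relation.EqvGen (Linked K) f g}

/-- `Θ_K`-sharing: all base function symbols, and the `Θ_K`-shared extension functions. -/
def thetaSharing (K : Set (Clause (extLang L F))) : Sharing (extLang L F) := fun A B =>
  {s | (∃ (n : ℕ) (f : L.Functions n), s = ⟨n, Sum.inl f⟩) ∨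
    ∃ (n : ℕ) (f : F n), s = ⟨n, Sum.inr f⟩ ∧
      (⟨n, f⟩ : Σ n, F n) ∈ Theta K (extSymbolsIn (atomsTerms A)) ∩
        Theta K (extSymbolsIn (atomsTerms B))}

/-- All terms occurring in a set of terms. -/
def allSubterms (S : Set ((extLang L F).Term ℕ)) : Set ((extLang L F).Term ℕ) :=
  ⋃ t ∈ S, subterms t

/-- A flat ground extension term `f(c₁, …, cₙ)`. -/
def IsFlat (t : (extLang L F).Term ℕ) : Prop :=
  ∃ (n : ℕ) (f : F n) (c : Fin n → ℕ),
    t = Term.func (L := extLang L F) (Sum.inr f) fun i => Term.var (c i)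

/-- All constants of `t` occur in `S`, and all extension functions of `t` are in the
`Θ_K`-closure of those occurring in `S`. -/
def GeneratedBy (K : Set (Clause (extLang L F))) (S : Set ((extLang L F).Term ℕ))
    (t : (extLang L F).Term ℕ) : Prop :=
  constsIn (subterms t) ⊆ constsIn (allSubterms S) ∧
  extSymbolsIn (subterms t) ⊆ Theta K (extSymbolsIn (allSubterms S))

/-- `Ψ` introduces no mixed terms: for finite sets `S_A`, `S_B` of flat ground extension terms,
`Ψ(S_A ∪ S_B)` is the union of an `A`-part and a `B`-part. -/
def Separable (K : Set (Clause (extLang L F)))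
    (Ψ : Set ((extLang L F).Term ℕ) → Set ((extLang L F).Term ℕ)) : Prop :=
  ∀ SA SB : Set ((extLang L F).Term ℕ), SA.Finite → SB.Finite →
    (∀ t ∈ SA, IsFlat t) → (∀ t ∈ SB, IsFlat t) →
    ∀ t ∈ Ψ (SA ∪ SB), GeneratedBy K SA t ∨ GeneratedBy K SB t

/-- The term `f(x₁, …, xₙ)`, for variables `x₁, …, xₙ`. -/
def varApp {n : ℕ} (f : F n) (x : Fin n → ℕ) : (extLang L F).Term ℕ :=
  Term.func (L := extLang L F) (Sum.inr f) fun i => Term.var (x i)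

/-- The clause `x₁ R₁ s₁ ∧ … ∧ xₙ Rₙ sₙ → f(x₁, …, xₙ) R g(y₁, …, yₙ)`. -/
def compClause {n : ℕ} (f g : F n) (Rs : Fin n → BinRel L) (R : BinRel L)
    (x y : Fin n → ℕ) (s : Fin n → (extLang L F).Term ℕ) : Clause (extLang L F) :=
  (List.ofFn fun i => (false, BinRel.atom (BinRel.ext F (Rs i)) (Term.var (x i)) (s i))) ++
    [(true, BinRel.atom (BinRel.ext F R) (varApp f x) (varApp g y))]

/-- The clause `x₁ R₁ y₁ ∧ … ∧ xₙ Rₙ yₙ → f(x₁, …, xₙ) R f(y₁, …, yₙ)`. -/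
def monClause {n : ℕ} (f : F n) (Rs : Fin n → BinRel L) (R : BinRel L)
    (x y : Fin n → ℕ) : Clause (extLang L F) :=
  compClause f f Rs R x y fun i => Term.var (y i)

/-- A term that is one of the variables `y₁, …, yₙ`, or `h(z₁, …, zₖ)` with `k ≥ 1`, an extension
function `h`, and variables `z₁, …, zₖ` among `y₁, …, yₙ`. -/
def IsPremiseTerm {n : ℕ} (y : Fin n → ℕ) (s : (extLang L F).Term ℕ) : Prop :=
  (∃ j, s = Term.var (y j)) ∨
  ∃ (k : ℕ) (h : F k) (z : Fin k → ℕ), 1 ≤ k ∧ (∀ j, z j ∈ Set.range y) ∧ s = varApp h z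

/-- Every clause of `K` is of the form
`x₁ R₁ s₁ ∧ … ∧ xₙ Rₙ sₙ → f(x₁, …, xₙ) R g(y₁, …, yₙ)`
with `n ≥ 1`, `R₁, …, Rₙ ∈ P`, `R` transitive, and accompanied in `K` by the monotonicity clause
of `f` for `R₁, …, Rₙ` and `R`.  (A monotonicity clause is itself of this form.) -/
def MonCompForm (T₀ : L.Theory) (P : Set (BinRel L)) (K : Set (Clause (extLang L F))) : Prop :=
  ∀ D ∈ K, ∃ (n : ℕ) (f g : F n) (Rs : Fin n → BinRel L) (R : BinRel L)
      (x y : Fin n → ℕ) (s : Fin n → (extLang L F).Term ℕ),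
    1 ≤ n ∧ (∀ i, Rs i ∈ P) ∧ TransIn (modelsOf T₀) R ∧
    Function.Injective (Sum.elim x y) ∧ (∀ i, IsPremiseTerm y (s i)) ∧
    D = compClause f g Rs R x y s ∧
    ∃ x' y' : Fin n → ℕ, Function.Injective (Sum.elim x' y') ∧ monClause f Rs R x' y' ∈ K

/-- `t₀` with the constants replaced according to `σ`. -/
def translate (σ : List (ℕ × (extLang L F).Term ℕ)) (t₀ : L.Term ℕ) : (extLang L F).Term ℕ :=
  ((baseHom L F).onTerm t₀).subst (replacement σ)

section

variable [Primcodable (Σ n, L.Functions n)] [Primcodable (Σ n, L.Relations n)]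
  [Primcodable (Σ n, F n)]

/-- `K` is recursively enumerable. -/
def RecEnum (K : Set (Clause (extLang L F))) : Prop :=
  REPred fun m : ℕ => ∃ D ∈ K, Encodable.encode D = m

/-- The algorithm `r` reduces `R`-interpolation in `T₀ ∪ K` (with `Θ_K`-sharing), for `R ∈ P`, to
`R`-interpolation in `T₀`: given `A ∧ B ⊨ a R b` in `T₀ ∪ K`, it returns base conjunctions `A₀`,
`B₀` with `A₀ ∧ B₀ ⊨ a R b` in `T₀` and a list of replacements of constants by terms, which turns
every interpolating term for `A₀ ∧ B₀ ⊨ a R b` into one for `A ∧ B ⊨ a R b`. -/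
def ReducesInterpolation (T₀ : L.Theory) (K : Set (Clause (extLang L F))) (P : Set (BinRel L))
    (r : ℕ →. ℕ) : Prop :=
  ∀ R ∈ P, ∀ (A B : List (Atom (extLang L F))) (a b : ℕ),
    IsProblem (extModels T₀ K) (BinRel.ext F R) A B a b →
    ∃ (A₀ B₀ : List (Atom L)) (σ : List (ℕ × (extLang L F).Term ℕ)),
      Encodable.encode (A₀, B₀, σ) ∈
        r (Encodable.encode (A, B, BinRel.atom (BinRel.ext F R) (Term.var a) (Term.var b))) ∧
      IsProblem (modelsOf T₀) R A₀ B₀ a b ∧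
      ∀ t₀, IsInterpolatingTerm (modelsOf T₀) allShared R A₀ B₀ a b t₀ →
        IsInterpolatingTerm (extModels T₀ K) (thetaSharing K) (BinRel.ext F R) A B a b
          (translate σ t₀)

end

end Extension

end LocalInterp

open LocalInterp

/-! Every term of the extended signature is named by a constant, injectively and so that `a` and `b`
name themselves, and `A`, `B` are flattened, so that extension functions are applied to constants
only. Call a term an A-term if its constants name terms of `A` and its extension functions lie in
the Θ-closure of those of `A`; B-terms are defined in the same way. A base atom speaks about the
terms named by its constants. Let Q be the set of base atoms that follow in `T₀` from some A₀ ∧ B₀,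
where A₀ consists of atoms about A-terms, B₀ of atoms about B-terms, and all of these are
consequences of `A ∧ B` in the extension. The heart of the proof is that `a R b` lies in Q
(`separated_of_isProblem`).

Suppose it does not. Q is closed under entailment in `T₀`, so convexity and compactness give a model
of `T₀` in which exactly the atoms of Q are true (`exists_model_of_closed`). It can be expanded by
the extension functions because Q respects congruence (`exists_expansion`), and it satisfies the
instances of `K` selected by `Ψ` because Q is closed under them. Indeed, since `Ψ` introduces no
mixed terms, each head f(u), g(w) of such an instance is an A-term or a B-term. If both are on one
side, the conclusion is itself an admissible atom of that side. If they are on different sides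
(`Separated.of_mixed`), interpolation in `T₀` yields for each premise uᵢ Rᵢ sᵢ an intermediate tᵢ
that is both an A-term and a B-term. So is f(t), as f and g share a clause. Monotonicity gives f(u)
R f(t), the clause itself gives f(t) R g(w), each of these atoms is about one side only, and
transitivity joins them. Congruence across the two sides is the same argument for equality, whence
the assumption of ≈-interpolation. Locality turns the model into one of the full extension,
contradicting `A ∧ B ⊨ a R b`.

Thus A₀ and B₀ exist, and a `T₀`-interpolating term for them speaks about constants whose terms are
on both sides; replacing names by terms gives an interpolating term in the extension
(`exists_isReduction`, `IsReduction.isInterpolatingTerm`). Convexity of the extension follows from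
the same model construction, with Q the set of all entailed atoms (`convex_extModels`).

The existence proof is not constructive, but reductions can be recognized: Θ-membership is witnessed
by a chain of clauses, `T₀`-entailment is decidable, and entailment in the extension is witnessed by
finite refutations in `T₀`, complete once more by the model construction (`exists_isRefutation`).
Hence a reduction is found by unbounded search (`exists_partrec_isReduction`), and composition with
the algorithm for `T₀` computes interpolating terms. -/

namespace LocalInterp

/-! ### Models of closed sets of atoms; subterms and substitution. -/

section Base

variable {L : FirstOrder.Language.{0, 0}}

/-- An atom as a formula whose free variables are the constants. -/
def Atom.toFormula : Atom L → L.Formula ℕ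
  | Sum.inl (s, t) => s.equal t
  | Sum.inr ⟨R, ts⟩ => Relations.formula R.2 ts

theorem Atom.realize_toFormula {M : Type} [L.Structure M] (v : ℕ → M) (α : Atom L) :
    α.toFormula.Realize v ↔ α.Holds v := by
  rcases α with ⟨s, t⟩ | ⟨R, ts⟩
  · simp [Atom.toFormula, Atom.Holds]
  · simp [Atom.toFormula, Atom.Holds, Formula.realize_rel]

/-- A set of atoms that is closed under entailment in a convex theory, and not everything, is the
set of atoms true in some model. -/
theorem exists_model_of_closed {T₀ : L.Theory} (hconv : ConvexTheory (modelsOf T₀))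
    {Q : Set (Atom L)}
    (hQ : ∀ (Γ : List (Atom L)) (β : Atom L), (∀ γ ∈ Γ, γ ∈ Q) →
      Entails (modelsOf T₀) Γ β → β ∈ Q)
    {δ : Atom L} (hδ : δ ∉ Q) :
    ∃ (M : Type) (_ : L.Structure M) (v : ℕ → M), modelsOf T₀ M ∧
      ∀ β : Atom L, Atom.Holds v β ↔ β ∈ Q := by
  classical
  have key : ∀ S : Finset (Atom L), ∃ (M : Type) (_ : L.Structure M) (v : ℕ → M),
      modelsOf T₀ M ∧ ∀ β ∈ S, (Atom.Holds v β ↔ β ∈ Q) := by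
    intro S
    by_contra hS
    -- If no model agrees with `Q` on `S`, then the atoms of `S` in `Q` entail the disjunction of
    -- those outside. Convexity picks one disjunct, which closedness puts into `Q`. Adding `δ` keeps
    -- the disjunction nonempty.
    have h := hconv (S.filter (· ∈ Q)).toList (δ :: (S.filter (· ∉ Q)).toList) (by simp) (by simp)
      (by
        intro M _ hM v hv
        by_contra hno
        apply hS
        refine ⟨M, inferInstance, v, hM, fun β hβ => ⟨fun h => ?_, fun h => hv β (by simp [hβ, h])⟩⟩
        by_contra hβQ
        exact hno ⟨β, by simp [hβ, hβQ], h⟩)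
    obtain ⟨δ', hδ', hent⟩ := h
    have hmem : δ' ∈ Q := hQ _ _ (by simp) hent
    rcases List.mem_cons.1 hδ' with rfl | h'
    · exact hδ hmem
    · simp only [Finset.mem_toList, Finset.mem_filter] at h'
      exact h'.2 hmem
  choose M inst v hM hv using key
  -- Each atom belongs to all sufficiently large finite sets, so along an ultrafilter refining
  -- `atTop` almost every factor agrees with `Q` on it; Łoś's theorem transfers this to the
  -- ultraproduct.
  let u : Ultrafilter (Finset (Atom L)) := Ultrafilter.of Filter.atTop
  have hu : (u : Filter (Finset (Atom L))) ≤ Filter.atTop := Ultrafilter.of_le _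
  have : ∀ S, Nonempty (M S) := fun S => (hM S).1
  refine ⟨(u : Filter (Finset (Atom L))).Product M, inferInstance,
    fun c => ((fun S => v S c : ∀ S, M S) : (u : Filter (Finset (Atom L))).Product M),
    ⟨inferInstance, ⟨fun φ hφ => ?_⟩⟩, fun β => ?_⟩
  · rw [Ultraproduct.sentence_realize]
    exact Filter.Eventually.of_forall fun S => (hM S).2.realize_of_mem φ hφ
  · refine ((Atom.realize_toFormula _ β).symm.trans
      (Ultraproduct.realize_formula_cast β.toFormula fun c S => v S c)).trans ?_
    have hev : ∀ᶠ S in (u : Filter (Finset (Atom L))),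
        (β.toFormula.Realize (fun c => v S c) ↔ β ∈ Q) := by
      filter_upwards [hu (Filter.mem_atTop {β})] with S hS
      rw [Atom.realize_toFormula]
      exact hv S β (by simpa using hS)
    rw [Filter.eventually_congr hev]
    exact Filter.eventually_const

theorem mem_subterms_self (t : L.Term ℕ) : t ∈ subterms t := by
  cases t <;> simp [subterms]

theorem mem_subterms_func {n : ℕ} {f : L.Functions n} {ts : Fin n → L.Term ℕ} {s : L.Term ℕ} :
    s ∈ subterms (Term.func f ts) ↔ s = Term.func f ts ∨ ∃ i, s ∈ subterms (ts i) := by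
  simp [subterms]

theorem subterms_trans {r s t : L.Term ℕ} (h : r ∈ subterms s) (h' : s ∈ subterms t) :
    r ∈ subterms t := by
  induction t with
  | var x =>
    simp only [subterms, Set.mem_singleton_iff] at h'
    rwa [h'] at h
  | func f ts ih =>
    rcases mem_subterms_func.1 h' with rfl | ⟨i, hi⟩
    · exact h
    · exact mem_subterms_func.2 (Or.inr ⟨i, ih i hi⟩)

theorem mem_subterms_arg {n : ℕ} (f : L.Functions n) (ts : Fin n → L.Term ℕ) (i : Fin n) :
    ts i ∈ subterms (Term.func f ts) :=
  mem_subterms_func.2 (Or.inr ⟨i, mem_subterms_self _⟩)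

theorem finite_subterms (t : L.Term ℕ) : (subterms t).Finite := by
  induction t with
  | var x => simp [subterms]
  | func f ts ih => exact (Set.finite_singleton _).union (Set.finite_iUnion ih)

/-- The arguments of an atom. -/
def Atom.args : Atom L → Set (L.Term ℕ)
  | Sum.inl (s, t) => {s, t}
  | Sum.inr ⟨_, ts⟩ => Set.range ts

theorem Atom.mem_terms {α : Atom L} {s : L.Term ℕ} :
    s ∈ α.terms ↔ ∃ t ∈ α.args, s ∈ subterms t := by
  rcases α with ⟨s, t⟩ | ⟨R, ts⟩ <;> simp [Atom.terms, Atom.args]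

theorem Atom.finite_terms (α : Atom L) : α.terms.Finite := by
  rcases α with ⟨s, t⟩ | ⟨R, ts⟩
  · exact (finite_subterms s).union (finite_subterms t)
  · exact Set.finite_iUnion fun i => finite_subterms (ts i)

theorem finite_atomsTerms (A : List (Atom L)) : (atomsTerms A).Finite := by
  have := (List.finite_toSet A).biUnion fun α _ => Atom.finite_terms α
  simpa [atomsTerms] using this

theorem mem_atomsTerms {A : List (Atom L)} {t : L.Term ℕ} :
    t ∈ atomsTerms A ↔ ∃ α ∈ A, t ∈ Atom.terms α := by
  simp [atomsTerms]

theorem subterms_subset_atomsTerms {A : List (Atom L)} {t : L.Term ℕ} (h : t ∈ atomsTerms A) :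
    subterms t ⊆ atomsTerms A := by
  intro s hs
  obtain ⟨α, hα, ht⟩ := mem_atomsTerms.1 h
  obtain ⟨r, hr, hr'⟩ := Atom.mem_terms.1 ht
  exact mem_atomsTerms.2 ⟨α, hα, Atom.mem_terms.2 ⟨r, hr, subterms_trans hs hr'⟩⟩

theorem mem_consts_var {c d : ℕ} : c ∈ constsIn (subterms (Term.var d : L.Term ℕ)) ↔ c = d := by
  simp [constsIn, subterms]

theorem mem_consts_func {n : ℕ} {f : L.Functions n} {ts : Fin n → L.Term ℕ} {c : ℕ} :
    c ∈ constsIn (subterms (Term.func f ts)) ↔ ∃ i, c ∈ constsIn (subterms (ts i)) := by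
  simp [constsIn, subterms]

theorem mem_symbols_func {n : ℕ} {f : L.Functions n} {ts : Fin n → L.Term ℕ}
    {s : Σ n, L.Functions n} :
    s ∈ symbolsIn (subterms (Term.func f ts)) ↔
      s = ⟨n, f⟩ ∨ ∃ i, s ∈ symbolsIn (subterms (ts i)) := by
  obtain ⟨m, g⟩ := s
  simp only [symbolsIn, subterms, Set.mem_ofPred_eq, Set.mem_union, Set.mem_singleton_iff,
    Set.mem_iUnion, exists_or]
  constructor
  · rintro (⟨us, h⟩ | ⟨us, i, h⟩)
    · left; cases h; rfl
    · exact Or.inr ⟨i, us, h⟩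
  · rintro (h | ⟨i, us, h⟩)
    · left; cases h; exact ⟨ts, rfl⟩
    · exact Or.inr ⟨us, i, h⟩

theorem symbols_var (c : ℕ) : symbolsIn (subterms (Term.var c : L.Term ℕ)) = ∅ := by
  ext s; simp [symbolsIn, subterms]

theorem mem_consts_subst {t : L.Term ℕ} {σ : ℕ → L.Term ℕ} {c : ℕ} :
    c ∈ constsIn (subterms (t.subst σ)) ↔
      ∃ d ∈ constsIn (subterms t), c ∈ constsIn (subterms (σ d)) := by
  induction t with
  | var x => simp [Term.subst, mem_consts_var]
  | func f ts ih =>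
    simp only [Term.subst, mem_consts_func, ih]
    constructor
    · rintro ⟨i, d, h, h'⟩; exact ⟨d, ⟨i, h⟩, h'⟩
    · rintro ⟨d, ⟨i, h⟩, h'⟩; exact ⟨i, d, h, h'⟩

theorem mem_symbols_subst {t : L.Term ℕ} {σ : ℕ → L.Term ℕ} {s : Σ n, L.Functions n} :
    s ∈ symbolsIn (subterms (t.subst σ)) ↔ s ∈ symbolsIn (subterms t) ∨
      ∃ d ∈ constsIn (subterms t), s ∈ symbolsIn (subterms (σ d)) := by
  induction t with
  | var x => simp [Term.subst, mem_consts_var, symbols_var]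
  | func f ts ih =>
    simp only [Term.subst, mem_consts_func, mem_symbols_func, ih]
    constructor
    · rintro (h | ⟨i, h | ⟨d, h, h'⟩⟩)
      · exact Or.inl (Or.inl h)
      · exact Or.inl (Or.inr ⟨i, h⟩)
      · exact Or.inr ⟨d, ⟨i, h⟩, h'⟩
    · rintro ((h | ⟨i, h⟩) | ⟨d, ⟨i, h⟩, h'⟩)
      · exact Or.inl h
      · exact Or.inr ⟨i, Or.inl h⟩
      · exact Or.inr ⟨i, Or.inr ⟨d, h, h'⟩⟩

theorem subst_congr {t : L.Term ℕ} {σ τ : ℕ → L.Term ℕ}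
    (h : ∀ c ∈ constsIn (subterms t), σ c = τ c) : t.subst σ = t.subst τ := by
  induction t with
  | var x => exact h x (mem_consts_var.2 rfl)
  | func f ts ih =>
    simp only [Term.subst]
    congr 1
    funext i
    exact ih i fun c hc => h c (mem_consts_func.2 ⟨i, hc⟩)

theorem realize_congr {M : Type} [L.Structure M] {t : L.Term ℕ} {v w : ℕ → M}
    (h : ∀ c ∈ constsIn (subterms t), v c = w c) : t.realize v = t.realize w := by
  induction t with
  | var x => exact h x (mem_consts_var.2 rfl)
  | func f ts ih =>
    simp only [Term.realize]
    congr 1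
    funext i
    exact ih i fun c hc => h c (mem_consts_func.2 ⟨i, hc⟩)

theorem mem_consts_atomTerms {α : Atom L} {c : ℕ} :
    c ∈ constsIn α.terms ↔ ∃ t ∈ α.args, c ∈ constsIn (subterms t) := by
  simp only [constsIn, Set.mem_ofPred_eq, Atom.mem_terms]

theorem Atom.subst_congr {α : Atom L} {σ τ : ℕ → L.Term ℕ}
    (h : ∀ c ∈ constsIn α.terms, σ c = τ c) : α.subst σ = α.subst τ := by
  have h' : ∀ t ∈ α.args, t.subst σ = t.subst τ := fun t ht =>
    LocalInterp.subst_congr fun c hc => h c (mem_consts_atomTerms.2 ⟨t, ht, hc⟩)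
  rcases α with ⟨s, t⟩ | ⟨R, ts⟩
  · simp only [Atom.subst, h' s (by simp [Atom.args]), h' t (by simp [Atom.args])]
  · simp only [Atom.subst]
    congr 2
    funext i
    exact h' _ ⟨i, rfl⟩

theorem Atom.holds_subst {M : Type} [L.Structure M] {α : Atom L} {v : ℕ → M}
    {σ : ℕ → L.Term ℕ} : (α.subst σ).Holds v ↔ α.Holds fun c => (σ c).realize v := by
  rcases α with ⟨s, t⟩ | ⟨R, ts⟩ <;> simp [Atom.subst, Atom.Holds, Term.realize_subst]

theorem Literal.holds_subst {M : Type} [L.Structure M] {l : Literal L} {v : ℕ → M}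
    {σ : ℕ → L.Term ℕ} : Literal.Holds v (l.1, Atom.subst σ l.2) ↔
      Literal.Holds (fun c => (σ c).realize v) l := by
  simp only [Literal.Holds, Atom.holds_subst]

theorem Clause.holds_subst {M : Type} [L.Structure M] {D : Clause L} {v : ℕ → M}
    {σ : ℕ → L.Term ℕ} : (D.subst σ).Holds v ↔ D.Holds fun c => (σ c).realize v := by
  simp only [Clause.Holds, Clause.subst, List.mem_map]
  constructor
  · rintro ⟨_, ⟨l, hl, rfl⟩, h⟩
    exact ⟨l, hl, Literal.holds_subst.1 h⟩
  · rintro ⟨l, hl, h⟩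
    exact ⟨_, ⟨l, hl, rfl⟩, Literal.holds_subst.2 h⟩

theorem BinRel.holds_atom {M : Type} [L.Structure M] {R : BinRel L} {v : ℕ → M}
    {s t : L.Term ℕ} : (R.atom s t).Holds v ↔ R.Rel M (s.realize v) (t.realize v) := by
  cases R with
  | none => rfl
  | some r =>
    simp only [BinRel.atom, Atom.Holds, BinRel.Rel]
    apply iff_of_eq
    congr 1
    funext i
    fin_cases i <;> rfl

theorem BinRel.args_atom {R : BinRel L} {s t : L.Term ℕ} : (R.atom s t).args = {s, t} := by
  cases R with
  | none => rfl
  | some r => simp [BinRel.atom, Atom.args, Set.pair_comm]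

theorem BinRel.sym_atom {R : BinRel L} {s t : L.Term ℕ} : (R.atom s t).sym = R.sym := by
  cases R <;> rfl

theorem BinRel.subst_atom {R : BinRel L} {s t : L.Term ℕ} {σ : ℕ → L.Term ℕ} :
    (R.atom s t).subst σ = R.atom (s.subst σ) (t.subst σ) := by
  cases R with
  | none => rfl
  | some r =>
    simp only [BinRel.atom, Atom.subst]
    congr 2
    funext i
    fin_cases i <;> rfl

end Base

/-! ### Base atoms in the extended signature, expansions of base models, and locality. -/

section Extension

variable {L : FirstOrder.Language.{0, 0}} {F : ℕ → Type}

/-- The inclusion of base atoms. -/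
def Atom.lift (F : ℕ → Type) : Atom L → Atom (extLang L F)
  | Sum.inl (s, t) => Sum.inl ((baseHom L F).onTerm s, (baseHom L F).onTerm t)
  | Sum.inr ⟨R, ts⟩ => Sum.inr ⟨R, fun i => (baseHom L F).onTerm (ts i)⟩

/-- A base atom whose constants are replaced by terms of the extended signature. -/
def Atom.trans (θ : ℕ → (extLang L F).Term ℕ) (β : Atom L) : Atom (extLang L F) :=
  (β.lift F).subst θ

/-- A base clause whose constants are replaced by terms of the extended signature. -/
def Clause.trans (θ : ℕ → (extLang L F).Term ℕ) (D : Clause L) : Clause (extLang L F) :=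
  D.map fun l => (l.1, Atom.trans θ l.2)

/-- The base atom in which every argument is named by a constant. -/
def nameAtom (e : (extLang L F).Term ℕ → ℕ) : Atom (extLang L F) → Atom L
  | Sum.inl (s, t) => Sum.inl (Term.var (e s), Term.var (e t))
  | Sum.inr ⟨R, ts⟩ => Sum.inr ⟨R, fun i => Term.var (e (ts i))⟩

/-- The reduct to the base signature. -/
abbrev baseStr (L : FirstOrder.Language.{0, 0}) (F : ℕ → Type) (M : Type)
    [(extLang L F).Structure M] : L.Structure M := (baseHom L F).reduct M

theorem realize_lift {M : Type} [(extLang L F).Structure M] (v : ℕ → M) (t : L.Term ℕ) :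
    ((baseHom L F).onTerm t).realize v = @Term.realize L M (baseStr L F M) ℕ v t := by
  induction t with
  | var x => rfl
  | func f ts ih =>
    simp only [LHom.onTerm, Term.realize, ih]
    rfl

theorem consts_lift (t : L.Term ℕ) :
    constsIn (subterms ((baseHom L F).onTerm t)) = constsIn (subterms t) := by
  ext c
  induction t with
  | var x => simp only [LHom.onTerm, mem_consts_var]
  | func f ts ih => simp only [LHom.onTerm, mem_consts_func, ih]

theorem mem_symbols_lift {t : L.Term ℕ} {s : Σ n, (extLang L F).Functions n}
    (h : s ∈ symbolsIn (subterms ((baseHom L F).onTerm t))) :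
    ∃ (n : ℕ) (f : L.Functions n), s = ⟨n, Sum.inl f⟩ := by
  induction t with
  | var x => simp [LHom.onTerm, symbols_var] at h
  | func f ts ih =>
    rcases mem_symbols_func.1 h with rfl | ⟨i, h⟩
    · exact ⟨_, f, rfl⟩
    · exact ih i h

theorem holds_lift {M : Type} [(extLang L F).Structure M] (v : ℕ → M) (β : Atom L) :
    (β.lift F).Holds v ↔ @Atom.Holds L M (baseStr L F M) v β := by
  rcases β with ⟨s, t⟩ | ⟨R, ts⟩
  · simp only [Atom.lift, Atom.Holds, realize_lift]
  · simp only [Atom.lift, Atom.Holds, realize_lift]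
    rfl

/-- Truth of a translated atom is truth in the base reduct under the assignment sending each
constant to the value of its term. All passages between the two signatures rest on this. -/
theorem holds_trans {M : Type} [(extLang L F).Structure M] {v : ℕ → M} {β : Atom L}
    {θ : ℕ → (extLang L F).Term ℕ} :
    (β.trans θ).Holds v ↔ @Atom.Holds L M (baseStr L F M) (fun c => (θ c).realize v) β := by
  rw [Atom.trans, Atom.holds_subst, holds_lift]

theorem consts_lift_atom (β : Atom L) : constsIn (β.lift F).terms = constsIn β.terms := by
  ext c
  rcases β with ⟨s, t⟩ | ⟨R, ts⟩
  · simp [mem_consts_atomTerms, Atom.lift, Atom.args, consts_lift]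
  · simp only [mem_consts_atomTerms, Atom.lift, Atom.args, Set.exists_range_iff, consts_lift]

theorem trans_congr {β : Atom L} {θ θ' : ℕ → (extLang L F).Term ℕ}
    (h : ∀ c ∈ constsIn β.terms, θ c = θ' c) : β.trans θ = β.trans θ' :=
  Atom.subst_congr fun c hc => h c (by rwa [consts_lift_atom] at hc)

theorem BinRel.rel_ext {M : Type} [(extLang L F).Structure M] {R : BinRel L} {x y : M} :
    (BinRel.ext F R).Rel M x y ↔ @BinRel.Rel L R M (baseStr L F M) x y := by
  cases R <;> rfl

theorem nameAtom_atom {R : BinRel L} {s t : (extLang L F).Term ℕ}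
    {e : (extLang L F).Term ℕ → ℕ} :
    nameAtom e ((BinRel.ext F R).atom s t) = R.atom (Term.var (e s)) (Term.var (e t)) := by
  cases R with
  | none => rfl
  | some r =>
    simp only [BinRel.atom, nameAtom, BinRel.ext]
    congr 2
    funext i
    fin_cases i <;> rfl

/-- Naming hides all function symbols of the arguments, and substituting the named terms restores
them; hence a purely relational base atom carries the full content of the original one. -/
theorem trans_nameAtom {e : (extLang L F).Term ℕ → ℕ} {ε : ℕ → (extLang L F).Term ℕ}
    (hε : ∀ t, ε (e t) = t) (α : Atom (extLang L F)) : (nameAtom e α).trans ε = α := by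
  rcases α with ⟨s, t⟩ | ⟨R, ts⟩
  · simp [nameAtom, Atom.trans, Atom.lift, Atom.subst, LHom.onTerm, Term.subst, hε]
  · simp [nameAtom, Atom.trans, Atom.lift, Atom.subst, LHom.onTerm, Term.subst, hε]

theorem holds_nameAtom {M : Type} [(extLang L F).Structure M] {v w : ℕ → M}
    {e : (extLang L F).Term ℕ → ℕ} {α : Atom (extLang L F)}
    (h : ∀ t ∈ α.args, t.realize w = v (e t)) :
    α.Holds w ↔ @Atom.Holds L M (baseStr L F M) v (nameAtom e α) := by
  rcases α with ⟨s, t⟩ | ⟨R, ts⟩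
  · simp only [nameAtom, Atom.Holds, Term.realize, h s (by simp [Atom.args]),
      h t (by simp [Atom.args])]
  · simp only [nameAtom, Atom.Holds, Term.realize, h _ ⟨_, rfl⟩]
    rfl

/-- Expand a model of the base theory, in which terms are named by constants, by interpretations
of the extension functions. -/
theorem exists_expansion {N : Set ((extLang L F).Term ℕ)}
    (hN : ∀ (n : ℕ) (f : (extLang L F).Functions n) ts,
      (Term.func f ts : (extLang L F).Term ℕ) ∈ N → ∀ i, ts i ∈ N)
    (e : (extLang L F).Term ℕ → ℕ) (M : Type) [S : L.Structure M] (v : ℕ → M)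
    (hbase : ∀ (n : ℕ) (f : L.Functions n) ts,
      (Term.func (L := extLang L F) (Sum.inl f) ts) ∈ N →
      v (e (Term.func (L := extLang L F) (Sum.inl f) ts)) =
        Structure.funMap f fun i => v (e (ts i)))
    (hcong : ∀ (n : ℕ) (f : F n) ts ts', (Term.func (L := extLang L F) (Sum.inr f) ts) ∈ N →
      (Term.func (L := extLang L F) (Sum.inr f) ts') ∈ N →
      (∀ i, v (e (ts i)) = v (e (ts' i))) →
      v (e (Term.func (L := extLang L F) (Sum.inr f) ts)) =
        v (e (Term.func (L := extLang L F) (Sum.inr f) ts'))) :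
    ∃ S' : (extLang L F).Structure M, @baseStr L F M S' = S ∧
      ∀ t ∈ N, t.realize (fun c => v (e (Term.var c))) = v (e t) := by
  classical
  -- A tuple of values that comes from the arguments of a named term gets the value of that term's
  -- name. The choice of the term is harmless by `hcong`; off such tuples the default `v 0` is
  -- arbitrary.
  let ev : ∀ n, F n → (Fin n → M) → M := fun n f m =>
    if h : ∃ ts, (Term.func (L := extLang L F) (Sum.inr f) ts) ∈ N ∧ ∀ i, v (e (ts i)) = m i then
      v (e (Term.func (L := extLang L F) (Sum.inr f) h.choose)) else v 0
  let S' : (extLang L F).Structure M :=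
    { funMap := fun {n} f m => Sum.elim (fun g => S.funMap g m) (fun g => ev n g m) f
      RelMap := fun {n} r m => S.RelMap r m }
  refine ⟨S', rfl, fun t ht => ?_⟩
  induction t with
  | var x => rfl
  | @func n f ts ih =>
    have ih' := fun i => ih i (hN _ _ _ ht i)
    simp only [Term.realize, ih']
    rcases f with f | f
    · exact (hbase _ f ts ht).symm
    · have hex : ∃ us, (Term.func (L := extLang L F) (Sum.inr f) us) ∈ N ∧
          ∀ i, v (e (us i)) = v (e (ts i)) := ⟨ts, ht, fun _ => rfl⟩
      change ev _ f (fun i => v (e (ts i))) = _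
      simp only [ev, dif_pos hex]
      exact hcong _ f _ _ hex.choose_spec.1 ht hex.choose_spec.2

/-- Given a set `Q` of base atoms about named terms that is closed under entailment in `T₀`,
respects the function symbols, and satisfies the clauses in `H`, there is a model of `H`. -/
theorem satisfiable_of_closed {T₀ : L.Theory} (hconv : ConvexTheory (modelsOf T₀))
    {N : Set ((extLang L F).Term ℕ)}
    (hN : ∀ (n : ℕ) (f : (extLang L F).Functions n) ts,
      (Term.func f ts : (extLang L F).Term ℕ) ∈ N → ∀ i, ts i ∈ N)
    (e : (extLang L F).Term ℕ → ℕ) {Q : Set (Atom L)}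
    (hQ : ∀ (Γ : List (Atom L)) (β : Atom L), (∀ γ ∈ Γ, γ ∈ Q) →
      Entails (modelsOf T₀) Γ β → β ∈ Q)
    {δ : Atom L} (hδ : δ ∉ Q)
    (hbase : ∀ (n : ℕ) (f : L.Functions n) ts,
      (Term.func (L := extLang L F) (Sum.inl f) ts) ∈ N →
      (Sum.inl (Term.var (e (Term.func (L := extLang L F) (Sum.inl f) ts)),
        Term.func f fun i => Term.var (e (ts i))) : Atom L) ∈ Q)
    (hcong : ∀ (n : ℕ) (f : F n) ts ts', (Term.func (L := extLang L F) (Sum.inr f) ts) ∈ N →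
      (Term.func (L := extLang L F) (Sum.inr f) ts') ∈ N →
      (∀ i, (Sum.inl (Term.var (e (ts i)), Term.var (e (ts' i))) : Atom L) ∈ Q) →
      (Sum.inl (Term.var (e (Term.func (L := extLang L F) (Sum.inr f) ts)),
        Term.var (e (Term.func (L := extLang L F) (Sum.inr f) ts'))) : Atom L) ∈ Q)
    {H : Set (Clause (extLang L F))}
    (hH : ∀ D ∈ H, (∀ l ∈ D, l.2.args ⊆ N) ∧ ∃ l ∈ D, nameAtom e l.2 ∈ Q ↔ l.1 = true) :
    Satisfiable (extModels T₀ ∅) H := by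
  obtain ⟨M, S, v, hM, hv⟩ := exists_model_of_closed hconv hQ hδ
  obtain ⟨S', hS', ht⟩ := exists_expansion hN e M v
    (fun n f ts h => (hv _).2 (hbase n f ts h))
    (fun n f ts ts' h h' heq => (hv _).2 (hcong n f ts ts' h h' fun i => (hv _).1 (heq i)))
  subst hS'
  refine ⟨M, S', fun c => v (e (Term.var c)), ⟨hM, by simp⟩, fun D hD => ?_⟩
  obtain ⟨hargs, l, hl, h⟩ := hH D hD
  refine ⟨l, hl, ?_⟩
  have := (holds_nameAtom (fun t htt => ht t (hargs l hl htt))).trans (hv _)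
  rcases l with ⟨b, α⟩
  cases b
  · simp only [Literal.Holds, this]
    simpa using h
  · simp only [Literal.Holds, this]
    simpa using h

/-- The hierarchical form of the satisfiability criterion in a local extension. -/
theorem satisfiable_of_local {T₀ : L.Theory} (hconv : ConvexTheory (modelsOf T₀))
    {K : Set (Clause (extLang L F))}
    {Ψ : Set ((extLang L F).Term ℕ) → Set ((extLang L F).Term ℕ)} (hloc : PsiLocal T₀ K Ψ)
    {N : Set ((extLang L F).Term ℕ)}
    (hN : ∀ (n : ℕ) (f : (extLang L F).Functions n) ts,
      (Term.func f ts : (extLang L F).Term ℕ) ∈ N → ∀ i, ts i ∈ N)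
    (e : (extLang L F).Term ℕ → ℕ) {Q : Set (Atom L)}
    (hQ : ∀ (Γ : List (Atom L)) (β : Atom L), (∀ γ ∈ Γ, γ ∈ Q) →
      Entails (modelsOf T₀) Γ β → β ∈ Q)
    {δ : Atom L} (hδ : δ ∉ Q)
    (hbase : ∀ (n : ℕ) (f : L.Functions n) ts,
      (Term.func (L := extLang L F) (Sum.inl f) ts) ∈ N →
      (Sum.inl (Term.var (e (Term.func (L := extLang L F) (Sum.inl f) ts)),
        Term.func f fun i => Term.var (e (ts i))) : Atom L) ∈ Q)
    (hcong : ∀ (n : ℕ) (f : F n) ts ts', (Term.func (L := extLang L F) (Sum.inr f) ts) ∈ N →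
      (Term.func (L := extLang L F) (Sum.inr f) ts') ∈ N →
      (∀ i, (Sum.inl (Term.var (e (ts i)), Term.var (e (ts' i))) : Atom L) ∈ Q) →
      (Sum.inl (Term.var (e (Term.func (L := extLang L F) (Sum.inr f) ts)),
        Term.var (e (Term.func (L := extLang L F) (Sum.inr f) ts'))) : Atom L) ∈ Q)
    {G : List (Clause (extLang L F))}
    (hG : ∀ D ∈ G, (∀ l ∈ D, l.2.args ⊆ N) ∧ ∃ l ∈ D, nameAtom e l.2 ∈ Q ↔ l.1 = true)
    (hK : ∀ D ∈ instances K (Ψ (est K G)),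
      (∀ l ∈ D, l.2.args ⊆ N) ∧ ∃ l ∈ D, nameAtom e l.2 ∈ Q ↔ l.1 = true) :
    Satisfiable (extModels T₀ K) {D | D ∈ G} := by
  by_contra h
  -- This is the nontrivial direction of locality: a model of the selected instances and `G`
  -- suffices for a model of all of `K` and `G`.
  refine (hloc G).1 h (satisfiable_of_closed hconv hN e hQ hδ hbase hcong fun D hD => ?_)
  rcases hD with hD | hD
  · exact hK D hD
  · exact hG D hD

theorem subst_varApp {n : ℕ} (f : F n) (x : Fin n → ℕ) (σ : ℕ → (extLang L F).Term ℕ) :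
    (varApp f x : (extLang L F).Term ℕ).subst σ =
      Term.func (L := extLang L F) (Sum.inr f) fun i => σ (x i) := rfl

theorem mem_subst_compClause {n : ℕ} {f g : F n} {Rs : Fin n → BinRel L} {R : BinRel L}
    {x y : Fin n → ℕ} {s : Fin n → (extLang L F).Term ℕ} {σ : ℕ → (extLang L F).Term ℕ}
    {l : Literal (extLang L F)} :
    l ∈ Clause.subst σ (compClause f g Rs R x y s) ↔
      (∃ i, l = (false, (BinRel.ext F (Rs i)).atom (σ (x i)) ((s i).subst σ))) ∨
      l = (true, (BinRel.ext F R).atom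
        (Term.func (L := extLang L F) (Sum.inr f) fun i => σ (x i))
        (Term.func (L := extLang L F) (Sum.inr g) fun i => σ (y i))) := by
  simp only [Clause.subst, compClause, List.mem_map, List.mem_append, List.mem_ofFn,
    List.mem_singleton]
  constructor
  · rintro ⟨l', ⟨i, rfl⟩ | rfl, rfl⟩
    · exact Or.inl ⟨i, by rw [BinRel.subst_atom]; rfl⟩
    · exact Or.inr (by rw [BinRel.subst_atom]; rfl)
  · rintro (⟨i, rfl⟩ | rfl)
    · exact ⟨_, Or.inl ⟨i, rfl⟩, by rw [BinRel.subst_atom]; rfl⟩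
    · exact ⟨_, Or.inr rfl, by rw [BinRel.subst_atom]; rfl⟩

theorem holds_compClause {M : Type} [(extLang L F).Structure M] {n : ℕ} {f g : F n}
    {Rs : Fin n → BinRel L} {R : BinRel L} {x y : Fin n → ℕ}
    {s : Fin n → (extLang L F).Term ℕ} {v : ℕ → M} :
    Clause.Holds v (compClause f g Rs R x y s) ↔
      ((∀ i, (BinRel.ext F (Rs i)).Rel M (v (x i)) ((s i).realize v)) →
        (BinRel.ext F R).Rel M ((varApp f x : (extLang L F).Term ℕ).realize v)
          ((varApp g y : (extLang L F).Term ℕ).realize v)) := by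
  simp only [Clause.Holds, compClause, List.mem_append, List.mem_ofFn, List.mem_singleton]
  constructor
  · rintro ⟨l, ⟨i, rfl⟩ | rfl, h⟩ hp
    · simp only [Literal.Holds, BinRel.holds_atom] at h
      exact absurd (hp i) (by simpa using h)
    · simpa [Literal.Holds, BinRel.holds_atom] using h
  · intro h
    by_cases hp : ∀ i, (BinRel.ext F (Rs i)).Rel M (v (x i)) ((s i).realize v)
    · exact ⟨_, Or.inr rfl, by simpa [Literal.Holds, BinRel.holds_atom] using h hp⟩
    · push Not at hp
      obtain ⟨i, hi⟩ := hp
      exact ⟨_, Or.inl ⟨i, rfl⟩, by simpa [Literal.Holds, BinRel.holds_atom] using hi⟩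

end Extension

/-! ### Naming of terms and convexity of the extension. -/

section Extension

variable {L : FirstOrder.Language.{0, 0}} {F : ℕ → Type}

/-- Terms can be named by constants, keeping two given constants fixed. -/
theorem exists_naming [Countable (Σ n, (extLang L F).Functions n)] (a b : ℕ) :
    ∃ (e : (extLang L F).Term ℕ → ℕ) (ε : ℕ → (extLang L F).Term ℕ),
      (∀ t, ε (e t) = t) ∧ e (Term.var a) = a ∧ e (Term.var b) = b := by
  classical
  obtain ⟨enc, henc⟩ := Countable.exists_injective_nat ((extLang L F).Term ℕ)
  -- Constants below `N`, in particular `a` and `b`, name themselves; all other terms receive names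
  -- from `N` on, so the two ranges cannot collide.
  let N := max a b + 1
  let e : (extLang L F).Term ℕ → ℕ := fun t =>
    if h : ∃ c, c < N ∧ t = Term.var c then h.choose else N + enc t
  have hvar : ∀ c, c < N → e (Term.var c) = c := by
    intro c hc
    have h : ∃ d, d < N ∧ (Term.var c : (extLang L F).Term ℕ) = Term.var d := ⟨c, hc, rfl⟩
    simp only [e, dif_pos h]
    have := h.choose_spec.2
    injection this with this
    exact this.symm
  have hinj : Function.Injective e := by
    intro s t hst
    by_cases hs : ∃ c, c < N ∧ s = Term.var c <;> by_cases ht : ∃ c, c < N ∧ t = Term.var c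
    · obtain ⟨c, hc, rfl⟩ := hs
      obtain ⟨d, hd, rfl⟩ := ht
      rw [hvar c hc, hvar d hd] at hst
      rw [hst]
    · obtain ⟨c, hc, rfl⟩ := hs
      rw [hvar c hc] at hst
      simp only [e, dif_neg ht] at hst
      omega
    · obtain ⟨c, hc, rfl⟩ := ht
      rw [hvar c hc] at hst
      simp only [e, dif_neg hs] at hst
      omega
    · simp only [e, dif_neg hs, dif_neg ht] at hst
      exact henc (by omega)
  exact ⟨e, Function.invFun e, Function.leftInverse_invFun hinj, hvar a (by omega),
    hvar b (by omega)⟩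

/-- Since the clauses are Horn, closure of `Q` under the implication produces a literal that `Q`
makes true: the head if all premises are in `Q`, otherwise the negation of a premise outside `Q`. -/
theorem instance_of_compClause {e : (extLang L F).Term ℕ → ℕ} {Q : Set (Atom L)}
    {N : Set ((extLang L F).Term ℕ)} {n : ℕ} {f g : F n} {Rs : Fin n → BinRel L} {R : BinRel L}
    {x y : Fin n → ℕ} {s : Fin n → (extLang L F).Term ℕ} {σ : ℕ → (extLang L F).Term ℕ}
    (hf : (Term.func (L := extLang L F) (Sum.inr f) fun i => σ (x i)) ∈ N)
    (hg : (Term.func (L := extLang L F) (Sum.inr g) fun i => σ (y i)) ∈ N)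
    (hx : ∀ i, σ (x i) ∈ N) (hs : ∀ i, (s i).subst σ ∈ N)
    (h : (∀ i, (Rs i).atom (Term.var (e (σ (x i)))) (Term.var (e ((s i).subst σ))) ∈ Q) →
      R.atom (Term.var (e (Term.func (L := extLang L F) (Sum.inr f) fun i => σ (x i))))
        (Term.var (e (Term.func (L := extLang L F) (Sum.inr g) fun i => σ (y i)))) ∈ Q) :
    (∀ l ∈ Clause.subst σ (compClause f g Rs R x y s), l.2.args ⊆ N) ∧
      ∃ l ∈ Clause.subst σ (compClause f g Rs R x y s), nameAtom e l.2 ∈ Q ↔ l.1 = true := by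
  constructor
  · intro l hl
    rcases mem_subst_compClause.1 hl with ⟨i, rfl⟩ | rfl
    · rw [BinRel.args_atom, Set.insert_subset_iff, Set.singleton_subset_iff]
      exact ⟨hx i, hs i⟩
    · rw [BinRel.args_atom, Set.insert_subset_iff, Set.singleton_subset_iff]
      exact ⟨hf, hg⟩
  · by_cases hp : ∀ i, (Rs i).atom (Term.var (e (σ (x i)))) (Term.var (e ((s i).subst σ))) ∈ Q
    · refine ⟨_, mem_subst_compClause.2 (Or.inr rfl), ?_⟩
      rw [nameAtom_atom]
      simpa using h hp
    · push Not at hp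
      obtain ⟨i, hi⟩ := hp
      refine ⟨_, mem_subst_compClause.2 (Or.inl ⟨i, rfl⟩), ?_⟩
      rw [nameAtom_atom]
      simpa using hi

/-- Closed sets of base atoms that contain `Γ` and avoid `Δ` give models of `Γ` and `¬ Δ`; all terms
are named here. -/
theorem satisfiable_of_saturated {T₀ : L.Theory} (hconv : ConvexTheory (modelsOf T₀))
    {K : Set (Clause (extLang L F))}
    {Ψ : Set ((extLang L F).Term ℕ) → Set ((extLang L F).Term ℕ)} (hloc : PsiLocal T₀ K Ψ)
    {P : Set (BinRel L)} (hform : MonCompForm T₀ P K)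
    (e : (extLang L F).Term ℕ → ℕ) {Q : Set (Atom L)}
    (hQ : ∀ (Γ : List (Atom L)) (β : Atom L), (∀ γ ∈ Γ, γ ∈ Q) →
      Entails (modelsOf T₀) Γ β → β ∈ Q)
    (hbase : ∀ (n : ℕ) (f : L.Functions n) ts,
      (Sum.inl (Term.var (e (Term.func (L := extLang L F) (Sum.inl f) ts)),
        Term.func f fun i => Term.var (e (ts i))) : Atom L) ∈ Q)
    (hcong : ∀ (n : ℕ) (f : F n) ts ts',
      (∀ i, (Sum.inl (Term.var (e (ts i)), Term.var (e (ts' i))) : Atom L) ∈ Q) →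
      (Sum.inl (Term.var (e (Term.func (L := extLang L F) (Sum.inr f) ts)),
        Term.var (e (Term.func (L := extLang L F) (Sum.inr f) ts'))) : Atom L) ∈ Q)
    (hK : ∀ (n : ℕ) (f g : F n) Rs R x y s, compClause f g Rs R x y s ∈ K → ∀ σ,
      (∀ i, (Rs i).atom (Term.var (e (σ (x i)))) (Term.var (e ((s i).subst σ))) ∈ Q) →
      R.atom (Term.var (e (Term.func (L := extLang L F) (Sum.inr f) fun i => σ (x i))))
        (Term.var (e (Term.func (L := extLang L F) (Sum.inr g) fun i => σ (y i)))) ∈ Q)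
    {Γ Δ : List (Atom (extLang L F))} (hΔ : Δ ≠ [])
    (hΓQ : ∀ γ ∈ Γ, nameAtom e γ ∈ Q) (hΔQ : ∀ δ ∈ Δ, nameAtom e δ ∉ Q) :
    ¬ EntailsDisj (extModels T₀ K) Γ Δ := by
  intro hent
  obtain ⟨δ, hδ⟩ := List.exists_mem_of_ne_nil Δ hΔ
  obtain ⟨M, S, v, hM, hv⟩ := satisfiable_of_local hconv hloc (N := Set.univ)
    (fun _ _ _ _ _ => trivial) e hQ (hΔQ δ hδ) (fun n f ts _ => hbase n f ts)
    (fun n f ts ts' _ _ => hcong n f ts ts')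
    (G := Γ.map (fun γ => [(true, γ)]) ++ Δ.map (fun δ => [(false, δ)]))
    (by
      intro D hD
      refine ⟨fun _ _ => Set.subset_univ _, ?_⟩
      rcases List.mem_append.1 hD with h | h
      · obtain ⟨γ, hγ, rfl⟩ := List.mem_map.1 h
        exact ⟨_, List.mem_singleton.2 rfl, by simpa using hΓQ γ hγ⟩
      · obtain ⟨γ, hγ, rfl⟩ := List.mem_map.1 h
        exact ⟨_, List.mem_singleton.2 rfl, by simpa using hΔQ γ hγ⟩)
    (by
      rintro _ ⟨D, hD, σ, rfl, -⟩
      obtain ⟨n, f, g, Rs, R, x, y, s, -, -, -, -, -, rfl, -⟩ := hform D hD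
      exact instance_of_compClause trivial trivial (fun _ => trivial) (fun _ => trivial)
        (hK n f g Rs R x y s hD σ))
  obtain ⟨δ', hδ', hh⟩ := hent M hM v fun γ hγ => by
    have := hv [(true, γ)] (List.mem_append_left _ (List.mem_map.2 ⟨γ, hγ, rfl⟩))
    simpa [Clause.Holds, Literal.Holds] using this
  have := hv [(false, δ')] (List.mem_append_right _ (List.mem_map.2 ⟨δ', hδ', rfl⟩))
  simp [Clause.Holds, Literal.Holds] at this
  exact this hh

theorem entails_trans_iff {T : Models (extLang L F)} {Γ : List (Atom (extLang L F))}
    {θ : ℕ → (extLang L F).Term ℕ} {β : Atom L} :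
    Entails T Γ (β.trans θ) ↔ ∀ (M : Type) [(extLang L F).Structure M], T M → ∀ v : ℕ → M,
      (∀ γ ∈ Γ, Atom.Holds v γ) →
      @Atom.Holds L M (baseStr L F M) (fun c => (θ c).realize v) β := by
  simp only [Entails, holds_trans]

theorem rel_of_mem {T₀ : L.Theory} {K : Set (Clause (extLang L F))} {M : Type}
    [(extLang L F).Structure M] (hM : extModels T₀ K M) {n : ℕ} {f g : F n}
    {Rs : Fin n → BinRel L} {R : BinRel L} {x y : Fin n → ℕ} {s : Fin n → (extLang L F).Term ℕ}
    (hD : compClause f g Rs R x y s ∈ K) (w : ℕ → M)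
    (h : ∀ i, @BinRel.Rel L (Rs i) M (baseStr L F M) (w (x i)) ((s i).realize w)) :
    @BinRel.Rel L R M (baseStr L F M)
      (Structure.funMap (L := extLang L F) (Sum.inr f : (extLang L F).Functions n) fun i => w (x i))
      (Structure.funMap (L := extLang L F) (Sum.inr g : (extLang L F).Functions n)
        fun i => w (y i)) :=
  BinRel.rel_ext.1 (holds_compClause.1 (hM.2 _ hD w) fun i => BinRel.rel_ext.2 (h i))

/-- Local extensions of convex theories by Horn clauses are convex. -/
theorem convex_extModels [Countable (Σ n, (extLang L F).Functions n)] {T₀ : L.Theory}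
    (hconv : ConvexTheory (modelsOf T₀)) {K : Set (Clause (extLang L F))}
    {Ψ : Set ((extLang L F).Term ℕ) → Set ((extLang L F).Term ℕ)} (hloc : PsiLocal T₀ K Ψ)
    {P : Set (BinRel L)} (hform : MonCompForm T₀ P K) : ConvexTheory (extModels T₀ K) := by
  intro Γ Δ hΔ _ hent
  by_contra hno
  push Not at hno
  obtain ⟨e, ε, hε, -, -⟩ := exists_naming (L := L) (F := F) 0 0
  refine satisfiable_of_saturated hconv hloc hform e
    -- With every term named, the entailed atoms form a closed set. If no disjunct were entailed,
    -- the model of this set would satisfy `Γ` and refute all of `Δ`.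
    (Q := {β | Entails (extModels T₀ K) Γ (β.trans ε)}) ?_ ?_ ?_ ?_ hΔ ?_ ?_ hent
  · intro Γ' β hΓ' hβ
    refine entails_trans_iff.2 fun M _ hM v hv => ?_
    exact @hβ M (baseStr L F M) hM.1 _ fun γ hγ => entails_trans_iff.1 (hΓ' γ hγ) M hM v hv
  · intro n f ts
    refine entails_trans_iff.2 fun M _ hM v hv => ?_
    simp only [Atom.Holds, Term.realize, hε]
    rfl
  · intro n f ts ts' h
    refine entails_trans_iff.2 fun M _ hM v hv => ?_
    have h' := fun i => entails_trans_iff.1 (h i) M hM v hv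
    simp only [Atom.Holds, Term.realize, hε] at h' ⊢
    simp only [h']
  · intro n f g Rs R x y s hD σ h
    refine entails_trans_iff.2 fun M _ hM v hv => ?_
    have h' := fun i => entails_trans_iff.1 (h i) M hM v hv
    simp only [BinRel.holds_atom, Term.realize, hε, Term.realize_subst] at h' ⊢
    exact rel_of_mem hM hD (fun c => (σ c).realize v) h'
  · intro γ hγ
    simp only [Set.mem_ofPred_eq, trans_nameAtom hε]
    exact fun M _ hM v hv => hv γ hγ
  · intro δ hδ
    simp only [Set.mem_ofPred_eq, trans_nameAtom hε]
    exact hno δ hδ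

end Extension

/-! ### Separated consequences and the interpolation of mixed instances. -/

section Extension

variable {L : FirstOrder.Language.{0, 0}} {F : ℕ → Type}

/-- The constants of `s` are in `C` and its extension functions in `Fs`. -/
def Gen (C : Set ℕ) (Fs : Set (Σ n, F n)) (s : (extLang L F).Term ℕ) : Prop :=
  constsIn (subterms s) ⊆ C ∧ extSymbolsIn (subterms s) ⊆ Fs

section Gen

variable {C : Set ℕ} {Fs : Set (Σ n, F n)}

theorem gen_var {c : ℕ} : Gen C Fs (Term.var c : (extLang L F).Term ℕ) ↔ c ∈ C := by
  simp only [Gen, Set.subset_def, mem_consts_var, extSymbolsIn, symbols_var]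
  simp

theorem gen_base {n : ℕ} {f : L.Functions n} {ts : Fin n → (extLang L F).Term ℕ} :
    Gen C Fs (Term.func (L := extLang L F) (Sum.inl f) ts) ↔ ∀ i, Gen C Fs (ts i) := by
  simp only [Gen, Set.subset_def, mem_consts_func, extSymbolsIn, Set.mem_ofPred_eq]
  constructor
  · rintro ⟨h, h'⟩ i
    exact ⟨fun c hc => h c ⟨i, hc⟩, fun s hs => h' s (mem_symbols_func.2 (Or.inr ⟨i, hs⟩))⟩
  · intro h
    refine ⟨fun c ⟨i, hi⟩ => (h i).1 c hi, fun s hs => ?_⟩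
    rcases mem_symbols_func.1 hs with h' | ⟨i, hi⟩
    · exfalso
      cases s
      cases h'
    · exact (h i).2 s hi

theorem gen_ext {n : ℕ} {f : F n} {ts : Fin n → (extLang L F).Term ℕ} :
    Gen C Fs (Term.func (L := extLang L F) (Sum.inr f) ts) ↔
      (⟨n, f⟩ : Σ n, F n) ∈ Fs ∧ ∀ i, Gen C Fs (ts i) := by
  simp only [Gen, Set.subset_def, mem_consts_func, extSymbolsIn, Set.mem_ofPred_eq]
  constructor
  · rintro ⟨h, h'⟩
    refine ⟨h' ⟨n, f⟩ (mem_symbols_func.2 (Or.inl rfl)), fun i => ?_⟩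
    exact ⟨fun c hc => h c ⟨i, hc⟩, fun s hs => h' s (mem_symbols_func.2 (Or.inr ⟨i, hs⟩))⟩
  · rintro ⟨hf, h⟩
    refine ⟨fun c ⟨i, hi⟩ => (h i).1 c hi, fun s hs => ?_⟩
    rcases mem_symbols_func.1 hs with h' | ⟨i, hi⟩
    · obtain ⟨m, g⟩ := s
      cases h'
      exact hf
    · exact (h i).2 s hi

theorem gen_arg {n : ℕ} {f : (extLang L F).Functions n} {ts : Fin n → (extLang L F).Term ℕ}
    (h : Gen C Fs (Term.func f ts)) (i : Fin n) : Gen C Fs (ts i) := by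
  rcases f with f | f
  · exact gen_base.1 h i
  · exact (gen_ext.1 h).2 i

/-- Base function symbols do not affect membership in a side. So a base interpolating term whose
constants all name terms of one side denotes a term of that side, which makes intermediate terms
usable on both. -/
theorem gen_subst {t₀ : L.Term ℕ} {ε : ℕ → (extLang L F).Term ℕ}
    (h : ∀ c ∈ constsIn (subterms t₀), Gen C Fs (ε c)) :
    Gen C Fs (((baseHom L F).onTerm t₀).subst ε) := by
  refine ⟨fun c hc => ?_, fun s hs => ?_⟩
  · obtain ⟨d, hd, hd'⟩ := mem_consts_subst.1 hc
    rw [consts_lift] at hd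
    exact (h d hd).1 hd'
  · rcases mem_symbols_subst.1 hs with h' | ⟨d, hd, hd'⟩
    · obtain ⟨n, f, hf⟩ := mem_symbols_lift h'
      exfalso
      cases s
      cases hf
    · rw [consts_lift] at hd
      exact (h d hd).2 hd'

end Gen

/-- The constants of the atoms in `l` name terms in `G`, and the atoms are satisfied by
all assignments of interest. -/
def PureList (e : (extLang L F).Term ℕ → ℕ) (V : Atom L → Prop)
    (G : (extLang L F).Term ℕ → Prop) (l : List (Atom L)) : Prop :=
  ∀ β ∈ l, V β ∧ ∀ c ∈ constsIn β.terms, ∃ s, c = e s ∧ G s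

/-- `β` follows in `T` from a separated set of atoms. -/
def Separated (T : Models L) (e : (extLang L F).Term ℕ → ℕ) (V : Atom L → Prop)
    (G₁ G₂ : (extLang L F).Term ℕ → Prop) (β : Atom L) : Prop :=
  ∃ A₀ B₀, PureList e V G₁ A₀ ∧ PureList e V G₂ B₀ ∧ Entails T (A₀ ++ B₀) β

section Separated

variable {T : Models L} {e : (extLang L F).Term ℕ → ℕ} {V : Atom L → Prop}
  {G₁ G₂ : (extLang L F).Term ℕ → Prop}

theorem PureList.append {G : (extLang L F).Term ℕ → Prop} {l l' : List (Atom L)}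
    (h : PureList e V G l) (h' : PureList e V G l') : PureList e V G (l ++ l') := fun β hβ =>
  (List.mem_append.1 hβ).elim (h β) (h' β)

theorem Separated.symm {β : Atom L} (h : Separated T e V G₁ G₂ β) :
    Separated T e V G₂ G₁ β := by
  obtain ⟨A₀, B₀, hA, hB, h⟩ := h
  exact ⟨B₀, A₀, hB, hA, fun M _ hM v hv => h M hM v fun γ hγ => hv γ (by
    rw [List.mem_append] at hγ ⊢; exact hγ.symm)⟩

theorem Separated.of_pure {β : Atom L} (hV : V β)
    (h : ∀ c ∈ constsIn β.terms, ∃ s, c = e s ∧ G₁ s) : Separated T e V G₁ G₂ β :=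
  ⟨[β], [], fun β' hβ' => by rw [List.mem_singleton.1 hβ']; exact ⟨hV, h⟩,
    fun β' hβ' => by simp at hβ', fun M _ hM v hv => hv β (by simp)⟩

/-- Finitely many separated atoms have a common separated set of hypotheses, obtained by
concatenation. This is the closedness needed to realize the separated atoms in a model of `T₀`. -/
theorem Separated.of_entails {Γ : List (Atom L)} {β : Atom L}
    (hΓ : ∀ γ ∈ Γ, Separated T e V G₁ G₂ γ) (hβ : Entails T Γ β) :
    Separated T e V G₁ G₂ β := by
  suffices h : ∃ A₀ B₀, PureList e V G₁ A₀ ∧ PureList e V G₂ B₀ ∧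
      ∀ γ ∈ Γ, Entails T (A₀ ++ B₀) γ by
    obtain ⟨A₀, B₀, hA, hB, h⟩ := h
    exact ⟨A₀, B₀, hA, hB, fun M _ hM v hv => hβ M hM v fun γ hγ => h γ hγ M hM v hv⟩
  clear hβ
  induction Γ with
  | nil => exact ⟨[], [], fun β hβ => by simp at hβ, fun β hβ => by simp at hβ, by simp⟩
  | cons γ Γ ih =>
    obtain ⟨A₀, B₀, hA, hB, h⟩ := ih fun γ' hγ' => hΓ γ' (List.mem_cons_of_mem _ hγ')
    obtain ⟨A₁, B₁, hA₁, hB₁, h₁⟩ := hΓ γ List.mem_cons_self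
    refine ⟨A₁ ++ A₀, B₁ ++ B₀, hA₁.append hA, hB₁.append hB, fun γ' hγ' => ?_⟩
    rcases List.mem_cons.1 hγ' with rfl | hγ'
    · exact fun M _ hM v hv => h₁ M hM v fun γ hγ => hv γ (by
        simp only [List.mem_append] at hγ ⊢; tauto)
    · exact fun M _ hM v hv => h γ' hγ' M hM v fun γ hγ => hv γ (by
        simp only [List.mem_append] at hγ ⊢; tauto)

end Separated

/-- `β`, with constants replaced twice by the terms they name, follows from `Γ`. -/
def Valid (T : Models (extLang L F)) (Γ : List (Atom (extLang L F)))
    (ε : ℕ → (extLang L F).Term ℕ) (β : Atom L) : Prop :=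
  Entails T Γ (β.trans fun c => (ε c).subst ε)

/-- Names are used at two levels: a base constant names a term `ε c`, whose own constants are names
introduced by flattening. Its value is therefore obtained by evaluating twice. -/
theorem valid_iff {T : Models (extLang L F)} {Γ : List (Atom (extLang L F))}
    {ε : ℕ → (extLang L F).Term ℕ} {β : Atom L} :
    Valid T Γ ε β ↔ ∀ (M : Type) [(extLang L F).Structure M], T M → ∀ v : ℕ → M,
      (∀ γ ∈ Γ, Atom.Holds v γ) →
      @Atom.Holds L M (baseStr L F M)
        (fun c => (ε c).realize fun d => (ε d).realize v) β := by
  simp only [Valid, entails_trans_iff, Term.realize_subst]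

section Mixed

variable {T₀ : L.Theory} {K : Set (Clause (extLang L F))} {Γ : List (Atom (extLang L F))}
  {e : (extLang L F).Term ℕ → ℕ} {ε : ℕ → (extLang L F).Term ℕ}

theorem Separated.valid {G₁ G₂ : (extLang L F).Term ℕ → Prop} {β : Atom L}
    (h : Separated (modelsOf T₀) e (Valid (extModels T₀ K) Γ ε) G₁ G₂ β) :
    Valid (extModels T₀ K) Γ ε β := by
  obtain ⟨A₀, B₀, hA, hB, h⟩ := h
  refine valid_iff.2 fun M _ hM v hv => @h M (baseStr L F M) hM.1 _ fun γ hγ => ?_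
  rcases List.mem_append.1 hγ with hγ | hγ
  · exact valid_iff.1 (hA γ hγ).1 M hM v hv
  · exact valid_iff.1 (hB γ hγ).1 M hM v hv

theorem consts_atom_var {R : BinRel L} {a b c : ℕ}
    (h : c ∈ constsIn (R.atom (Term.var a) (Term.var b)).terms) : c = a ∨ c = b := by
  obtain ⟨t, ht, hc⟩ := mem_consts_atomTerms.1 h
  rw [BinRel.args_atom] at ht
  rcases ht with rfl | rfl
  · exact Or.inl (mem_consts_var.1 hc)
  · exact Or.inr (mem_consts_var.1 hc)

/-- A trivial equation makes a chosen constant occur in a conjunction without changing its content.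
An interpolation problem requires its end constants to occur on their sides, which a separated set
alone does not guarantee. -/
theorem PureList.cons_refl {G : (extLang L F).Term ℕ → Prop}
    {l : List (Atom L)} (h : PureList e (Valid (extModels T₀ K) Γ ε) G l)
    {u : (extLang L F).Term ℕ} (hu : G u) :
    PureList e (Valid (extModels T₀ K) Γ ε) G
      (Sum.inl (Term.var (e u), Term.var (e u)) :: l) := by
  intro β hβ
  rcases List.mem_cons.1 hβ with rfl | hβ
  · refine ⟨valid_iff.2 fun M _ hM v hv => rfl, fun c hc => ⟨u, ?_, hu⟩⟩
    simpa using consts_atom_var (R := none) hc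
  · exact h β hβ

theorem mem_consts_cons_refl {c : ℕ} {l : List (Atom L)} :
    c ∈ constsIn (atomsTerms (Sum.inl (Term.var c, Term.var c) :: l : List (Atom L))) :=
  mem_atomsTerms.2 ⟨_, List.mem_cons_self, Atom.mem_terms.2
    ⟨Term.var c, by simp [Atom.args], mem_subterms_self _⟩⟩

theorem PureList.gen (hε : ∀ t, ε (e t) = t) {V : Atom L → Prop}
    {G : (extLang L F).Term ℕ → Prop} {l : List (Atom L)} (h : PureList e V G l) {c : ℕ}
    (hc : c ∈ constsIn (atomsTerms l)) : c = e (ε c) ∧ G (ε c) := by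
  obtain ⟨β, hβ, hcβ⟩ := mem_atomsTerms.1 hc
  obtain ⟨s, rfl, hs⟩ := (h β hβ).2 c hcβ
  rw [hε]
  exact ⟨rfl, hs⟩

/-- An interpolating term for a separated atom. -/
theorem Separated.interpolate (hε : ∀ t, ε (e t) = t) {C₁ C₂ : Set ℕ} {F₁ F₂ : Set (Σ n, F n)}
    {R : BinRel L} (hint : RInterpolating (modelsOf T₀) allShared R)
    {u s : (extLang L F).Term ℕ} (hu : Gen C₁ F₁ u) (hs : Gen C₂ F₂ s)
    (h : Separated (modelsOf T₀) e (Valid (extModels T₀ K) Γ ε) (Gen C₁ F₁) (Gen C₂ F₂)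
      (R.atom (Term.var (e u)) (Term.var (e s)))) :
    ∃ t : (extLang L F).Term ℕ, Gen C₁ F₁ t ∧ Gen C₂ F₂ t ∧ ∀ (M : Type) [(extLang L F).Structure M],
      extModels T₀ K M → ∀ v : ℕ → M, (∀ γ ∈ Γ, Atom.Holds v γ) →
        @BinRel.Rel L R M (baseStr L F M) (u.realize fun d => (ε d).realize v)
          (t.realize fun d => (ε d).realize v) ∧
        @BinRel.Rel L R M (baseStr L F M) (t.realize fun d => (ε d).realize v)
          (s.realize fun d => (ε d).realize v) := by
  obtain ⟨A₀, B₀, hA, hB, h⟩ := h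
  have hA' := hA.cons_refl hu
  have hB' := hB.cons_refl hs
  obtain ⟨t₀, hc, -, h₁, h₂⟩ := hint.2 _ _ (e u) (e s)
    ⟨mem_consts_cons_refl (l := A₀), mem_consts_cons_refl (l := B₀), fun M _ hM v hv =>
      h M hM v fun γ hγ => hv γ (by
        simp only [List.mem_append, List.mem_cons] at hγ ⊢; tauto)⟩
  -- Only one level of names is replaced here, so that the result is again a term over the
  -- flattening constants. Constants of `t₀` are common to both conjunctions, hence name terms of
  -- both sides.
  refine ⟨((baseHom L F).onTerm t₀).subst ε, gen_subst fun c hcc => (hA'.gen hε (hc hcc).1).2,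
    gen_subst fun c hcc => (hB'.gen hε (hc hcc).2).2, fun M _ hM v hv => ?_⟩
  have hall : ∀ γ ∈ (Sum.inl (Term.var (e u), Term.var (e u)) :: A₀) ++
      (Sum.inl (Term.var (e s), Term.var (e s)) :: B₀),
      @Atom.Holds L M (baseStr L F M) (fun c => (ε c).realize fun d => (ε d).realize v) γ := by
    intro γ hγ
    rcases List.mem_append.1 hγ with hγ | hγ
    · exact valid_iff.1 (hA' γ hγ).1 M hM v hv
    · exact valid_iff.1 (hB' γ hγ).1 M hM v hv
  have h₁' := @h₁ M (baseStr L F M) hM.1 _ hall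
  have h₂' := @h₂ M (baseStr L F M) hM.1 _ hall
  simp only [BinRel.holds_atom, Term.realize, hε] at h₁' h₂'
  simp only [Term.realize_subst, realize_lift]
  exact ⟨h₁', h₂'⟩

/-- The mixed case: premises between terms of the two sides are interpolated, and the intermediate
term `f(t₁, …, tₙ)` separates the conclusion. -/
theorem Separated.of_mixed (hε : ∀ t, ε (e t) = t) {C₁ C₂ : Set ℕ} {F₁ F₂ : Set (Σ n, F n)}
    {n : ℕ} {f g : F n} {Rs : Fin n → BinRel L} {R : BinRel L} (hR : TransIn (modelsOf T₀) R)
    (hint : ∀ i, RInterpolating (modelsOf T₀) allShared (Rs i))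
    {u w s : Fin n → (extLang L F).Term ℕ}
    (hu : Gen C₁ F₁ (Term.func (L := extLang L F) (Sum.inr f) u))
    (hw : Gen C₂ F₂ (Term.func (L := extLang L F) (Sum.inr g) w))
    (hf : (⟨n, f⟩ : Σ n, F n) ∈ F₂) (hs : ∀ i, Gen C₂ F₂ (s i))
    (hmono : ∀ (M : Type) [(extLang L F).Structure M], extModels T₀ K M → ∀ p q : Fin n → M,
      (∀ i, @BinRel.Rel L (Rs i) M (baseStr L F M) (p i) (q i)) →
      @BinRel.Rel L R M (baseStr L F M)
        (Structure.funMap (L := extLang L F) (Sum.inr f : (extLang L F).Functions n) p)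
        (Structure.funMap (L := extLang L F) (Sum.inr f : (extLang L F).Functions n) q))
    (hcomp : ∀ (M : Type) [(extLang L F).Structure M], extModels T₀ K M → ∀ (p : Fin n → M)
      (ν : ℕ → M), (∀ i, @BinRel.Rel L (Rs i) M (baseStr L F M) (p i) ((s i).realize ν)) →
      @BinRel.Rel L R M (baseStr L F M)
        (Structure.funMap (L := extLang L F) (Sum.inr f : (extLang L F).Functions n) p)
        (Structure.funMap (L := extLang L F) (Sum.inr g : (extLang L F).Functions n)
          fun i => (w i).realize ν))
    (h : ∀ i, Separated (modelsOf T₀) e (Valid (extModels T₀ K) Γ ε) (Gen C₁ F₁) (Gen C₂ F₂)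
      ((Rs i).atom (Term.var (e (u i))) (Term.var (e (s i))))) :
    Separated (modelsOf T₀) e (Valid (extModels T₀ K) Γ ε) (Gen C₁ F₁) (Gen C₂ F₂)
      (R.atom (Term.var (e (Term.func (L := extLang L F) (Sum.inr f) u)))
        (Term.var (e (Term.func (L := extLang L F) (Sum.inr g) w)))) := by
  -- One intermediate term per premise, belonging to both sides.
  choose t ht₁ ht₂ ht using fun i =>
    Separated.interpolate hε (hint i) (gen_arg hu i) (hs i) (h i)
  have hft₁ : Gen C₁ F₁ (Term.func (L := extLang L F) (Sum.inr f) t) :=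
    gen_ext.2 ⟨(gen_ext.1 hu).1, ht₁⟩
  have hft₂ : Gen C₂ F₂ (Term.func (L := extLang L F) (Sum.inr f) t) := gen_ext.2 ⟨hf, ht₂⟩
  -- The new term f(t) cuts the mixed conclusion into an atom about the first side, true by
  -- monotonicity, and one about the second, true by the clause; transitivity in `T₀` recombines
  -- them.
  refine Separated.of_entails (Γ :=
    [R.atom (Term.var (e (Term.func (L := extLang L F) (Sum.inr f) u)))
        (Term.var (e (Term.func (L := extLang L F) (Sum.inr f) t))),
      R.atom (Term.var (e (Term.func (L := extLang L F) (Sum.inr f) t)))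
        (Term.var (e (Term.func (L := extLang L F) (Sum.inr g) w)))]) ?_ ?_
  · intro γ hγ
    simp only [List.mem_cons, List.not_mem_nil, or_false] at hγ
    rcases hγ with rfl | rfl
    · refine Separated.of_pure (valid_iff.2 fun M _ hM v hv => ?_) fun c hc => ?_
      · simp only [BinRel.holds_atom, Term.realize, hε]
        exact hmono M hM _ _ fun i => (ht i M hM v hv).1
      · rcases consts_atom_var hc with rfl | rfl
        · exact ⟨_, rfl, hu⟩
        · exact ⟨_, rfl, hft₁⟩
    · refine Separated.symm (Separated.of_pure (valid_iff.2 fun M _ hM v hv => ?_) fun c hc => ?_)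
      · simp only [BinRel.holds_atom, Term.realize, hε]
        exact hcomp M hM _ _ fun i => (ht i M hM v hv).2
      · rcases consts_atom_var hc with rfl | rfl
        · exact ⟨_, rfl, hft₂⟩
        · exact ⟨_, rfl, hw⟩
  · intro M _ hM v hv
    have h₁ := hv _ (List.mem_cons_self)
    have h₂ := hv _ (List.mem_cons_of_mem _ List.mem_cons_self)
    simp only [BinRel.holds_atom] at h₁ h₂ ⊢
    exact hR M hM _ _ _ h₁ h₂

/-- Functionality of an extension function for terms of the two sides. -/
theorem Separated.congruence (hε : ∀ t, ε (e t) = t)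
    (heq : RInterpolating (modelsOf T₀) allShared none) {C₁ C₂ : Set ℕ} {F₁ F₂ : Set (Σ n, F n)}
    {n : ℕ} {f : F n} {u w : Fin n → (extLang L F).Term ℕ}
    (hu : Gen C₁ F₁ (Term.func (L := extLang L F) (Sum.inr f) u))
    (hw : Gen C₂ F₂ (Term.func (L := extLang L F) (Sum.inr f) w))
    (h : ∀ i, Separated (modelsOf T₀) e (Valid (extModels T₀ K) Γ ε) (Gen C₁ F₁) (Gen C₂ F₂)
      (Sum.inl (Term.var (e (u i)), Term.var (e (w i))))) :
    Separated (modelsOf T₀) e (Valid (extModels T₀ K) Γ ε) (Gen C₁ F₁) (Gen C₂ F₂)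
      (Sum.inl (Term.var (e (Term.func (L := extLang L F) (Sum.inr f) u)),
        Term.var (e (Term.func (L := extLang L F) (Sum.inr f) w)))) := by
  -- For equality, monotonicity and the clause coincide with functionality of `f`, which holds in
  -- every structure.
  refine Separated.of_mixed (Rs := fun _ => none) (R := none) hε
    (fun M _ hM x y z hxy hyz => Eq.trans hxy hyz) (fun _ => heq) hu hw (gen_ext.1 hw).1
    (gen_arg hw) ?_ ?_ h
  · intro M _ hM p q hpq
    exact congrArg _ (funext hpq)
  · intro M _ hM p ν hp
    exact congrArg _ (funext hp)

/-- The conclusion of an instance whose head terms are on the same side. -/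
theorem Separated.of_valid (hε : ∀ t, ε (e t) = t) {G₁ G₂ : (extLang L F).Term ℕ → Prop}
    {R : BinRel L} {s t : (extLang L F).Term ℕ} (hs : G₁ s) (ht : G₁ t)
    (h : ∀ (M : Type) [(extLang L F).Structure M], extModels T₀ K M → ∀ v : ℕ → M,
      (∀ γ ∈ Γ, Atom.Holds v γ) → @BinRel.Rel L R M (baseStr L F M)
        (s.realize fun d => (ε d).realize v) (t.realize fun d => (ε d).realize v)) :
    Separated (modelsOf T₀) e (Valid (extModels T₀ K) Γ ε) G₁ G₂
      (R.atom (Term.var (e s)) (Term.var (e t))) := by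
  refine Separated.of_pure (valid_iff.2 fun M _ hM v hv => ?_) fun c hc => ?_
  · simp only [BinRel.holds_atom, Term.realize, hε]
    exact h M hM v hv
  · rcases consts_atom_var hc with rfl | rfl
    · exact ⟨_, rfl, hs⟩
    · exact ⟨_, rfl, ht⟩

end Mixed

end Extension

/-! ### Instances of the clauses of `K`, and flattening. -/

section Extension

variable {L : FirstOrder.Language.{0, 0}} {F : ℕ → Type}

theorem mem_clauseTerms {D : Clause L} {t : L.Term ℕ} :
    t ∈ clauseTerms D ↔ ∃ l ∈ D, t ∈ Atom.terms l.2 := by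
  simp only [clauseTerms, Set.mem_iUnion, exists_prop]

theorem mem_clauseTerms_of_arg {D : Clause L} {l : Literal L} (hl : l ∈ D) {t : L.Term ℕ}
    (ht : t ∈ l.2.args) : t ∈ clauseTerms D :=
  mem_clauseTerms.2 ⟨l, hl, Atom.mem_terms.2 ⟨t, ht, mem_subterms_self t⟩⟩

theorem head_mem_clauseTerms {n : ℕ} {f g : F n} {Rs : Fin n → BinRel L} {R : BinRel L}
    {x y : Fin n → ℕ} {s : Fin n → (extLang L F).Term ℕ} (σ : ℕ → (extLang L F).Term ℕ) :
    (Term.func (L := extLang L F) (Sum.inr f) fun i => σ (x i)) ∈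
        clauseTerms (Clause.subst σ (compClause f g Rs R x y s)) ∧
      (Term.func (L := extLang L F) (Sum.inr g) fun i => σ (y i)) ∈
        clauseTerms (Clause.subst σ (compClause f g Rs R x y s)) :=
  ⟨mem_clauseTerms_of_arg (mem_subst_compClause.2 (Or.inr rfl)) (by simp [BinRel.args_atom]),
    mem_clauseTerms_of_arg (mem_subst_compClause.2 (Or.inr rfl)) (by simp [BinRel.args_atom])⟩

theorem premise_mem_clauseTerms {n : ℕ} {f g : F n} {Rs : Fin n → BinRel L} {R : BinRel L}
    {x y : Fin n → ℕ} {s : Fin n → (extLang L F).Term ℕ} (σ : ℕ → (extLang L F).Term ℕ)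
    (i : Fin n) :
    (s i).subst σ ∈ clauseTerms (Clause.subst σ (compClause f g Rs R x y s)) :=
  mem_clauseTerms_of_arg (mem_subst_compClause.2 (Or.inl ⟨i, rfl⟩)) (by simp [BinRel.args_atom])

theorem Term.subst_var (t : L.Term ℕ) : t.subst Term.var = t := by
  induction t with
  | var x => rfl
  | func f ts ih => simp only [Term.subst, ih]

theorem Atom.subst_var (α : Atom L) : α.subst Term.var = α := by
  rcases α with ⟨s, t⟩ | ⟨R, ts⟩ <;> simp [Atom.subst, Term.subst_var]

theorem Clause.subst_var (D : Clause L) : D.subst Term.var = D := by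
  simp [Clause.subst, Atom.subst_var]

theorem mem_extSymbols_of_func {S : Set ((extLang L F).Term ℕ)} {n : ℕ} {f : F n}
    {ts : Fin n → (extLang L F).Term ℕ} (h : (Term.func (L := extLang L F) (Sum.inr f) ts) ∈ S) :
    (⟨n, f⟩ : Σ n, F n) ∈ extSymbolsIn S := ⟨ts, h⟩

variable {K : Set (Clause (extLang L F))}

theorem linked_heads {n : ℕ} {f g : F n} {Rs : Fin n → BinRel L} {R : BinRel L}
    {x y : Fin n → ℕ} {s : Fin n → (extLang L F).Term ℕ}
    (hD : compClause f g Rs R x y s ∈ K) : Linked K ⟨n, f⟩ ⟨n, g⟩ := by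
  have h := head_mem_clauseTerms (f := f) (g := g) (Rs := Rs) (R := R) (x := x) (y := y) (s := s)
    (Term.var : ℕ → (extLang L F).Term ℕ)
  rw [Clause.subst_var] at h
  exact ⟨_, hD, mem_extSymbols_of_func h.1, mem_extSymbols_of_func h.2⟩

/-- This is why premise terms stay on the side of the second head: `h` and `g` occur in one clause,
so they have the same Θ-closure. -/
theorem linked_premise {n k : ℕ} {f g : F n} {h : F k} {z : Fin k → ℕ} {Rs : Fin n → BinRel L}
    {R : BinRel L} {x y : Fin n → ℕ} {s : Fin n → (extLang L F).Term ℕ}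
    (hD : compClause f g Rs R x y s ∈ K) {i : Fin n} (hi : s i = varApp h z) :
    Linked K ⟨n, g⟩ ⟨k, h⟩ := by
  have h₁ := head_mem_clauseTerms (f := f) (g := g) (Rs := Rs) (R := R) (x := x) (y := y) (s := s)
    (Term.var : ℕ → (extLang L F).Term ℕ)
  have h₂ := premise_mem_clauseTerms (f := f) (g := g) (Rs := Rs) (R := R) (x := x) (y := y)
    (s := s) (Term.var : ℕ → (extLang L F).Term ℕ) i
  rw [Clause.subst_var] at h₁ h₂
  rw [Term.subst_var, hi] at h₂
  exact ⟨_, hD, mem_extSymbols_of_func h₁.2, mem_extSymbols_of_func h₂⟩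

theorem Theta.of_linked {S : Set (Σ n, F n)} {f g : Σ n, F n} (h : Linked K f g)
    (hf : f ∈ Theta K S) : g ∈ Theta K S := by
  obtain ⟨f', hf', hr⟩ := hf
  exact ⟨f', hf', hr.trans _ _ _ (Relation.EqvGen.rel _ _ h)⟩

theorem subset_theta (S : Set (Σ n, F n)) : S ⊆ Theta K S := fun f hf =>
  ⟨f, hf, Relation.EqvGen.refl f⟩

theorem theta_mono {S S' : Set (Σ n, F n)} (h : S ⊆ S') : Theta K S ⊆ Theta K S' :=
  fun _ ⟨f, hf, hr⟩ => ⟨f, h hf, hr⟩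

section Clause

variable {T₀ : L.Theory} {Γ : List (Atom (extLang L F))} {e : (extLang L F).Term ℕ → ℕ}
  {ε : ℕ → (extLang L F).Term ℕ} {n : ℕ} {f g : F n} {Rs : Fin n → BinRel L} {R : BinRel L}
  {x y x' y' : Fin n → ℕ} {s : Fin n → (extLang L F).Term ℕ}

theorem realize_premise {M : Type} [(extLang L F).Structure M] {s : (extLang L F).Term ℕ}
    (hs : IsPremiseTerm y s) {w w' : ℕ → M} (h : ∀ i, w (y i) = w' (y i)) :
    s.realize w = s.realize w' := by
  refine realize_congr fun c hc => ?_
  rcases hs with ⟨j, rfl⟩ | ⟨k, f, z, -, hz, rfl⟩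
  · rw [mem_consts_var.1 hc]
    exact h j
  · obtain ⟨j, hj⟩ := mem_consts_func.1 hc
    obtain ⟨i, hi⟩ := hz j
    rw [mem_consts_var.1 hj, ← hi]
    exact h i

/-- A premise term is built from the arguments of the second head and at most one extension
function, which is linked to `g`. -/
theorem gen_premise {C : Set ℕ} {Fs : Set (Σ n, F n)}
    (hFs : ∀ f g, Linked K f g → f ∈ Fs → g ∈ Fs)
    (hD : compClause f g Rs R x y s ∈ K) (hs : ∀ i, IsPremiseTerm y (s i))
    {σ : ℕ → (extLang L F).Term ℕ}
    (hg : Gen C Fs (Term.func (L := extLang L F) (Sum.inr g) fun i => σ (y i))) (i : Fin n) :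
    Gen C Fs ((s i).subst σ) := by
  rcases hs i with ⟨j, hj⟩ | ⟨k, h, z, -, hz, hi⟩
  · rw [hj]
    exact gen_arg hg j
  · rw [hi, subst_varApp]
    refine gen_ext.2 ⟨hFs _ _ (linked_premise hD hi) (gen_ext.1 hg).1, fun j => ?_⟩
    obtain ⟨l, hl⟩ := hz j
    rw [← hl]
    exact gen_arg hg l

theorem rel_of_mono (hD : monClause f Rs R x' y' ∈ K)
    (hinj : Function.Injective (Sum.elim x' y')) (M : Type) [(extLang L F).Structure M]
    (hM : extModels T₀ K M) (p q : Fin n → M)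
    (h : ∀ i, @BinRel.Rel L (Rs i) M (baseStr L F M) (p i) (q i)) :
    @BinRel.Rel L R M (baseStr L F M)
      (Structure.funMap (L := extLang L F) (Sum.inr f : (extLang L F).Functions n) p)
      (Structure.funMap (L := extLang L F) (Sum.inr f : (extLang L F).Functions n) q) := by
  -- Distinctness of the clause variables allows arbitrary values `p`, `q` to be assigned
  -- independently; `m` is a dummy value for all other variables.
  obtain ⟨m⟩ := hM.1.1
  have hw : ∀ k, Function.extend (Sum.elim x' y') (Sum.elim p q) (fun _ => m)
      (Sum.elim x' y' k) = Sum.elim p q k := fun k => hinj.extend_apply _ _ k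
  have hx : ∀ i, Function.extend (Sum.elim x' y') (Sum.elim p q) (fun _ => m) (x' i) = p i :=
    fun i => hw (Sum.inl i)
  have hy : ∀ i, Function.extend (Sum.elim x' y') (Sum.elim p q) (fun _ => m) (y' i) = q i :=
    fun i => hw (Sum.inr i)
  have := rel_of_mem hM hD (Function.extend (Sum.elim x' y') (Sum.elim p q) fun _ => m)
  simp only [Term.realize, hx, hy] at this
  exact this h

theorem rel_of_comp (hD : compClause f g Rs R x y s ∈ K)
    (hinj : Function.Injective (Sum.elim x y)) (hs : ∀ i, IsPremiseTerm y (s i))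
    (σ : ℕ → (extLang L F).Term ℕ) (M : Type) [(extLang L F).Structure M]
    (hM : extModels T₀ K M) (p : Fin n → M) (ν : ℕ → M)
    (h : ∀ i, @BinRel.Rel L (Rs i) M (baseStr L F M) (p i) (((s i).subst σ).realize ν)) :
    @BinRel.Rel L R M (baseStr L F M)
      (Structure.funMap (L := extLang L F) (Sum.inr f : (extLang L F).Functions n) p)
      (Structure.funMap (L := extLang L F) (Sum.inr g : (extLang L F).Functions n)
        fun i => (σ (y i)).realize ν) := by
  let q : Fin n → M := fun i => (σ (y i)).realize ν
  -- The variables `x` receive the intermediate values `p`, while `y` keeps the values from the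
  -- substitution. Premise terms depend on `y` only, so they are unaffected by this change.
  let w : ℕ → M := Function.extend (Sum.elim x y) (Sum.elim p q) fun _ => ν 0
  have hw : ∀ k, w (Sum.elim x y k) = Sum.elim p q k := fun k => hinj.extend_apply _ _ k
  have hx : ∀ i, w (x i) = p i := fun i => hw (Sum.inl i)
  have hy : ∀ i, w (y i) = (σ (y i)).realize ν := fun i => hw (Sum.inr i)
  have := rel_of_mem hM hD w
  simp only [hx, hy] at this
  refine this fun i => ?_
  rw [realize_premise (hs i) (w' := fun c => (σ c).realize ν) hy, ← Term.realize_subst]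
  exact h i

/-- The conclusion of an instance of a clause of `K` is separated if the premises are. -/
theorem Separated.of_clause (hε : ∀ t, ε (e t) = t) {C₁ C₂ : Set ℕ} {F₁ F₂ : Set (Σ n, F n)}
    (hF₂ : ∀ f g, Linked K f g → f ∈ F₂ → g ∈ F₂) (hR : TransIn (modelsOf T₀) R)
    (hint : ∀ i, RInterpolating (modelsOf T₀) allShared (Rs i))
    (hD : compClause f g Rs R x y s ∈ K) (hinj : Function.Injective (Sum.elim x y))
    (hs : ∀ i, IsPremiseTerm y (s i)) (hD' : monClause f Rs R x' y' ∈ K)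
    (hinj' : Function.Injective (Sum.elim x' y')) (σ : ℕ → (extLang L F).Term ℕ)
    (hf : Gen C₁ F₁ (Term.func (L := extLang L F) (Sum.inr f) fun i => σ (x i)))
    (hg : Gen C₂ F₂ (Term.func (L := extLang L F) (Sum.inr g) fun i => σ (y i)))
    (h : ∀ i, Separated (modelsOf T₀) e (Valid (extModels T₀ K) Γ ε) (Gen C₁ F₁) (Gen C₂ F₂)
      ((Rs i).atom (Term.var (e (σ (x i)))) (Term.var (e ((s i).subst σ))))) :
    Separated (modelsOf T₀) e (Valid (extModels T₀ K) Γ ε) (Gen C₁ F₁) (Gen C₂ F₂)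
      (R.atom (Term.var (e (Term.func (L := extLang L F) (Sum.inr f) fun i => σ (x i))))
        (Term.var (e (Term.func (L := extLang L F) (Sum.inr g) fun i => σ (y i))))) := by
  -- Linking is symmetric, so `f` belongs to the closure on the side of `g`; this puts the
  -- intermediate head term on both sides.
  have hlink : Linked K ⟨n, g⟩ ⟨n, f⟩ := by
    obtain ⟨D, h₁, h₂, h₃⟩ := linked_heads hD
    exact ⟨D, h₁, h₃, h₂⟩
  exact Separated.of_mixed hε hR hint hf hg (hF₂ _ _ hlink (gen_ext.1 hg).1)
    (gen_premise hF₂ hD hs hg) (fun M _ hM => rel_of_mono hD' hinj' M hM)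
    (fun M _ hM => rel_of_comp hD hinj hs σ M hM) h

/-- When both heads are on one side no interpolation is needed: the conclusion is valid because its
premises are, and it is its own witness of separation. How the premises are separated is immaterial.
-/
theorem Separated.of_clause_of_pure (hε : ∀ t, ε (e t) = t)
    {G₁ G₂ G₃ G₄ : (extLang L F).Term ℕ → Prop}
    (hD : compClause f g Rs R x y s ∈ K) (σ : ℕ → (extLang L F).Term ℕ)
    (hf : G₁ (Term.func (L := extLang L F) (Sum.inr f) fun i => σ (x i)))
    (hg : G₁ (Term.func (L := extLang L F) (Sum.inr g) fun i => σ (y i)))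
    (h : ∀ i, Separated (modelsOf T₀) e (Valid (extModels T₀ K) Γ ε) G₃ G₄
      ((Rs i).atom (Term.var (e (σ (x i)))) (Term.var (e ((s i).subst σ))))) :
    Separated (modelsOf T₀) e (Valid (extModels T₀ K) Γ ε) G₁ G₂
      (R.atom (Term.var (e (Term.func (L := extLang L F) (Sum.inr f) fun i => σ (x i))))
        (Term.var (e (Term.func (L := extLang L F) (Sum.inr g) fun i => σ (y i))))) := by
  refine Separated.of_valid hε hf hg fun M _ hM v hv => ?_
  have h' := fun i => valid_iff.1 (h i).valid M hM v hv
  simp only [BinRel.holds_atom, Term.realize, hε] at h'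
  exact rel_of_mem hM hD (fun c => (σ c).realize fun d => (ε d).realize v) fun i => by
    simpa only [Term.realize_subst] using h' i

end Clause

section Flatten

variable (e : (extLang L F).Term ℕ → ℕ)

/-- The term in which all arguments are named by constants. -/
def flatTerm : (extLang L F).Term ℕ → (extLang L F).Term ℕ
  | Term.var c => Term.var (e (Term.var c))
  | Term.func f ts => Term.func f fun i => Term.var (e (ts i))

/-- The definitions of the names of all terms occurring in `A`, and the atoms of `A` in terms of
these names. -/
noncomputable def flatAtoms (A : List (Atom (extLang L F))) : List (Atom (extLang L F)) :=
  (finite_atomsTerms A).toFinset.toList.map (fun t => Sum.inl (Term.var (e t), flatTerm e t)) ++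
    A.map fun α => (nameAtom e α).lift F

variable {e}

theorem mem_flatAtoms {A : List (Atom (extLang L F))} {γ : Atom (extLang L F)} :
    γ ∈ flatAtoms e A ↔ (∃ t ∈ atomsTerms A, γ = Sum.inl (Term.var (e t), flatTerm e t)) ∨
      ∃ α ∈ A, γ = (nameAtom e α).lift F := by
  simp only [flatAtoms, List.mem_append, List.mem_map, Finset.mem_toList,
    Set.Finite.mem_toFinset]
  constructor
  · rintro (⟨t, ht, rfl⟩ | ⟨α, hα, rfl⟩)
    exacts [Or.inl ⟨t, ht, rfl⟩, Or.inr ⟨α, hα, rfl⟩]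
  · rintro (⟨t, ht, rfl⟩ | ⟨α, hα, rfl⟩)
    exacts [Or.inl ⟨t, ht, rfl⟩, Or.inr ⟨α, hα, rfl⟩]

theorem args_lift_nameAtom {α : Atom (extLang L F)} {s : (extLang L F).Term ℕ}
    (hs : s ∈ ((nameAtom e α).lift F).args) : ∃ t ∈ α.args, s = Term.var (e t) := by
  rcases α with ⟨s₁, s₂⟩ | ⟨R, ts⟩
  · rcases hs with rfl | rfl
    · exact ⟨s₁, by simp [Atom.args], rfl⟩
    · exact ⟨s₂, by simp [Atom.args], rfl⟩
  · obtain ⟨i, rfl⟩ := hs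
    exact ⟨ts i, ⟨i, rfl⟩, rfl⟩

theorem arg_mem_atomsTerms {A : List (Atom L)} {α : Atom L} (hα : α ∈ A) {t : L.Term ℕ}
    (ht : t ∈ α.args) : t ∈ atomsTerms A :=
  mem_atomsTerms.2 ⟨α, hα, Atom.mem_terms.2 ⟨t, ht, mem_subterms_self t⟩⟩

/-- The arguments of the flattened atoms. -/
theorem args_flatAtoms {A : List (Atom (extLang L F))} {γ : Atom (extLang L F)}
    (hγ : γ ∈ flatAtoms e A) {s : (extLang L F).Term ℕ} (hs : s ∈ γ.args) :
    ∃ t ∈ atomsTerms A, s = Term.var (e t) ∨ s = flatTerm e t := by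
  rcases mem_flatAtoms.1 hγ with ⟨t, ht, rfl⟩ | ⟨α, hα, rfl⟩
  · rcases hs with rfl | rfl
    exacts [⟨t, ht, Or.inl rfl⟩, ⟨t, ht, Or.inr rfl⟩]
  · obtain ⟨t, ht, rfl⟩ := args_lift_nameAtom hs
    exact ⟨t, arg_mem_atomsTerms hα ht, Or.inl rfl⟩

/-- After flattening, an extension term can only occur as the right-hand side of a definition, so it
is flat and comes from an extension term of `A`. -/
theorem ext_mem_flatAtoms {A : List (Atom (extLang L F))} {s : (extLang L F).Term ℕ}
    (hext : IsExt s) (hs : s ∈ atomsTerms (flatAtoms e A)) :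
    ∃ (n : ℕ) (f : F n) (ts : Fin n → (extLang L F).Term ℕ),
      (Term.func (L := extLang L F) (Sum.inr f) ts) ∈ atomsTerms A ∧
      s = Term.func (L := extLang L F) (Sum.inr f) fun i => Term.var (e (ts i)) := by
  obtain ⟨n, f, us, rfl⟩ := hext
  obtain ⟨γ, hγ, hs⟩ := mem_atomsTerms.1 hs
  obtain ⟨r, hr, hs⟩ := Atom.mem_terms.1 hs
  obtain ⟨t, ht, rfl | rfl⟩ := args_flatAtoms hγ hr
  · simp [subterms] at hs
  · cases t with
    | var c => simp [flatTerm, subterms] at hs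
    | func g ts =>
      rcases mem_subterms_func.1 hs with h | ⟨i, h⟩
      · cases h
        exact ⟨n, f, ts, ht, rfl⟩
      · simp [subterms] at h

/-- The constants naming the terms that occur in `A`. -/
def nameSet (e : (extLang L F).Term ℕ → ℕ) (A : List (Atom (extLang L F))) : Set ℕ :=
  e '' atomsTerms A

theorem gen_flatTerm {A : List (Atom (extLang L F))} {t : (extLang L F).Term ℕ}
    (ht : t ∈ atomsTerms A) :
    Gen (nameSet e A) (Theta K (extSymbolsIn (atomsTerms A))) (flatTerm e t) := by
  cases t with
  | var c => exact gen_var.2 ⟨_, ht, rfl⟩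
  | func f ts =>
    have harg : ∀ i, Gen (nameSet e A) (Theta K (extSymbolsIn (atomsTerms A)))
        (Term.var (e (ts i)) : (extLang L F).Term ℕ) := fun i =>
      gen_var.2 ⟨_, subterms_subset_atomsTerms ht (mem_subterms_arg f ts i), rfl⟩
    rcases f with f | f
    · exact gen_base.2 harg
    · exact gen_ext.2 ⟨subset_theta _ (mem_extSymbols_of_func ht), harg⟩

/-- Converts the separability condition on `Ψ`, stated for the flattened extension terms, into the
notion of side used for separation: their constants are names of subterms of `A` and their functions
occur in `A`. -/
theorem gen_of_generatedBy {A : List (Atom (extLang L F))} {t : (extLang L F).Term ℕ}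
    (h : GeneratedBy K {s | IsExt s ∧ s ∈ atomsTerms (flatAtoms e A)} t) :
    Gen (nameSet e A) (Theta K (extSymbolsIn (atomsTerms A))) t := by
  refine ⟨h.1.trans fun c hc => ?_, h.2.trans (theta_mono fun s hs => ?_)⟩
  · simp only [constsIn, allSubterms, Set.mem_iUnion, Set.mem_ofPred_eq, exists_prop] at hc
    obtain ⟨r, ⟨hext, hr⟩, hc⟩ := hc
    obtain ⟨n, f, ts, hA, rfl⟩ := ext_mem_flatAtoms hext hr
    obtain ⟨i, hi⟩ := mem_consts_func.1 hc
    rw [mem_consts_var.1 hi]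
    exact ⟨_, subterms_subset_atomsTerms hA (mem_subterms_arg _ ts i), rfl⟩
  · obtain ⟨us, hs⟩ := hs
    simp only [allSubterms, Set.mem_iUnion, Set.mem_ofPred_eq, exists_prop] at hs
    obtain ⟨r, ⟨hext, hr⟩, hs⟩ := hs
    obtain ⟨n, f, ts, hA, rfl⟩ := ext_mem_flatAtoms hext hr
    obtain ⟨m, g⟩ := s
    rcases mem_subterms_func.1 hs with h | ⟨i, h⟩
    · cases h
      exact mem_extSymbols_of_func hA
    · simp [subterms] at h

/-- A model of the flattened atoms is a model of the original ones. -/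
theorem holds_of_flatAtoms {M : Type} [(extLang L F).Structure M] {A : List (Atom (extLang L F))}
    {v : ℕ → M} (h : ∀ γ ∈ flatAtoms e A, Atom.Holds v γ) :
    ∀ α ∈ A, Atom.Holds (fun c => v (e (Term.var c))) α := by
  have key : ∀ t ∈ atomsTerms A, t.realize (fun c => v (e (Term.var c))) = v (e t) := by
    intro t
    induction t with
    | var c => exact fun _ => rfl
    | func f ts ih =>
      intro ht
      have := h _ (mem_flatAtoms.2 (Or.inl ⟨_, ht, rfl⟩))
      simp only [Atom.Holds, flatTerm, Term.realize] at this
      rw [this, Term.realize]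
      congr 1
      funext i
      exact ih i (subterms_subset_atomsTerms ht (mem_subterms_arg f ts i))
  intro α hα
  rw [holds_nameAtom (v := v) (e := e) fun t ht => key t (arg_mem_atomsTerms hα ht), ← holds_lift]
  exact h _ (mem_flatAtoms.2 (Or.inr ⟨α, hα, rfl⟩))

/-- The flattened atoms of `A` hold in every model of `A` if the names are interpreted by
the named terms. -/
theorem flatAtoms_holds {ε : ℕ → (extLang L F).Term ℕ} (hε : ∀ t, ε (e t) = t) {M : Type}
    [(extLang L F).Structure M] {A : List (Atom (extLang L F))} {v : ℕ → M}
    (h : ∀ α ∈ A, Atom.Holds v α) {γ : Atom (extLang L F)} (hγ : γ ∈ flatAtoms e A) :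
    Atom.Holds (fun d => (ε d).realize v) γ := by
  rcases mem_flatAtoms.1 hγ with ⟨t, ht, rfl⟩ | ⟨α, hα, rfl⟩
  · cases t <;> simp [Atom.Holds, flatTerm, Term.realize, hε]
  · rw [holds_lift, ← holds_nameAtom (w := v)]
    · exact h α hα
    · intro t _
      simp only [hε]

end Flatten

end Extension

/-! ### Separation of the conclusion, and reduction to the base theory. -/

section Extension

variable {L : FirstOrder.Language.{0, 0}} {F : ℕ → Type}

theorem consts_nameAtom {e : (extLang L F).Term ℕ → ℕ} {α : Atom (extLang L F)} {c : ℕ}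
    (hc : c ∈ constsIn (nameAtom e α).terms) : ∃ t ∈ α.args, c = e t := by
  obtain ⟨s, hs, hc⟩ := mem_consts_atomTerms.1 hc
  rcases α with ⟨s₁, s₂⟩ | ⟨R, ts⟩
  · rcases hs with rfl | rfl
    · exact ⟨s₁, by simp [Atom.args], mem_consts_var.1 hc⟩
    · exact ⟨s₂, by simp [Atom.args], mem_consts_var.1 hc⟩
  · obtain ⟨i, rfl⟩ := hs
    exact ⟨ts i, ⟨i, rfl⟩, mem_consts_var.1 hc⟩

/-- A flattened interpolation problem as a list of clauses. -/
noncomputable def flatClauses (e : (extLang L F).Term ℕ → ℕ) (A B : List (Atom (extLang L F)))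
    (α : Atom (extLang L F)) : List (Clause (extLang L F)) :=
  (flatAtoms e A ++ flatAtoms e B).map (fun γ => [(true, γ)]) ++ [ [(false, α)] ]

theorem mem_flatClauses {e : (extLang L F).Term ℕ → ℕ} {A B : List (Atom (extLang L F))}
    {α : Atom (extLang L F)} {D : Clause (extLang L F)} :
    D ∈ flatClauses e A B α ↔
      (∃ γ, (γ ∈ flatAtoms e A ∨ γ ∈ flatAtoms e B) ∧ D = [(true, γ)]) ∨ D = [(false, α)] := by
  simp only [flatClauses, List.mem_append, List.mem_map, List.mem_singleton]
  constructor
  · rintro (⟨γ, h, rfl⟩ | rfl)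
    exacts [Or.inl ⟨γ, h, rfl⟩, Or.inr rfl]
  · rintro (⟨γ, h, rfl⟩ | rfl)
    exacts [Or.inl ⟨γ, h, rfl⟩, Or.inr rfl]

/-- The conditions `1 ≤ n` and `1 ≤ k` exclude ground terms from the clauses, so `K` itself
contributes nothing to the extension terms fed into `Ψ`. -/
theorem consts_nonempty_of_form {T₀ : L.Theory} {K : Set (Clause (extLang L F))}
    {P : Set (BinRel L)} (hform : MonCompForm T₀ P K) {D : Clause (extLang L F)} (hD : D ∈ K)
    {t : (extLang L F).Term ℕ} (ht : t ∈ clauseTerms D) : constsIn (subterms t) ≠ ∅ := by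
  obtain ⟨n, f, g, Rs, R, x, y, s, hn, -, -, -, hs, rfl, -⟩ := hform D hD
  have happ : ∀ {k : ℕ} (h : F k) (z : Fin k → ℕ) {r : (extLang L F).Term ℕ}, 1 ≤ k →
      r ∈ subterms (varApp h z : (extLang L F).Term ℕ) → ∃ c, c ∈ constsIn (subterms r) := by
    intro k h z r hk hr
    rcases mem_subterms_func.1 hr with rfl | ⟨i, hi⟩
    · exact ⟨z ⟨0, hk⟩, mem_consts_func.2 ⟨⟨0, hk⟩, mem_consts_var.2 rfl⟩⟩
    · rw [subterms, Set.mem_singleton_iff] at hi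
      exact ⟨z i, by rw [hi]; exact mem_consts_var.2 rfl⟩
  have hvar : ∀ {c : ℕ} {r : (extLang L F).Term ℕ}, r ∈ subterms (Term.var c) →
      ∃ d, d ∈ constsIn (subterms r) := by
    intro c r hr
    rw [subterms, Set.mem_singleton_iff] at hr
    exact ⟨c, by rw [hr]; exact mem_consts_var.2 rfl⟩
  suffices h : ∃ c, c ∈ constsIn (subterms t) from fun h' => by
    obtain ⟨c, hc⟩ := h
    rw [h'] at hc
    exact hc
  rw [← Clause.subst_var (compClause f g Rs R x y s)] at ht
  obtain ⟨l, hl, ht⟩ := mem_clauseTerms.1 ht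
  obtain ⟨r, hr, ht⟩ := Atom.mem_terms.1 ht
  rcases mem_subst_compClause.1 hl with ⟨i, rfl⟩ | rfl
  · rw [BinRel.args_atom] at hr
    rcases hr with rfl | rfl
    · exact hvar ht
    · rw [Term.subst_var] at ht
      rcases hs i with ⟨j, hj⟩ | ⟨k, h, z, hk, -, hi⟩
      · rw [hj] at ht
        exact hvar ht
      · rw [hi] at ht
        exact happ h z hk ht
  · rw [BinRel.args_atom] at hr
    rcases hr with rfl | rfl
    · exact happ f x hn ht
    · exact happ g y hn ht

/-- The set handed to `Ψ` thus has exactly the form of a union of an A-part and a B-part of flat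
terms to which separability applies; the negated goal contains only constants. -/
theorem est_flatClauses {T₀ : L.Theory} {K : Set (Clause (extLang L F))}
    {P : Set (BinRel L)} (hform : MonCompForm T₀ P K) (e : (extLang L F).Term ℕ → ℕ)
    (A B : List (Atom (extLang L F))) (R : BinRel L) (a b : ℕ) :
    est K (flatClauses e A B ((BinRel.ext F R).atom (Term.var a) (Term.var b))) =
      {s | IsExt s ∧ s ∈ atomsTerms (flatAtoms e A)} ∪
      {s | IsExt s ∧ s ∈ atomsTerms (flatAtoms e B)} := by
  ext t
  constructor
  · rintro ⟨hext, ⟨D, hD, ht⟩ | ⟨D, hD, ht, hc⟩⟩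
    · obtain ⟨l, hl, htl⟩ := mem_clauseTerms.1 ht
      rcases mem_flatClauses.1 hD with ⟨γ, hγ, rfl⟩ | rfl
      · rw [List.mem_singleton.1 hl] at htl
        exact hγ.imp (fun h => ⟨hext, mem_atomsTerms.2 ⟨γ, h, htl⟩⟩)
          fun h => ⟨hext, mem_atomsTerms.2 ⟨γ, h, htl⟩⟩
      · exfalso
        rw [List.mem_singleton.1 hl] at htl
        obtain ⟨r, hr, ht⟩ := Atom.mem_terms.1 htl
        rw [BinRel.args_atom] at hr
        obtain ⟨n, f, ts, rfl⟩ := hext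
        rcases hr with rfl | rfl <;> simp [subterms] at ht
    · exact absurd hc (consts_nonempty_of_form hform hD ht)
  · have key : ∀ γ, (γ ∈ flatAtoms e A ∨ γ ∈ flatAtoms e B) → IsExt t → t ∈ γ.terms →
        t ∈ est K (flatClauses e A B ((BinRel.ext F R).atom (Term.var a) (Term.var b))) :=
      fun γ hγ hext ht => ⟨hext, Or.inl ⟨[(true, γ)], mem_flatClauses.2 (Or.inl ⟨γ, hγ, rfl⟩),
        mem_clauseTerms.2 ⟨_, List.mem_singleton.2 rfl, ht⟩⟩⟩
    rintro (⟨hext, h⟩ | ⟨hext, h⟩)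
    · obtain ⟨γ, hγ, ht⟩ := mem_atomsTerms.1 h
      exact key γ (Or.inl hγ) hext ht
    · obtain ⟨γ, hγ, ht⟩ := mem_atomsTerms.1 h
      exact key γ (Or.inr hγ) hext ht

theorem isFlat_of_flatAtoms {e : (extLang L F).Term ℕ → ℕ} {A : List (Atom (extLang L F))}
    {t : (extLang L F).Term ℕ} (h : IsExt t ∧ t ∈ atomsTerms (flatAtoms e A)) : IsFlat t := by
  obtain ⟨n, f, ts, -, rfl⟩ := ext_mem_flatAtoms h.1 h.2
  exact ⟨n, f, fun i => e (ts i), rfl⟩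

section Problem

variable {T₀ : L.Theory} {P : Set (BinRel L)} {K : Set (Clause (extLang L F))}
  {Ψ : Set ((extLang L F).Term ℕ) → Set ((extLang L F).Term ℕ)}

theorem separated_of_flatAtoms {Γ : List (Atom (extLang L F))} {e : (extLang L F).Term ℕ → ℕ}
    {ε : ℕ → (extLang L F).Term ℕ} (hε : ∀ t, ε (e t) = t)
    {A : List (Atom (extLang L F))} (hA : ∀ α ∈ A, α ∈ Γ)
    {G₂ : (extLang L F).Term ℕ → Prop} {γ : Atom (extLang L F)} (hγ : γ ∈ flatAtoms e A) :
    (∀ s ∈ γ.args, Gen (nameSet e A) (Theta K (extSymbolsIn (atomsTerms A))) s) ∧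
    Separated (modelsOf T₀) e (Valid (extModels T₀ K) Γ ε)
      (Gen (nameSet e A) (Theta K (extSymbolsIn (atomsTerms A)))) G₂ (nameAtom e γ) := by
  have hargs : ∀ s ∈ γ.args, Gen (nameSet e A) (Theta K (extSymbolsIn (atomsTerms A))) s := by
    intro s hs
    obtain ⟨t, ht, rfl | rfl⟩ := args_flatAtoms hγ hs
    · exact gen_var.2 ⟨t, ht, rfl⟩
    · exact gen_flatTerm ht
  refine ⟨hargs, Separated.of_pure (valid_iff.2 fun M _ hM v hv => ?_) fun c hc => ?_⟩
  · rw [← holds_nameAtom (w := fun d => (ε d).realize v) (fun t _ => by simp only [hε])]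
    exact flatAtoms_holds hε (fun α hα => hv α (hA α hα)) hγ
  · obtain ⟨t, ht, rfl⟩ := consts_nameAtom hc
    exact ⟨t, rfl, hargs t ht⟩

/-- The conclusion of an interpolation problem is separated. -/
theorem separated_of_isProblem (hconv : ConvexTheory (modelsOf T₀))
    (hint : PInterpolating (modelsOf T₀) allShared P)
    (heq : RInterpolating (modelsOf T₀) allShared none)
    (hform : MonCompForm T₀ P K) (hsep : Separable K Ψ) (hloc : PsiLocal T₀ K Ψ)
    {R : BinRel L} {A B : List (Atom (extLang L F))} {a b : ℕ}
    (hprob : IsProblem (extModels T₀ K) (BinRel.ext F R) A B a b)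
    {e : (extLang L F).Term ℕ → ℕ} {ε : ℕ → (extLang L F).Term ℕ} (hε : ∀ t, ε (e t) = t)
    (ha : e (Term.var a) = a) (hb : e (Term.var b) = b) :
    Separated (modelsOf T₀) e (Valid (extModels T₀ K) (A ++ B) ε)
      (Gen (nameSet e A) (Theta K (extSymbolsIn (atomsTerms A))))
      (Gen (nameSet e B) (Theta K (extSymbolsIn (atomsTerms B))))
      (R.atom (Term.var a) (Term.var b)) := by
  by_contra hno
  -- The defining equation of a name of a base term is valid and speaks about one side only, because
  -- the arguments are on the side of the term.
  have hpureN : ∀ {C : Set ℕ} {Fs : Set (Σ n, F n)}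
      {G₂ : (extLang L F).Term ℕ → Prop} {n : ℕ} {f : L.Functions n}
      {ts : Fin n → (extLang L F).Term ℕ},
      Gen C Fs (Term.func (L := extLang L F) (Sum.inl f) ts) →
      Separated (modelsOf T₀) e (Valid (extModels T₀ K) (A ++ B) ε) (Gen C Fs) G₂
        (Sum.inl (Term.var (e (Term.func (L := extLang L F) (Sum.inl f) ts)),
          Term.func f fun i => Term.var (e (ts i)))) := by
    intro C Fs G₂ n f ts h
    refine Separated.of_pure (valid_iff.2 fun M _ hM v hv => ?_) fun c hc => ?_
    · simp only [Atom.Holds, Term.realize, hε]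
      rfl
    · obtain ⟨s, hs, hc⟩ := mem_consts_atomTerms.1 hc
      rcases hs with rfl | rfl
      · exact ⟨_, mem_consts_var.1 hc, h⟩
      · obtain ⟨i, hi⟩ := mem_consts_func.1 hc
        exact ⟨_, mem_consts_var.1 hi, gen_arg h i⟩
  -- Congruence for two terms of the same side needs only validity of the argument equations.
  have hpureC : ∀ {G₁ G₂ G₃ G₄ : (extLang L F).Term ℕ → Prop} {n : ℕ} {f : F n}
      {ts ts' : Fin n → (extLang L F).Term ℕ},
      G₁ (Term.func (L := extLang L F) (Sum.inr f) ts) →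
      G₁ (Term.func (L := extLang L F) (Sum.inr f) ts') →
      (∀ i, Separated (modelsOf T₀) e (Valid (extModels T₀ K) (A ++ B) ε) G₃ G₄
        (Sum.inl (Term.var (e (ts i)), Term.var (e (ts' i))))) →
      Separated (modelsOf T₀) e (Valid (extModels T₀ K) (A ++ B) ε) G₁ G₂
        (Sum.inl (Term.var (e (Term.func (L := extLang L F) (Sum.inr f) ts)),
          Term.var (e (Term.func (L := extLang L F) (Sum.inr f) ts')))) := by
    intro G₁ G₂ G₃ G₄ n f ts ts' h h' hi
    refine Separated.of_valid (R := none) hε h h' fun M _ hM v hv => ?_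
    have := fun i => valid_iff.1 (hi i).valid M hM v hv
    simp only [Atom.Holds, Term.realize, hε] at this
    simp only [BinRel.Rel, Term.realize, this]
  have hlinkA : ∀ f g, Linked K f g → f ∈ Theta K (extSymbolsIn (atomsTerms A)) →
      g ∈ Theta K (extSymbolsIn (atomsTerms A)) := fun f g h hf => Theta.of_linked h hf
  have hlinkB : ∀ f g, Linked K f g → f ∈ Theta K (extSymbolsIn (atomsTerms B)) →
      g ∈ Theta K (extSymbolsIn (atomsTerms B)) := fun f g h hf => Theta.of_linked h hf
  have hamem : Gen (nameSet e A) (Theta K (extSymbolsIn (atomsTerms A)))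
      (Term.var a : (extLang L F).Term ℕ) := gen_var.2 ⟨Term.var a, hprob.1, ha⟩
  have hbmem : Gen (nameSet e B) (Theta K (extSymbolsIn (atomsTerms B)))
      (Term.var b : (extLang L F).Term ℕ) := gen_var.2 ⟨Term.var b, hprob.2.1, hb⟩
  -- The model is built over A-terms and B-terms only, and its true atoms are the separated ones. By
  -- assumption the goal is not among them, so it also serves as the missing atom that keeps the
  -- closed set proper.
  obtain ⟨M, S, v, hM, hv⟩ := satisfiable_of_local hconv hloc
    (N := {s | Gen (nameSet e A) (Theta K (extSymbolsIn (atomsTerms A))) s ∨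
      Gen (nameSet e B) (Theta K (extSymbolsIn (atomsTerms B))) s})
    (fun n f ts h i => h.imp (fun h => gen_arg h i) fun h => gen_arg h i) e
    (Q := {β | Separated (modelsOf T₀) e (Valid (extModels T₀ K) (A ++ B) ε)
      (Gen (nameSet e A) (Theta K (extSymbolsIn (atomsTerms A))))
      (Gen (nameSet e B) (Theta K (extSymbolsIn (atomsTerms B)))) β})
    (fun Γ β hΓ hβ => Separated.of_entails hΓ hβ) hno
    (fun n f ts h => h.elim hpureN fun h => (hpureN h).symm)
    (by
      intro n f ts ts' h h' hi
      rcases h with h | h <;> rcases h' with h' | h'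
      · exact hpureC h h' hi
      · exact Separated.congruence hε heq h h' hi
      · exact (Separated.congruence hε heq h h' fun i => (hi i).symm).symm
      · exact (hpureC h h' hi).symm)
    (G := flatClauses e A B ((BinRel.ext F R).atom (Term.var a) (Term.var b)))
    (by
      intro D hD
      rcases mem_flatClauses.1 hD with ⟨γ, hγ | hγ, rfl⟩ | rfl
      · have h := separated_of_flatAtoms (T₀ := T₀) (K := K) (Γ := A ++ B) hε
          (fun α hα => List.mem_append_left _ hα) (G₂ := Gen (nameSet e B)
            (Theta K (extSymbolsIn (atomsTerms B)))) hγ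
        refine ⟨fun l hl s hs => ?_, _, List.mem_singleton.2 rfl, by simpa using h.2⟩
        rw [List.mem_singleton.1 hl] at hs
        exact Or.inl (h.1 s hs)
      · have h := separated_of_flatAtoms (T₀ := T₀) (K := K) (Γ := A ++ B) hε
          (fun α hα => List.mem_append_right _ hα) (G₂ := Gen (nameSet e A)
            (Theta K (extSymbolsIn (atomsTerms A)))) hγ
        refine ⟨fun l hl s hs => ?_, _, List.mem_singleton.2 rfl, by simpa using h.2.symm⟩
        rw [List.mem_singleton.1 hl] at hs
        exact Or.inr (h.1 s hs)
      · refine ⟨fun l hl s hs => ?_, _, List.mem_singleton.2 rfl, ?_⟩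
        · rw [List.mem_singleton.1 hl, BinRel.args_atom] at hs
          rcases hs with rfl | rfl
          exacts [Or.inl hamem, Or.inr hbmem]
        · rw [nameAtom_atom, ha, hb]
          simpa using hno)
    (by
      rintro _ ⟨D, hD, σ, rfl, hterms⟩
      obtain ⟨n, f, g, Rs, R', x, y, s, -, hRs, hR', hinj, hs, rfl, x', y', hinj', hmon⟩ :=
        hform D hD
      have hgen : ∀ t ∈ clauseTerms (Clause.subst σ (compClause f g Rs R' x y s)), IsExt t →
          Gen (nameSet e A) (Theta K (extSymbolsIn (atomsTerms A))) t ∨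
          Gen (nameSet e B) (Theta K (extSymbolsIn (atomsTerms B))) t := by
        intro t ht hext
        have h := hterms t ht hext
        rw [est_flatClauses hform] at h
        exact (hsep _ _ ((finite_atomsTerms (flatAtoms e A)).subset fun s hs => hs.2)
          ((finite_atomsTerms (flatAtoms e B)).subset fun s hs => hs.2)
          (fun s hs => isFlat_of_flatAtoms hs) (fun s hs => isFlat_of_flatAtoms hs) t h).imp
          gen_of_generatedBy gen_of_generatedBy
      -- The heads are extension terms of a selected instance, so each lies on a side. Everything
      -- else in the instance is then located by its head.
      have hf := hgen _ (head_mem_clauseTerms σ).1 ⟨n, f, _, rfl⟩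
      have hg := hgen _ (head_mem_clauseTerms σ).2 ⟨n, g, _, rfl⟩
      refine instance_of_compClause hf hg
        (fun i => hf.imp (fun h => gen_arg h i) fun h => gen_arg h i)
        (fun i => hg.imp (fun h => gen_premise hlinkA hD hs h i)
          fun h => gen_premise hlinkB hD hs h i) fun h => ?_
      have hRs' := fun i => hint (Rs i) (hRs i)
      -- Same-side heads need validity only; in the two mixed cases interpolation goes towards the
      -- side of `g`, whose Θ-closure contains `f` and the premise functions.
      rcases hf with hf | hf <;> rcases hg with hg | hg
      · exact Separated.of_clause_of_pure hε hD σ hf hg h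
      · exact Separated.of_clause hε hlinkB hR' hRs' hD hinj hs hmon hinj' σ hf hg h
      · exact (Separated.of_clause hε hlinkA hR' hRs' hD hinj hs hmon hinj' σ hf hg
          fun i => (h i).symm).symm
      · exact (Separated.of_clause_of_pure hε hD σ hf hg h).symm)
  have hpos : ∀ γ, (γ ∈ flatAtoms e A ∨ γ ∈ flatAtoms e B) → Atom.Holds v γ := by
    intro γ hγ
    obtain ⟨l, hl, h⟩ := hv [(true, γ)] (mem_flatClauses.2 (Or.inl ⟨γ, hγ, rfl⟩))
    rw [List.mem_singleton.1 hl] at h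
    simpa [Literal.Holds] using h
  have hneg := hv _ (mem_flatClauses.2 (Or.inr rfl))
  obtain ⟨l, hl, h⟩ := hneg
  rw [List.mem_singleton.1 hl] at h
  simp only [Literal.Holds, Bool.false_eq_true, if_false] at h
  apply h
  -- The names of the original constants interpret `A` and `B` in the flattened model. Since `a` and
  -- `b` name themselves, the entailed atom is the one refuted there.
  have := hprob.2.2 M hM (fun c => v (e (Term.var c))) fun γ hγ =>
    (List.mem_append.1 hγ).elim (holds_of_flatAtoms (fun γ hγ => hpos γ (Or.inl hγ)) γ)
      (holds_of_flatAtoms (fun γ hγ => hpos γ (Or.inr hγ)) γ)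
  simpa only [BinRel.holds_atom, Term.realize, ha, hb] using this

/-- `A₀`, `B₀`, `σ` is a reduction of an interpolation problem in the extension to one in the base
theory. -/
def IsReduction (T₀ : L.Theory) (K : Set (Clause (extLang L F))) (R : BinRel L)
    (A B : List (Atom (extLang L F))) (a b : ℕ) (A₀ B₀ : List (Atom L))
    (σ : List (ℕ × (extLang L F).Term ℕ)) : Prop :=
  IsProblem (modelsOf T₀) R A₀ B₀ a b ∧
  (replacement σ a = Term.var a ∧ replacement σ b = Term.var b) ∧
  (∀ c ∈ constsIn (atomsTerms A₀) ∩ constsIn (atomsTerms B₀),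
    constsIn (subterms (replacement σ c)) ⊆ constsIn (atomsTerms A) ∩ constsIn (atomsTerms B) ∧
    symbolsIn (subterms (replacement σ c)) ⊆ thetaSharing K A B) ∧
  ∀ β ∈ A₀ ++ B₀, Entails (extModels T₀ K) (A ++ B) (β.trans (replacement σ))

/-- The translated hypotheses hold in every model of `A ∧ B`, so both halves of the base
interpolation can be evaluated there. The end constants are fixed by the replacement, and the common
constants are replaced by terms that use only shared material. -/
theorem IsReduction.isInterpolatingTerm {R : BinRel L} {A B : List (Atom (extLang L F))}
    {a b : ℕ} {A₀ B₀ : List (Atom L)} {σ : List (ℕ × (extLang L F).Term ℕ)}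
    (h : IsReduction T₀ K R A B a b A₀ B₀ σ) {t₀ : L.Term ℕ}
    (ht : IsInterpolatingTerm (modelsOf T₀) allShared R A₀ B₀ a b t₀) :
    IsInterpolatingTerm (extModels T₀ K) (thetaSharing K) (BinRel.ext F R) A B a b
      (translate σ t₀) := by
  obtain ⟨hprob, ⟨ha, hb⟩, hc, hv⟩ := h
  obtain ⟨htc, -, h₁, h₂⟩ := ht
  have hall : ∀ (M : Type) [(extLang L F).Structure M], extModels T₀ K M → ∀ v : ℕ → M,
      (∀ γ ∈ A ++ B, Atom.Holds v γ) → ∀ γ ∈ A₀ ++ B₀, @Atom.Holds L M (baseStr L F M)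
        (fun c => (replacement σ c).realize v) γ := fun M _ hM v hv' γ hγ =>
    entails_trans_iff.1 (hv γ hγ) M hM v hv'
  refine ⟨fun c hcc => ?_, fun s hs => ?_, fun M _ hM v hv' => ?_, fun M _ hM v hv' => ?_⟩
  · obtain ⟨d, hd, hcd⟩ := mem_consts_subst.1 hcc
    rw [consts_lift] at hd
    exact (hc d (htc hd)).1 hcd
  · rcases mem_symbols_subst.1 hs with h | ⟨d, hd, hsd⟩
    · exact Or.inl (mem_symbols_lift h)
    · rw [consts_lift] at hd
      exact (hc d (htc hd)).2 hsd
  · have := @h₁ M (baseStr L F M) hM.1 _ (hall M hM v hv')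
    simp only [BinRel.holds_atom, Term.realize, ha] at this
    rw [BinRel.holds_atom, BinRel.rel_ext, translate, Term.realize_subst, realize_lift]
    exact this
  · have := @h₂ M (baseStr L F M) hM.1 _ (hall M hM v hv')
    simp only [BinRel.holds_atom, Term.realize, hb] at this
    rw [BinRel.holds_atom, BinRel.rel_ext, translate, Term.realize_subst, realize_lift]
    exact this

theorem replacement_map (θ : ℕ → L.Term ℕ) (l : List ℕ) {c : ℕ} (hc : c ∈ l) :
    replacement (l.map fun c => (c, θ c)) c = θ c := by
  induction l with
  | nil => simp at hc
  | cons d l ih =>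
    simp only [List.map_cons, replacement]
    split_ifs with h
    · rw [h]
    · exact ih ((List.mem_cons.1 hc).resolve_left h)

theorem finite_constsIn {S : Set (L.Term ℕ)} (hS : S.Finite) : (constsIn S).Finite :=
  hS.preimage fun c _ d _ h => by injection h

/-- A substitution agrees on finitely many constants with a list of replacements. -/
theorem exists_replacement (θ : ℕ → L.Term ℕ) {C : Set ℕ} (hC : C.Finite) :
    ∃ σ : List (ℕ × L.Term ℕ), ∀ c ∈ C, replacement σ c = θ c :=
  ⟨hC.toFinset.toList.map fun c => (c, θ c), fun c hc =>
    replacement_map θ _ (by simpa using hc)⟩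

/-- Every interpolation problem in the extension can be reduced to one in the base theory. -/
theorem exists_isReduction [Countable (Σ n, (extLang L F).Functions n)]
    (hconv : ConvexTheory (modelsOf T₀))
    (hint : PInterpolating (modelsOf T₀) allShared P)
    (heq : RInterpolating (modelsOf T₀) allShared none)
    (hform : MonCompForm T₀ P K) (hsep : Separable K Ψ) (hloc : PsiLocal T₀ K Ψ)
    {R : BinRel L} {A B : List (Atom (extLang L F))} {a b : ℕ}
    (hprob : IsProblem (extModels T₀ K) (BinRel.ext F R) A B a b) :
    ∃ A₀ B₀ σ, IsReduction T₀ K R A B a b A₀ B₀ σ := by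
  obtain ⟨e, ε, hε, ha, hb⟩ := exists_naming (L := L) (F := F) a b
  obtain ⟨A₁, B₁, hA₁, hB₁, h⟩ :=
    separated_of_isProblem hconv hint heq hform hsep hloc hprob hε ha hb
  have hA₀ := hA₁.cons_refl (u := Term.var a) (gen_var.2 ⟨Term.var a, hprob.1, ha⟩)
  have hB₀ := hB₁.cons_refl (u := Term.var b) (gen_var.2 ⟨Term.var b, hprob.2.1, hb⟩)
  rw [ha] at hA₀
  rw [hb] at hB₀
  have hmemA := mem_consts_cons_refl (c := a) (l := A₁)
  have hmemB := mem_consts_cons_refl (c := b) (l := B₁)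
  have hent : Entails (modelsOf T₀) ((Sum.inl (Term.var a, Term.var a) :: A₁) ++
      (Sum.inl (Term.var b, Term.var b) :: B₁)) (R.atom (Term.var a) (Term.var b)) :=
    fun M _ hM v hv => h M hM v fun γ hγ => hv γ (by
      simp only [List.mem_append, List.mem_cons] at hγ ⊢; tauto)
  generalize (Sum.inl (Term.var a, Term.var a) :: A₁ : List (Atom L)) = A₀ at hA₀ hmemA hent
  generalize (Sum.inl (Term.var b, Term.var b) :: B₁ : List (Atom L)) = B₀ at hB₀ hmemB hent
  -- Both levels of naming are undone at once; only the finitely many constants of the two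
  -- conjunctions matter.
  obtain ⟨σ, hσ⟩ := exists_replacement (fun c => (ε c).subst ε)
    ((finite_constsIn (finite_atomsTerms A₀)).union (finite_constsIn (finite_atomsTerms B₀)))
  -- Self-naming constants survive both rounds of replacement, so the end points `a` and `b` are
  -- preserved.
  have hfix : ∀ c, e (Term.var c) = c → (ε c).subst ε = Term.var c := by
    intro c hc
    have h : ε c = Term.var c := by rw [← hε (Term.var c), hc]
    rw [h, Term.subst, h]
  have hsub : ∀ {A : List (Atom (extLang L F))} {t : (extLang L F).Term ℕ},
      t ∈ atomsTerms A → constsIn (subterms t) ⊆ constsIn (atomsTerms A) ∧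
        extSymbolsIn (subterms t) ⊆ extSymbolsIn (atomsTerms A) := by
    intro A t ht
    exact ⟨fun c hc => subterms_subset_atomsTerms ht hc,
      fun s ⟨us, hs⟩ => ⟨us, subterms_subset_atomsTerms ht hs⟩⟩
  -- Replacing the flattening names by subterms of `A` brings in only constants and extension
  -- functions of `A`. Applied to both sides, this yields sharing for the common constants.
  have hside : ∀ {A : List (Atom (extLang L F))} {s : (extLang L F).Term ℕ},
      Gen (nameSet e A) (Theta K (extSymbolsIn (atomsTerms A))) s →
      constsIn (subterms (s.subst ε)) ⊆ constsIn (atomsTerms A) ∧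
      extSymbolsIn (subterms (s.subst ε)) ⊆ Theta K (extSymbolsIn (atomsTerms A)) := by
    intro A s hs
    refine ⟨fun c hc => ?_, fun g hg => ?_⟩
    · obtain ⟨d, hd, hcd⟩ := mem_consts_subst.1 hc
      obtain ⟨t, ht, rfl⟩ := hs.1 hd
      rw [hε] at hcd
      exact (hsub ht).1 hcd
    · rcases mem_symbols_subst.1 hg with h | ⟨d, hd, hgd⟩
      · exact hs.2 h
      · obtain ⟨t, ht, rfl⟩ := hs.1 hd
        rw [hε] at hgd
        exact subset_theta _ ((hsub ht).2 hgd)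
  refine ⟨A₀, B₀, σ, ⟨hmemA, hmemB, hent⟩, ⟨?_, ?_⟩, fun c ⟨hcA, hcB⟩ => ?_, fun β hβ => ?_⟩
  · rw [hσ a (Or.inl hmemA), hfix a ha]
  · rw [hσ b (Or.inr hmemB), hfix b hb]
  · rw [hσ c (Or.inl hcA)]
    have h₁ := hside (hA₀.gen hε hcA).2
    have h₂ := hside (hB₀.gen hε hcB).2
    refine ⟨Set.subset_inter h₁.1 h₂.1, fun s hs => ?_⟩
    obtain ⟨n, f | f⟩ := s
    · exact Or.inl ⟨n, f, rfl⟩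
    · exact Or.inr ⟨n, f, rfl, h₁.2 hs, h₂.2 hs⟩
  · have hval : Valid (extModels T₀ K) (A ++ B) ε β :=
      (List.mem_append.1 hβ).elim (fun h => (hA₀ β h).1) fun h => (hB₀ β h).1
    rw [trans_congr (θ' := fun c => (ε c).subst ε)]
    · exact hval
    · intro c hc
      refine hσ c ((List.mem_append.1 hβ).imp (fun h => ?_) fun h => ?_)
      · exact mem_atomsTerms.2 ⟨β, h, hc⟩
      · exact mem_atomsTerms.2 ⟨β, h, hc⟩

/-- The interpolation property of the extension. -/
theorem pInterpolating_extModels [Countable (Σ n, (extLang L F).Functions n)]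
    (hconv : ConvexTheory (modelsOf T₀))
    (hint : PInterpolating (modelsOf T₀) allShared P)
    (heq : RInterpolating (modelsOf T₀) allShared none)
    (hform : MonCompForm T₀ P K) (hsep : Separable K Ψ) (hloc : PsiLocal T₀ K Ψ) :
    PInterpolating (extModels T₀ K) (thetaSharing K) (BinRel.ext F '' P) := by
  rintro _ ⟨R, hR, rfl⟩
  refine ⟨fun Γ Δ hΔ _ => convex_extModels hconv hloc hform Γ Δ hΔ fun _ _ => trivial,
    fun A B a b hprob => ?_⟩
  obtain ⟨A₀, B₀, σ, h⟩ := exists_isReduction hconv hint heq hform hsep hloc hprob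
  obtain ⟨t₀, ht₀⟩ := (hint R hR).2 A₀ B₀ a b h.1
  exact ⟨_, h.isInterpolatingTerm ht₀⟩

end Problem

end Extension

/-! ### Finite refutations witnessing entailment in the extension. -/

section Extension

variable {L : FirstOrder.Language.{0, 0}} {F : ℕ → Type}

/-- The functionality clause of an extension function. -/
def congClause (L : FirstOrder.Language.{0, 0}) {n : ℕ} (f : F n) : Clause (extLang L F) :=
  monClause f (fun _ => none) none (fun i => (i : ℕ)) fun i => n + i

/-- The clause `x ≈ x`. -/
def reflClause (L : FirstOrder.Language.{0, 0}) (F : ℕ → Type) : Clause (extLang L F) :=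
  [(true, Sum.inl (Term.var 0, Term.var 0))]

/-- The clauses of `K` and the axioms of equality needed for hierarchical refutations. -/
def axiomClauses (K : Set (Clause (extLang L F))) : Set (Clause (extLang L F)) :=
  {D | D ∈ K ∨ (∃ s : Σ n, F n, D = congClause L s.2) ∨ D = reflClause L F}

/-- `D` belongs to `G` or is an instance of an axiom. -/
def IsInput (K : Set (Clause (extLang L F))) (G : List (Clause (extLang L F)))
    (D : Clause (extLang L F)) : Prop :=
  D ∈ G ∨ ∃ D' ∈ axiomClauses K, ∃ ρ : List (ℕ × (extLang L F).Term ℕ),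
    D = D'.subst (replacement ρ)

/-- A refutation of `G`: a finite unsatisfiable set of base clauses that become inputs under
a replacement of constants. -/
def IsRefutation (T₀ : L.Theory) (K : Set (Clause (extLang L F)))
    (G : List (Clause (extLang L F))) (C : List (Clause L))
    (σ : List (ℕ × (extLang L F).Term ℕ)) : Prop :=
  (∀ D ∈ C, IsInput K G (D.trans (replacement σ))) ∧ ¬ Satisfiable (modelsOf T₀) {D | D ∈ C}

theorem literal_holds_trans {M : Type} [(extLang L F).Structure M] {v : ℕ → M} {l : Literal L}
    {θ : ℕ → (extLang L F).Term ℕ} :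
    Literal.Holds v ((l.1, Atom.trans θ l.2) : Literal (extLang L F)) ↔
      @Literal.Holds L M (baseStr L F M) (fun c => (θ c).realize v) l := by
  simp only [Literal.Holds, holds_trans]

theorem clause_holds_trans {M : Type} [(extLang L F).Structure M] {v : ℕ → M} {D : Clause L}
    {θ : ℕ → (extLang L F).Term ℕ} :
    Clause.Holds v (D.trans θ) ↔
      @Clause.Holds L M (baseStr L F M) (fun c => (θ c).realize v) D := by
  simp only [Clause.Holds, Clause.trans, List.mem_map]
  constructor
  · rintro ⟨_, ⟨l, hl, rfl⟩, h⟩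
    exact ⟨l, hl, literal_holds_trans.1 h⟩
  · rintro ⟨l, hl, h⟩
    exact ⟨_, ⟨l, hl, rfl⟩, literal_holds_trans.2 h⟩

theorem holds_axiomClause {T₀ : L.Theory} {K : Set (Clause (extLang L F))} {M : Type}
    [(extLang L F).Structure M] (hM : extModels T₀ K M) {D : Clause (extLang L F)}
    (hD : D ∈ axiomClauses K) (v : ℕ → M) : Clause.Holds v D := by
  rcases hD with hD | ⟨s, rfl⟩ | rfl
  · exact hM.2 D hD v
  · refine holds_compClause.2 fun h => ?_
    simp only [BinRel.ext, BinRel.Rel, Term.realize] at h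
    simp only [BinRel.ext, BinRel.Rel, Term.realize, varApp, h]
  · exact ⟨_, List.mem_singleton.2 rfl, by simp [Literal.Holds, Atom.Holds]⟩

/-- A model of `G` in the extension satisfies every input, so interpreting constants by their
replacement terms in the base reduct would satisfy the unsatisfiable base clauses. The replacement
need not be injective. -/
theorem IsRefutation.not_satisfiable {T₀ : L.Theory} {K : Set (Clause (extLang L F))}
    {G : List (Clause (extLang L F))} {C : List (Clause L)}
    {σ : List (ℕ × (extLang L F).Term ℕ)} (h : IsRefutation T₀ K G C σ) :
    ¬ Satisfiable (extModels T₀ K) {D | D ∈ G} := by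
  rintro ⟨M, S, v, hM, hv⟩
  refine h.2 ⟨M, baseStr L F M, fun c => (replacement σ c).realize v, hM.1, fun D hD => ?_⟩
  rw [← clause_holds_trans]
  rcases h.1 D hD with h' | ⟨D', hD', ρ, h'⟩
  · exact hv _ h'
  · rw [h', Clause.holds_subst]
    exact holds_axiomClause hM hD' _

theorem finite_clauseTerms (D : Clause L) : (clauseTerms D).Finite := by
  have := (List.finite_toSet D).biUnion fun l _ => Atom.finite_terms l.2
  simpa [clauseTerms] using this

theorem clause_subst_congr {D : Clause L} {σ τ : ℕ → L.Term ℕ}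
    (h : ∀ c ∈ constsIn (clauseTerms D), σ c = τ c) : D.subst σ = D.subst τ := by
  refine List.map_congr_left fun l hl => ?_
  rw [Atom.subst_congr fun c hc => h c (mem_clauseTerms.2 ⟨l, hl, hc⟩)]

theorem clause_trans_congr {D : Clause L} {θ θ' : ℕ → (extLang L F).Term ℕ}
    (h : ∀ c ∈ constsIn (clauseTerms D), θ c = θ' c) : D.trans θ = D.trans θ' := by
  refine List.map_congr_left fun l hl => ?_
  rw [trans_congr fun c hc => h c (mem_clauseTerms.2 ⟨l, hl, hc⟩)]

/-- A clause has finitely many variables, so an arbitrary substitution acts on it like a finite list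
of replacements. This makes the witness of being an input a finite object that can be searched for.
-/
theorem IsInput.of_subst {K : Set (Clause (extLang L F))} {G : List (Clause (extLang L F))}
    {D : Clause (extLang L F)} (hD : D ∈ axiomClauses K) (σ : ℕ → (extLang L F).Term ℕ) :
    IsInput K G (D.subst σ) := by
  obtain ⟨ρ, hρ⟩ := exists_replacement σ (finite_constsIn (finite_clauseTerms D))
  exact Or.inr ⟨D, hD, ρ, (clause_subst_congr hρ).symm⟩

/-- The base clause in which all arguments are named by constants. -/
def nameClause (e : (extLang L F).Term ℕ → ℕ) (D : Clause (extLang L F)) : Clause L :=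
  D.map fun l => (l.1, nameAtom e l.2)

theorem trans_nameClause {e : (extLang L F).Term ℕ → ℕ} {ε : ℕ → (extLang L F).Term ℕ}
    (hε : ∀ t, ε (e t) = t) (D : Clause (extLang L F)) : (nameClause e D).trans ε = D := by
  simp only [Clause.trans, nameClause, List.map_map, Function.comp_def, trans_nameAtom hε]
  exact List.map_id D

/-- `β` follows in the base theory from finitely many clauses that become inputs when names are
replaced by terms. -/
def Derivable (T₀ : L.Theory) (K : Set (Clause (extLang L F))) (G : List (Clause (extLang L F)))
    (ε : ℕ → (extLang L F).Term ℕ) (β : Atom L) : Prop :=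
  ∃ C : List (Clause L), (∀ D ∈ C, IsInput K G (D.trans ε)) ∧
    ∀ (M : Type) [L.Structure M], modelsOf T₀ M → ∀ v : ℕ → M,
      (∀ D ∈ C, Clause.Holds v D) → Atom.Holds v β

section Derivable

variable {T₀ : L.Theory} {K : Set (Clause (extLang L F))} {G : List (Clause (extLang L F))}
  {e : (extLang L F).Term ℕ → ℕ} {ε : ℕ → (extLang L F).Term ℕ}

/-- Finitely many derivable atoms follow from a common finite set of clauses. -/
theorem Derivable.exists_common {Γ : List (Atom L)} (hΓ : ∀ γ ∈ Γ, Derivable T₀ K G ε γ) :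
    ∃ C : List (Clause L), (∀ D ∈ C, IsInput K G (D.trans ε)) ∧
    ∀ (M : Type) [L.Structure M], modelsOf T₀ M → ∀ v : ℕ → M,
      (∀ D ∈ C, Clause.Holds v D) → ∀ γ ∈ Γ, Atom.Holds v γ := by
  induction Γ with
  | nil => exact ⟨[], by simp, by simp⟩
  | cons γ Γ ih =>
    obtain ⟨C, hC, h⟩ := ih fun γ' hγ' => hΓ γ' (List.mem_cons_of_mem _ hγ')
    obtain ⟨C₁, hC₁, h₁⟩ := hΓ γ List.mem_cons_self
    refine ⟨C₁ ++ C, fun D hD => (List.mem_append.1 hD).elim (hC₁ D) (hC D),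
      fun M _ hM v hv γ' hγ' => ?_⟩
    rcases List.mem_cons.1 hγ' with rfl | hγ'
    · exact h₁ M hM v fun D hD => hv D (List.mem_append_left _ hD)
    · exact h M hM v (fun D hD => hv D (List.mem_append_right _ hD)) γ' hγ'

/-- The named form of the instance is added to the clauses deriving the premises; its negative
literals are then false, which leaves the head. -/
theorem Derivable.of_clause (hε : ∀ t, ε (e t) = t) {n : ℕ} {f g : F n} {Rs : Fin n → BinRel L}
    {R : BinRel L} {x y : Fin n → ℕ} {s : Fin n → (extLang L F).Term ℕ}
    (hD : compClause f g Rs R x y s ∈ axiomClauses K) (σ : ℕ → (extLang L F).Term ℕ)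
    (h : ∀ i, Derivable T₀ K G ε
      ((Rs i).atom (Term.var (e (σ (x i)))) (Term.var (e ((s i).subst σ))))) :
    Derivable T₀ K G ε
      (R.atom (Term.var (e (Term.func (L := extLang L F) (Sum.inr f) fun i => σ (x i))))
        (Term.var (e (Term.func (L := extLang L F) (Sum.inr g) fun i => σ (y i))))) := by
  obtain ⟨C, hC, hC'⟩ := Derivable.exists_common (T₀ := T₀) (K := K) (G := G) (ε := ε)
    (Γ := List.ofFn fun i =>
      (Rs i).atom (Term.var (e (σ (x i)))) (Term.var (e ((s i).subst σ)))) (by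
      intro γ hγ
      obtain ⟨i, rfl⟩ := List.mem_ofFn.1 hγ
      exact h i)
  refine ⟨nameClause e (Clause.subst σ (compClause f g Rs R x y s)) :: C, fun D hD' => ?_,
    fun M _ hM v hv => ?_⟩
  · rcases List.mem_cons.1 hD' with rfl | hD'
    · rw [trans_nameClause hε]
      exact IsInput.of_subst hD σ
    · exact hC D hD'
  · have hpre := hC' M hM v fun D hD => hv D (List.mem_cons_of_mem _ hD)
    obtain ⟨_, hl', hh⟩ := hv _ List.mem_cons_self
    obtain ⟨l, hl, rfl⟩ := List.mem_map.1 hl'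
    rcases mem_subst_compClause.1 hl with ⟨i, rfl⟩ | rfl
    · have := hpre _ (List.mem_ofFn.2 ⟨i, rfl⟩)
      simp only [Literal.Holds, nameAtom_atom, Bool.false_eq_true, if_false] at hh
      exact absurd this hh
    · simpa only [Literal.Holds, nameAtom_atom, if_true] using hh

end Derivable

/-- Entailment of atoms in a local extension is witnessed by refutations. -/
theorem exists_isRefutation [Countable (Σ n, (extLang L F).Functions n)] {T₀ : L.Theory}
    (hconv : ConvexTheory (modelsOf T₀)) {K : Set (Clause (extLang L F))}
    {Ψ : Set ((extLang L F).Term ℕ) → Set ((extLang L F).Term ℕ)} (hloc : PsiLocal T₀ K Ψ)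
    {P : Set (BinRel L)} (hform : MonCompForm T₀ P K) {Γ : List (Atom (extLang L F))}
    {α : Atom (extLang L F)} (hent : Entails (extModels T₀ K) Γ α) :
    ∃ C σ, IsRefutation T₀ K ([(false, α)] :: Γ.map fun γ => [(true, γ)]) C σ := by
  obtain ⟨e, ε, hε, -, -⟩ := exists_naming (L := L) (F := F) 0 0
  have hder : Derivable T₀ K (Γ.map fun γ => [(true, γ)]) ε (nameAtom e α) := by
    by_contra hno
    -- The derivable atoms form a closed set. If the goal were not among them, a model of `Γ`
    -- refuting `α` would arise, against the entailment.
    refine satisfiable_of_saturated hconv hloc hform e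
      (Q := {β | Derivable T₀ K (Γ.map fun γ => [(true, γ)]) ε β}) ?_ ?_ ?_ ?_
      (Γ := Γ) (Δ := [α]) (by simp) ?_ (by simpa using hno) ?_
    · intro Γ' β hΓ' hβ
      obtain ⟨C, hC, h⟩ := Derivable.exists_common hΓ'
      exact ⟨C, hC, fun M _ hM v hv => hβ M hM v (h M hM v hv)⟩
    · intro n f ts
      -- The definition of the name of a base term translates to an equation of that term with
      -- itself, an instance of reflexivity. This is the reason for including `reflClause` among the
      -- axioms.
      refine ⟨[ [(true, Sum.inl (Term.var (e (Term.func (L := extLang L F) (Sum.inl f) ts)),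
        Term.func f fun i => Term.var (e (ts i))))] ], fun D hD => ?_, fun M _ hM v hv => ?_⟩
      · rw [List.mem_singleton.1 hD]
        have := IsInput.of_subst (K := K) (G := Γ.map fun γ => [(true, γ)])
          (Or.inr (Or.inr rfl)) fun _ => Term.func (L := extLang L F) (Sum.inl f) ts
        simp only [reflClause, Clause.subst, List.map_cons, List.map_nil, Atom.subst,
          Term.subst] at this
        simp only [Clause.trans, List.map_cons, List.map_nil, Atom.trans, Atom.lift, Atom.subst,
          LHom.onTerm, Term.subst, hε]
        exact this
      · obtain ⟨l, hl, h⟩ := hv _ (List.mem_singleton.2 rfl)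
        rw [List.mem_singleton.1 hl] at h
        simpa [Literal.Holds] using h
    · intro n f ts ts' h
      have hx : ∀ σ : ℕ → (extLang L F).Term ℕ, (∀ i : Fin n, σ i = ts i) →
          (∀ i : Fin n, σ (n + i) = ts' i) →
          Derivable T₀ K (Γ.map fun γ => [(true, γ)]) ε
            (Sum.inl (Term.var (e (Term.func (L := extLang L F) (Sum.inr f) ts)),
              Term.var (e (Term.func (L := extLang L F) (Sum.inr f) ts')))) := by
        intro σ h₁ h₂
        have := Derivable.of_clause (T₀ := T₀) (K := K) (G := Γ.map fun γ => [(true, γ)]) hε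
          (f := f) (g := f) (Rs := fun _ => none) (R := none) (x := fun i => (i : ℕ))
          (y := fun i => n + i) (s := fun i => Term.var (n + i))
          (Or.inr (Or.inl ⟨⟨n, f⟩, rfl⟩)) σ (fun i => by
            simp only [Term.subst, h₁, h₂]
            exact h i)
        simp only [h₁, h₂] at this
        exact this
      -- The functionality clause has the variables 0, …, n-1 on the left and n, …, 2n-1 on the
      -- right; all others get a dummy term.
      exact hx (fun c => if hc : c < n then ts ⟨c, hc⟩ else
        if hc' : c - n < n then ts' ⟨c - n, hc'⟩ else Term.var 0) (fun i => by simp) (fun i => by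
          simp)
    · intro n f g Rs R x y s hD σ h
      exact Derivable.of_clause hε (Or.inl hD) σ h
    · intro γ hγ
      refine ⟨[nameClause e [(true, γ)] ], fun D hD => ?_, fun M _ hM v hv => ?_⟩
      · rw [List.mem_singleton.1 hD, trans_nameClause hε]
        exact Or.inl (List.mem_map.2 ⟨γ, hγ, rfl⟩)
      · obtain ⟨l, hl, h⟩ := hv _ (List.mem_singleton.2 rfl)
        rw [List.mem_singleton.1 hl] at h
        simpa [Literal.Holds] using h
    · exact fun M _ hM v hv => ⟨α, List.mem_singleton.2 rfl, hent M hM v hv⟩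
  obtain ⟨C, hC, h⟩ := hder
  -- The negated goal is added to the derivation, which turns it into a refutation; finitely many
  -- names occur, so `ε` can be cut down to a list.
  have hfin : (⋃ D ∈ nameClause e [(false, α)] :: C, constsIn (clauseTerms D)).Finite :=
    (List.finite_toSet _).biUnion fun D _ => finite_constsIn (finite_clauseTerms D)
  obtain ⟨σ, hσ⟩ := exists_replacement ε hfin
  refine ⟨nameClause e [(false, α)] :: C, σ, fun D hD => ?_, ?_⟩
  · rw [clause_trans_congr (θ' := ε) fun c hc => hσ c (Set.mem_biUnion hD hc)]
    rcases List.mem_cons.1 hD with rfl | hD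
    · rw [trans_nameClause hε]
      exact Or.inl List.mem_cons_self
    · exact (hC D hD).imp (fun h => List.mem_cons_of_mem _ h) id
  · rintro ⟨M, S, v, hM, hv⟩
    have hα := h M hM v fun D hD => hv D (List.mem_cons_of_mem _ hD)
    obtain ⟨l, hl, hh⟩ := hv _ List.mem_cons_self
    rw [List.mem_singleton.1 hl] at hh
    simp only [Literal.Holds, Bool.false_eq_true, if_false] at hh
    exact hh hα

theorem entails_iff_isRefutation [Countable (Σ n, (extLang L F).Functions n)] {T₀ : L.Theory}
    (hconv : ConvexTheory (modelsOf T₀)) {K : Set (Clause (extLang L F))}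
    {Ψ : Set ((extLang L F).Term ℕ) → Set ((extLang L F).Term ℕ)} (hloc : PsiLocal T₀ K Ψ)
    {P : Set (BinRel L)} (hform : MonCompForm T₀ P K) {Γ : List (Atom (extLang L F))}
    {α : Atom (extLang L F)} :
    Entails (extModels T₀ K) Γ α ↔
      ∃ C σ, IsRefutation T₀ K ([(false, α)] :: Γ.map fun γ => [(true, γ)]) C σ := by
  refine ⟨exists_isRefutation hconv hloc hform, fun ⟨C, σ, h⟩ M S hM v hv => ?_⟩
  by_contra hα
  refine h.not_satisfiable ⟨M, S, v, hM, fun D hD => ?_⟩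
  rcases List.mem_cons.1 hD with rfl | hD
  · exact ⟨_, List.mem_singleton.2 rfl, by simpa [Literal.Holds] using hα⟩
  · obtain ⟨γ, hγ, rfl⟩ := List.mem_map.1 hD
    exact ⟨_, List.mem_singleton.2 rfl, by simpa [Literal.Holds] using hv γ hγ⟩

end Extension

open Encodable

/-! ### Closure properties of recursively enumerable predicates. -/

section REPred

variable {α β : Type} [Primcodable α] [Primcodable β]

theorem rePred_comp {p : β → Prop} (hp : REPred p) {f : α → β} (hf : Computable f) :
    REPred fun a => p (f a) :=
  Partrec.comp hp hf

/-- Recursively enumerable predicates are projections of monotone primitive recursive ones. -/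
theorem exists_stages {p : α → Prop} (hp : REPred p) :
    ∃ q : α → ℕ → Prop, PrimrecRel q ∧ (∀ a k k', k ≤ k' → q a k → q a k') ∧
      ∀ a, p a ↔ ∃ k, q a k := by
  obtain ⟨c, hc⟩ := Nat.Partrec.Code.exists_code.1 hp
  -- The stage is a bound for the evaluation of a code that semidecides the predicate; raising the
  -- bound preserves results.
  refine ⟨fun a k => (Nat.Partrec.Code.evaln k c (encode a)).isSome = true, ?_, ?_, ?_⟩
  · exact PrimrecRel.comp₂ (R := fun a b : Bool => a = b) Primrec.eq
      (Primrec.option_isSome.comp (Nat.Partrec.Code.primrec_evaln.comp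
        ((Primrec.snd.pair (Primrec.const c)).pair (Primrec.encode.comp Primrec.fst)))).to₂
      (Primrec.const true).to₂
  · intro a k k' hk h
    obtain ⟨x, hx⟩ := Option.isSome_iff_exists.1 h
    exact Option.isSome_iff_exists.2 ⟨x, Nat.Partrec.Code.evaln_mono hk hx⟩
  · intro a
    have : p a ↔ (Nat.Partrec.Code.eval c (encode a)).Dom := by
      rw [hc]
      simp [Part.dom_iff_mem]
    rw [this, Part.dom_iff_mem]
    constructor
    · rintro ⟨y, hy⟩
      obtain ⟨k, hk⟩ := Nat.Partrec.Code.evaln_complete.1 hy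
      exact ⟨k, Option.isSome_iff_exists.2 ⟨y, hk⟩⟩
    · rintro ⟨k, hk⟩
      obtain ⟨y, hy⟩ := Option.isSome_iff_exists.1 hk
      exact ⟨y, Nat.Partrec.Code.evaln_sound hy⟩

theorem rePred_of_stages {p : α → Prop} {q : α → ℕ → Prop} (hq : PrimrecRel q)
    (h : ∀ a, p a ↔ ∃ k, q a k) : REPred p := by
  classical
  have hq : Primrec fun x : α × ℕ => decide (q x.1 x.2) := PrimrecPred.decide hq
  have hr : Partrec fun a => Nat.rfind fun k => Part.some (decide (q a k)) :=
    Partrec.rfind (p := fun a k => Part.some (decide (q a k))) hq.to_comp.partrec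
  refine (Partrec.dom_re hr).of_eq fun a => ?_
  rw [h a, Part.dom_iff_mem]
  constructor
  · rintro ⟨k, hk⟩
    have := Nat.rfind_spec hk
    simp only [Part.mem_some_iff] at this
    exact ⟨k, by simpa using this.symm⟩
  · rintro ⟨k, hk⟩
    exact Part.dom_iff_mem.1 (Nat.rfind_dom.2 ⟨k, by simpa using hk, fun _ => trivial⟩)

/-- Monotonicity of the stages allows both searches to be run to the maximum of the two stages. -/
theorem rePred_and {p q : α → Prop} (hp : REPred p) (hq : REPred q) :
    REPred fun a => p a ∧ q a := by
  obtain ⟨p', hp', hpm, hp⟩ := exists_stages hp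
  obtain ⟨q', hq', hqm, hq⟩ := exists_stages hq
  refine rePred_of_stages (q := fun a k => p' a k ∧ q' a k) (PrimrecPred.and hp' hq') fun a => ?_
  rw [hp, hq]
  constructor
  · rintro ⟨⟨k, hk⟩, ⟨l, hl⟩⟩
    exact ⟨max k l, hpm _ _ _ (le_max_left _ _) hk, hqm _ _ _ (le_max_right _ _) hl⟩
  · rintro ⟨k, hk, hl⟩
    exact ⟨⟨k, hk⟩, ⟨k, hl⟩⟩

theorem rePred_or {p q : α → Prop} (hp : REPred p) (hq : REPred q) :
    REPred fun a => p a ∨ q a := by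
  obtain ⟨p', hp', -, hp⟩ := exists_stages hp
  obtain ⟨q', hq', -, hq⟩ := exists_stages hq
  refine rePred_of_stages (q := fun a k => p' a k ∨ q' a k) (PrimrecPred.or hp' hq') fun a => ?_
  rw [hp, hq, exists_or]

theorem rePred_exists {p : α × β → Prop} (hp : REPred p) : REPred fun a => ∃ b, p (a, b) := by
  obtain ⟨q, hq, -, hp⟩ := exists_stages hp
  classical
  have hq : Primrec fun x : (α × β) × ℕ => decide (q x.1 x.2) := PrimrecPred.decide hq
  refine rePred_of_stages
    -- A stage now codes a pair of a witness and a stage for it, and both are searched for together.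
    (q := fun a m => (Option.casesOn (decode (α := β × ℕ) m) false
      fun x => decide (q (a, x.1) x.2) : Bool) = true) ?_ fun a => ?_
  · refine PrimrecRel.comp₂ (R := fun a b : Bool => a = b) Primrec.eq ?_ (Primrec.const true).to₂
    exact Primrec.option_casesOn (Primrec.decode.comp Primrec.snd) (Primrec.const false)
      (hq.comp (((Primrec.fst.comp Primrec.fst).pair (Primrec.fst.comp Primrec.snd)).pair
        (Primrec.snd.comp Primrec.snd))).to₂
  · constructor
    · rintro ⟨b, hb⟩
      obtain ⟨k, hk⟩ := (hp _).1 hb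
      exact ⟨encode (b, k), by rw [encodek]; simpa using hk⟩
    · rintro ⟨m, hm⟩
      cases hd : decode (α := β × ℕ) m with
      | none => rw [hd] at hm; simp at hm
      | some x =>
        rw [hd] at hm
        exact ⟨x.1, (hp _).2 ⟨x.2, by simpa using hm⟩⟩

/-- For a finite list one stage suffices for all members, again by monotonicity, and a bounded check
over a list is primitive recursive. -/
theorem rePred_forall_list {p : α × β → Prop} (hp : REPred p) :
    REPred fun x : α × List β => ∀ b ∈ x.2, p (x.1, b) := by
  obtain ⟨q, hq, hm, hp⟩ := exists_stages hp
  refine rePred_of_stages (q := fun x k => ∀ b ∈ x.2, q (x.1, b) k) ?_ fun x => ?_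
  · have h : PrimrecRel fun (b : β) (y : α × ℕ) => q (y.1, b) y.2 :=
      PrimrecRel.comp hq ((Primrec.fst.comp Primrec.snd).pair Primrec.fst)
        (Primrec.snd.comp Primrec.snd)
    exact PrimrecRel.comp (PrimrecRel.forall_mem_list h) (Primrec.snd.comp Primrec.fst)
      ((Primrec.fst.comp Primrec.fst).pair Primrec.snd)
  · simp only [hp]
    obtain ⟨a, l⟩ := x
    constructor
    · intro h
      induction l with
      | nil => exact ⟨0, by simp⟩
      | cons b l ih =>
        obtain ⟨k, hk⟩ := ih fun c hc => h c (List.mem_cons_of_mem _ hc)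
        obtain ⟨k', hk'⟩ := h b List.mem_cons_self
        refine ⟨max k k', fun c hc => ?_⟩
        rcases List.mem_cons.1 hc with rfl | hc
        · exact hm _ _ _ (le_max_right _ _) hk'
        · exact hm _ _ _ (le_max_left _ _) (hk c hc)
    · rintro ⟨k, hk⟩ b hb
      exact ⟨k, hk b hb⟩

theorem rePred_eq {f g : α → β} (hf : Computable f) (hg : Computable g) :
    REPred fun a => f a = g a := by
  have h : REPred fun x : ℕ × ℕ => x.1 = x.2 :=
    (PrimrecPred.computablePred (p := fun x : ℕ × ℕ => x.1 = x.2) Primrec.eq).to_re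
  refine (rePred_comp h ((Computable.encode.comp hf).pair (Computable.encode.comp hg))).of_eq
    fun a => encode_inj

end REPred

/-- A predicate on an encodable type is recursively enumerable. -/
def RE {X : Type} [Encodable X] (p : X → Prop) : Prop :=
  REPred fun n : ℕ => ∃ x, encode x = n ∧ p x

/-- A function between encodable types is primitive recursive on codes. -/
def PR {X Y : Type} [Encodable X] [Encodable Y] (f : X → Y) : Prop :=
  ∃ g : ℕ → ℕ, Primrec g ∧ ∀ x, g (encode x) = encode (f x)

/-- The codes of an encodable type are recursively enumerable. -/
class Recognizable (X : Type) [Encodable X] : Prop where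
  re : RE fun _ : X => True

/-! ### Enumerability and primitive recursion on codes of encodable types. -/

section RE

variable {X Y Z W : Type} [Encodable X] [Encodable Y] [Encodable Z] [Encodable W]

theorem RE.of_iff {p q : X → Prop} (hp : RE p) (h : ∀ x, q x ↔ p x) : RE q :=
  REPred.of_eq hp fun n => by simp only [h]

theorem re_of_rePred {X : Type} [Primcodable X] {p : X → Prop} (hp : REPred p) : RE p :=
  rePred_exists (p := fun y : ℕ × X => encode y.2 = y.1 ∧ p y.2)
    (rePred_and (rePred_eq (Computable.encode.comp Computable.snd) Computable.fst)
      (rePred_comp hp Computable.snd))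

/-- Transfer along an embedding that preserves codes. -/
theorem re_of_raw {A : Type} [Primcodable A] {r : X → A} (hr : ∀ x, encode (r x) = encode x)
    {p : X → Prop} (hp : REPred fun y => ∃ x, r x = y ∧ p x) : RE p := by
  refine REPred.of_eq (re_of_rePred hp) fun n => ?_
  constructor
  · rintro ⟨_, hn, x, rfl, hx⟩
    exact ⟨x, by rw [← hr, hn], hx⟩
  · rintro ⟨x, rfl, hx⟩
    exact ⟨r x, hr x, x, rfl, hx⟩

instance recognizable_primcodable {X : Type} [Primcodable X] : Recognizable X :=
  ⟨re_of_rePred (rePred_eq (Computable.const 0) (Computable.const 0) |>.of_eq fun _ => by simp)⟩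

theorem RE.and {p q : X → Prop} (hp : RE p) (hq : RE q) : RE fun x => p x ∧ q x := by
  refine REPred.of_eq (rePred_and hp hq) fun n => ?_
  constructor
  · rintro ⟨⟨x, rfl, hx⟩, ⟨y, hy, hy'⟩⟩
    cases encode_injective hy
    exact ⟨_, rfl, hx, hy'⟩
  · rintro ⟨x, rfl, hx, hx'⟩
    exact ⟨⟨x, rfl, hx⟩, ⟨x, rfl, hx'⟩⟩

theorem RE.or {p q : X → Prop} (hp : RE p) (hq : RE q) : RE fun x => p x ∨ q x :=
  REPred.of_eq (rePred_or hp hq) fun n => by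
    simp only [← exists_or, ← and_or_left]

theorem RE.exists {p : X × Y → Prop} (hp : RE p) : RE fun x => ∃ y, p (x, y) := by
  refine REPred.of_eq (rePred_exists (p := fun y : ℕ × ℕ => ∃ z : X × Y,
    encode z = Nat.pair y.1 y.2 ∧ p z) (rePred_comp hp
      (Primrec₂.natPair.comp Primrec.fst Primrec.snd).to_comp)) fun n => ?_
  constructor
  · rintro ⟨m, ⟨x, y⟩, h, hp⟩
    rw [encode_prod_val] at h
    exact ⟨x, (Nat.pair_eq_pair.1 h).1, y, hp⟩
  · rintro ⟨x, rfl, y, hp⟩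
    exact ⟨encode y, (x, y), encode_prod_val x y, hp⟩

/-- The code function is constrained only on codes of elements of `X`, so a number must first be
recognized as such a code. -/
theorem RE.comp [Recognizable X] {q : Y → Prop} (hq : RE q) {f : X → Y} (hf : PR f) :
    RE fun x => q (f x) := by
  obtain ⟨g, hg, h⟩ := hf
  refine REPred.of_eq (rePred_and (Recognizable.re (X := X)) (rePred_comp hq hg.to_comp))
    fun n => ?_
  constructor
  · rintro ⟨⟨x, rfl, -⟩, ⟨y, hy, hq⟩⟩
    rw [h] at hy
    cases encode_injective hy
    exact ⟨x, rfl, hq⟩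
  · rintro ⟨x, rfl, hq⟩
    exact ⟨⟨x, rfl, trivial⟩, ⟨f x, (h x).symm, hq⟩⟩

theorem encode_list_eq (l : List X) : encode l = encode (l.map encode) := by
  induction l with
  | nil => rfl
  | cons x l ih => simp only [List.map_cons, encode_list_cons, ih, encode_nat]

theorem decode_list_encode (l : List X) : decode (α := List ℕ) (encode l) = some (l.map encode) := by
  rw [encode_list_eq, encodek]

theorem RE.forall_list [Recognizable X] {p : X × Y → Prop} (hp : RE p) :
    RE fun x : X × List Y => ∀ y ∈ x.2, p (x.1, y) := by
  -- The list is treated as a list of codes, each checked separately. Recognition of the first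
  -- component is added since an empty list would not test it.
  have h₁ : REPred fun z : ℕ × List ℕ => ∀ m ∈ z.2, ∃ w : X × Y,
      encode w = Nat.pair z.1 m ∧ p w :=
    rePred_forall_list (p := fun z : ℕ × ℕ => ∃ w : X × Y, encode w = Nat.pair z.1 z.2 ∧ p w)
      (rePred_comp hp (Primrec₂.natPair.comp Primrec.fst Primrec.snd).to_comp)
  have h₂ := rePred_and (rePred_comp (Recognizable.re (X := X)) (Computable.fst (β := List ℕ))) h₁
  refine REPred.of_eq (re_of_rePred h₂) fun n => ?_
  constructor
  · rintro ⟨⟨a, L⟩, rfl, ⟨x, rfl, -⟩, h⟩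
    have hL : ∃ l : List Y, l.map encode = L ∧ ∀ y ∈ l, p (x, y) := by
      clear h₁ h₂
      dsimp only at h
      induction L with
      | nil => exact ⟨[], rfl, by simp⟩
      | cons m L ih =>
        obtain ⟨l, rfl, hl⟩ := ih fun m' hm' => h m' (List.mem_cons_of_mem _ hm')
        obtain ⟨⟨x', y⟩, hw, hpw⟩ := h m List.mem_cons_self
        rw [encode_prod_val] at hw
        obtain ⟨hx, rfl⟩ := Nat.pair_eq_pair.1 hw
        cases encode_injective hx
        refine ⟨y :: l, rfl, fun y' hy' => ?_⟩
        rcases List.mem_cons.1 hy' with rfl | hy'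
        exacts [hpw, hl y' hy']
    obtain ⟨l, rfl, hl⟩ := hL
    exact ⟨(x, l), by rw [encode_prod_val, encode_prod_val, encode_list_eq, encode_nat], hl⟩
  · rintro ⟨⟨x, l⟩, rfl, h⟩
    refine ⟨(encode x, l.map encode), by
      rw [encode_prod_val, encode_prod_val, encode_list_eq l, encode_nat], ⟨x, rfl, trivial⟩, ?_⟩
    intro m hm
    obtain ⟨y, hy, rfl⟩ := List.mem_map.1 hm
    exact ⟨(x, y), encode_prod_val x y, h y hy⟩

theorem PR.id : PR fun x : X => x := ⟨fun n => n, Primrec.id, fun _ => rfl⟩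

theorem PR.comp {f : Y → Z} (hf : PR f) {g : X → Y} (hg : PR g) : PR fun x => f (g x) := by
  obtain ⟨f', hf', h⟩ := hf
  obtain ⟨g', hg', h'⟩ := hg
  exact ⟨fun n => f' (g' n), hf'.comp hg', fun x => by simp only [h', h]⟩

theorem PR.const (y : Y) : PR fun _ : X => y := ⟨fun _ => encode y, Primrec.const _, fun _ => rfl⟩

theorem PR.pair {f : X → Y} (hf : PR f) {g : X → Z} (hg : PR g) : PR fun x => (f x, g x) := by
  obtain ⟨f', hf', h⟩ := hf
  obtain ⟨g', hg', h'⟩ := hg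
  exact ⟨fun n => Nat.pair (f' n) (g' n), Primrec₂.natPair.comp hf' hg', fun x => by
    simp only [h, h', encode_prod_val]⟩

theorem PR.fst : PR fun x : X × Y => x.1 :=
  ⟨fun n => n.unpair.1, Primrec.fst.comp Primrec.unpair, fun x => by
    obtain ⟨x, y⟩ := x
    simp only [encode_prod_val, Nat.unpair_pair]⟩

theorem PR.snd : PR fun x : X × Y => x.2 :=
  ⟨fun n => n.unpair.2, Primrec.snd.comp Primrec.unpair, fun x => by
    obtain ⟨x, y⟩ := x
    simp only [encode_prod_val, Nat.unpair_pair]⟩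

/-- If elements of `X` and `Y` have representations with the same codes in types with a primitive
recursive coding, functions can be computed on these representations: terms become words of symbols,
lists become lists of numbers. -/
theorem PR.of_primrec {A B : Type} [Primcodable A] [Primcodable B] {r : X → A} {s : Y → B}
    (hr : ∀ x, encode (r x) = encode x) (hs : ∀ y, encode (s y) = encode y) {f : X → Y} {g : A → B}
    (hg : Primrec g) (h : ∀ x, g (r x) = s (f x)) : PR f :=
  ⟨fun n => ((decode (α := A) n).map fun a => encode (g a)).getD 0,
    Primrec.option_getD.comp (Primrec.option_map Primrec.decode
      (Primrec.encode.comp (hg.comp Primrec.snd)).to₂) (Primrec.const 0), fun x => by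
    simp only [← hr, encodek, ← hs, ← h, Option.map_some, Option.getD_some]⟩

theorem PR.nil : PR fun _ : X => ([] : List Y) := PR.const []

theorem PR.cons {f : X → Y} (hf : PR f) {g : X → List Y} (hg : PR g) :
    PR fun x => f x :: g x := by
  obtain ⟨f', hf', h⟩ := hf
  obtain ⟨g', hg', h'⟩ := hg
  exact ⟨fun n => Nat.succ (Nat.pair (f' n) (g' n)),
    Primrec.succ.comp (Primrec₂.natPair.comp hf' hg'), fun x => by
    simp only [h, h', encode_list_cons, Nat.succ_eq_add_one]⟩

theorem PR.append {f g : X → List Y} (hf : PR f) (hg : PR g) : PR fun x => f x ++ g x := by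
  have h : PR fun z : List Y × List Y => z.1 ++ z.2 :=
    PR.of_primrec (r := fun z : List Y × List Y => (z.1.map encode, z.2.map encode))
      (s := fun l : List Y => l.map encode)
      (fun z => by
        obtain ⟨l, l'⟩ := z
        rw [encode_prod_val, encode_prod_val, encode_list_eq l, encode_list_eq l']) (fun l => by
        rw [encode_list_eq l])
      (Primrec.list_append.comp Primrec.fst Primrec.snd) fun z => by simp
  exact h.comp (hf.pair hg)

theorem PR.list_map {f : X × Y → Z} (hf : PR f) {g : X → List Y} (hg : PR g) :
    PR fun x => (g x).map fun y => f (x, y) := by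
  obtain ⟨f', hf', h⟩ := hf
  have h : PR fun z : X × List Y => z.2.map fun y => f (z.1, y) :=
    PR.of_primrec (r := fun z : X × List Y => (encode z.1, z.2.map encode))
      (s := fun l : List Z => l.map encode)
      (fun z => by
        obtain ⟨x, l⟩ := z
        rw [encode_prod_val, encode_prod_val, encode_list_eq l, encode_nat]) (fun l => by
        rw [encode_list_eq l])
      (g := fun z : ℕ × List ℕ => z.2.map fun m => f' (Nat.pair z.1 m))
      (Primrec.list_map Primrec.snd (hf'.comp (Primrec₂.natPair.comp
        (Primrec.fst.comp Primrec.fst) Primrec.snd)).to₂) fun z => by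
        simp only [List.map_map, Function.comp_def, ← encode_prod_val, h]
  exact h.comp (PR.id.pair hg)

theorem PR.list_flatten : PR fun l : List (List X) => l.flatten :=
  PR.of_primrec (r := fun l : List (List X) => l.map fun l' => l'.map encode)
    (s := fun l : List X => l.map encode)
    (fun l => by
      induction l with
      | nil => rfl
      | cons x l ih => rw [List.map_cons, encode_list_cons, encode_list_cons, ih, encode_list_eq x])
    (fun l => by rw [encode_list_eq l]) Primrec.list_flatten fun l => by
      simp [List.map_flatten]

theorem PR.list_flatMap {f : X × Y → List Z} (hf : PR f) {g : X → List Y} (hg : PR g) :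
    PR fun x => (g x).flatMap fun y => f (x, y) := by
  simp only [List.flatMap_def]
  exact PR.list_flatten.comp (PR.list_map hf hg)

instance [Recognizable X] [Recognizable Y] : Recognizable (X × Y) where
  re := by
    refine REPred.of_eq (rePred_and
      (rePred_comp (Recognizable.re (X := X)) (Primrec.fst.comp Primrec.unpair).to_comp)
      (rePred_comp (Recognizable.re (X := Y)) (Primrec.snd.comp Primrec.unpair).to_comp))
      fun n => ?_
    constructor
    · rintro ⟨⟨x, hx, -⟩, ⟨y, hy, -⟩⟩
      exact ⟨(x, y), by rw [encode_prod_val, hx, hy, Nat.pair_unpair], trivial⟩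
    · rintro ⟨⟨x, y⟩, rfl, -⟩
      rw [encode_prod_val, Nat.unpair_pair]
      exact ⟨⟨x, rfl, trivial⟩, ⟨y, rfl, trivial⟩⟩

/-- The case of a dummy parameter in `ℕ`. Recognizability of the member type is not presupposed, so
this also serves to recognize lists. -/
theorem RE.list_all {p : Y → Prop} (hp : RE p) : RE fun l : List Y => ∀ y ∈ l, p y := by
  have h : RE fun x : ℕ × List Y => ∀ y ∈ x.2, p y :=
    RE.forall_list (p := fun z : ℕ × Y => p z.2) (by
      refine REPred.of_eq (rePred_comp hp (Primrec.snd.comp Primrec.unpair).to_comp) fun n => ?_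
      constructor
      · rintro ⟨y, hy, h⟩
        exact ⟨(n.unpair.1, y), by rw [encode_prod_val, hy, encode_nat, Nat.pair_unpair], h⟩
      · rintro ⟨⟨m, y⟩, rfl, h⟩
        exact ⟨y, by rw [encode_prod_val, Nat.unpair_pair], h⟩)
  refine REPred.of_eq (rePred_comp h (Primrec₂.natPair.comp (Primrec.const 0)
    Primrec.id).to_comp) fun n => ?_
  constructor
  · rintro ⟨⟨m, l⟩, hl, h⟩
    rw [encode_prod_val] at hl
    exact ⟨l, (Nat.pair_eq_pair.1 hl).2, h⟩
  · rintro ⟨l, rfl, h⟩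
    exact ⟨(0, l), encode_prod_val _ _, h⟩

instance [Recognizable X] : Recognizable (List X) where
  re := (RE.list_all (Recognizable.re (X := X))).of_iff fun l => by simp

theorem RE.eq [Recognizable X] {f g : X → Y} (hf : PR f) (hg : PR g) : RE fun x => f x = g x := by
  obtain ⟨f', hf', h⟩ := hf
  obtain ⟨g', hg', h'⟩ := hg
  refine REPred.of_eq (rePred_and (Recognizable.re (X := X)) (rePred_eq hf'.to_comp hg'.to_comp))
    fun n => ?_
  constructor
  · rintro ⟨⟨x, rfl, -⟩, hx⟩
    rw [h, h'] at hx
    exact ⟨x, rfl, encode_injective hx⟩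
  · rintro ⟨x, rfl, hx⟩
    exact ⟨⟨x, rfl, trivial⟩, by rw [h, h', hx]⟩

theorem RE.mem [Recognizable X] {f : X → Y} {g : X → List Y} (hf : PR f) (hg : PR g) :
    RE fun x => f x ∈ g x := by
  obtain ⟨f', hf', h⟩ := hf
  obtain ⟨g', hg', h'⟩ := hg
  have hmem : REPred fun z : ℕ × List ℕ => ∃ m ∈ z.2, m = z.1 :=
    (PrimrecPred.computablePred (p := fun z : ℕ × List ℕ => ∃ m ∈ z.2, m = z.1)
      (PrimrecRel.comp (PrimrecRel.exists_mem_list Primrec.eq) Primrec.snd Primrec.fst)).to_re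
  have hc : Computable fun n => (f' n, (decode (α := List ℕ) (g' n)).getD []) :=
    (hf'.pair (Primrec.option_getD.comp (Primrec.decode.comp hg') (Primrec.const []))).to_comp
  refine REPred.of_eq (rePred_and (Recognizable.re (X := X)) (rePred_comp hmem hc)) fun n => ?_
  have key : ∀ x : X, (∃ m ∈ (decode (α := List ℕ) (g' (encode x))).getD [], m = f' (encode x)) ↔
      f x ∈ g x := by
    intro x
    rw [h, h', decode_list_encode]
    simp
  constructor
  · rintro ⟨⟨x, rfl, -⟩, hx⟩
    exact ⟨x, rfl, (key x).1 hx⟩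
  · rintro ⟨x, rfl, hx⟩
    exact ⟨⟨x, rfl, trivial⟩, (key x).2 hx⟩

theorem RE.not_mem [Recognizable X] {f : X → Y} {g : X → List Y} (hf : PR f) (hg : PR g) :
    RE fun x => f x ∉ g x := by
  obtain ⟨f', hf', h⟩ := hf
  obtain ⟨g', hg', h'⟩ := hg
  have hmem : REPred fun z : ℕ × List ℕ => ∀ m ∈ z.2, ¬ m = z.1 :=
    (PrimrecPred.computablePred (p := fun z : ℕ × List ℕ => ∀ m ∈ z.2, ¬ m = z.1)
      (PrimrecRel.comp (PrimrecRel.forall_mem_list (PrimrecRel.not Primrec.eq)) Primrec.snd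
        Primrec.fst)).to_re
  have hc : Computable fun n => (f' n, (decode (α := List ℕ) (g' n)).getD []) :=
    (hf'.pair (Primrec.option_getD.comp (Primrec.decode.comp hg') (Primrec.const []))).to_comp
  refine REPred.of_eq (rePred_and (Recognizable.re (X := X)) (rePred_comp hmem hc)) fun n => ?_
  have key : ∀ x : X, (∀ m ∈ (decode (α := List ℕ) (g' (encode x))).getD [], ¬ m = f' (encode x)) ↔
      f x ∉ g x := by
    intro x
    rw [h, h', decode_list_encode]
    simp only [Option.getD_some, List.mem_map, forall_exists_index, and_imp,
      forall_apply_eq_imp_iff₂, encode_inj]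
    exact ⟨fun hx hf => hx _ hf rfl, fun hf y hy he => hf (he ▸ hy)⟩
  constructor
  · rintro ⟨⟨x, rfl, -⟩, hx⟩
    exact ⟨x, rfl, (key x).1 hx⟩
  · rintro ⟨x, rfl, hx⟩
    exact ⟨⟨x, rfl, trivial⟩, (key x).2 hx⟩

/-- Unbounded search for a witness of a recursively enumerable relation. -/
theorem exists_search {p : X × Y → Prop} (hp : RE p) :
    ∃ r : ℕ →. ℕ, Nat.Partrec r ∧ ∀ x, (∃ y, p (x, y)) → ∃ y, p (x, y) ∧ encode y ∈ r (encode x) := by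
  obtain ⟨q, hq, -, h⟩ := exists_stages (rePred_comp hp
    (Primrec₂.natPair.comp (Primrec.fst (α := ℕ) (β := ℕ)) Primrec.snd).to_comp)
  -- The search runs over pairs of a candidate code and a stage, so a candidate that never succeeds
  -- cannot block the others.
  have hq' : PrimrecRel fun (n k : ℕ) => q (n, k.unpair.1) k.unpair.2 :=
    PrimrecRel.comp hq (Primrec.fst.pair (Primrec.fst.comp (Primrec.unpair.comp Primrec.snd)))
      (Primrec.snd.comp (Primrec.unpair.comp Primrec.snd))
  classical
  have hq' : Primrec fun x : ℕ × ℕ => decide (q (x.1, x.2.unpair.1) x.2.unpair.2) :=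
    PrimrecPred.decide hq'
  have hr : Partrec fun n => (Nat.rfind fun k =>
      Part.some (decide (q (n, k.unpair.1) k.unpair.2))).map fun k => k.unpair.1 :=
    (Partrec.rfind (p := fun n k => Part.some (decide (q (n, k.unpair.1) k.unpair.2)))
      hq'.to_comp.partrec).map (Primrec.fst.comp (Primrec.unpair.comp Primrec.snd)).to_comp.to₂
  refine ⟨_, Partrec.nat_iff.1 hr, fun x ⟨y, hy⟩ => ?_⟩
  obtain ⟨k, hk⟩ := (h (encode x, encode y)).1 ⟨(x, y), encode_prod_val x y, hy⟩
  have hdom : (Nat.rfind fun k => Part.some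
      (decide (q (encode x, k.unpair.1) k.unpair.2))).Dom :=
    Nat.rfind_dom.2 ⟨Nat.pair (encode y) k, by simpa using hk, fun _ => trivial⟩
  obtain ⟨m, hm⟩ := Part.dom_iff_mem.1 hdom
  have hspec := Nat.rfind_spec hm
  simp only [Part.mem_some_iff] at hspec
  obtain ⟨⟨x', y'⟩, he, hp'⟩ := (h (encode x, m.unpair.1)).2 ⟨m.unpair.2, by simpa using hspec.symm⟩
  rw [encode_prod_val] at he
  obtain ⟨hx, hy'⟩ := Nat.pair_eq_pair.1 he
  cases encode_injective hx
  exact ⟨y', hp', (Part.mem_map_iff _).2 ⟨m, hm, hy'.symm⟩⟩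

end RE

/-! ### Terms as words in Polish notation. -/

section Polish

variable {L : FirstOrder.Language.{0, 0}}

/-- The arity of a symbol of a term in Polish notation. -/
def arity : ℕ ⊕ (Σ n, L.Functions n) → ℕ
  | Sum.inl _ => 0
  | Sum.inr f => f.1

/-- One step of counting the terms on a stack, from right to left. -/
def stackStep (n : ℕ) (o : Option ℕ) : Option ℕ :=
  o.bind fun h => if n ≤ h then some (h - n + 1) else none

/-- The number of terms of a concatenation in Polish notation with the given arities. -/
def stackCount (ns : List ℕ) : Option ℕ := ns.foldr stackStep (some 0)

theorem primrec_stackCount : Primrec stackCount := by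
  refine Primrec.list_foldr Primrec.id (Primrec.const (some 0))
    (h := fun _ p => stackStep p.1 p.2) ?_
  refine Primrec.option_bind (Primrec.snd.comp Primrec.snd) (Primrec.ite
    (c := fun x : (List ℕ × (ℕ × Option ℕ)) × ℕ => x.1.2.1 ≤ x.2) ?_ ?_ (Primrec.const none))
  · exact Primrec.nat_le.comp (Primrec.fst.comp (Primrec.snd.comp Primrec.fst)) Primrec.snd
  · exact Primrec.option_some.comp (Primrec.succ.comp (Primrec.nat_sub.comp Primrec.snd
      (Primrec.fst.comp (Primrec.snd.comp Primrec.fst))))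

theorem flatMap_finRange_take {ts : List (L.Term ℕ)} {n : ℕ} (h : n ≤ ts.length) :
    ((List.finRange n).flatMap fun i : Fin n => (ts[i]'(i.2.trans_le h)).listEncode) =
      (ts.take n).flatMap Term.listEncode := by
  have : ts.take n = (List.finRange n).map fun i : Fin n => ts[i]'(i.2.trans_le h) := by
    apply List.ext_getElem
    · simp [h]
    · intro i h₁ h₂
      simp
  rw [this, List.flatMap_map]

/-- Reading from right to left, a symbol of arity n takes the first n terms already formed and puts
one in their place. The count records the length of this stack, so a successful count is a
successful parse. -/
theorem exists_terms_of_stackCount {l : List (ℕ ⊕ (Σ n, L.Functions n))} {k : ℕ}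
    (h : stackCount (l.map arity) = some k) :
    ∃ ts : List (L.Term ℕ), ts.length = k ∧ ts.flatMap Term.listEncode = l := by
  induction l generalizing k with
  | nil =>
    simp only [stackCount, List.map_nil, List.foldr_nil, Option.some.injEq] at h
    exact ⟨[], h, rfl⟩
  | cons s l ih =>
    simp only [stackCount, List.map_cons, List.foldr_cons, stackStep,
      Option.bind_eq_some_iff] at h
    obtain ⟨m, hm, h⟩ := h
    obtain ⟨ts, hts, rfl⟩ := ih hm
    split_ifs at h with hle
    injection h with h
    rcases s with c | ⟨n, f⟩
    · simp only [arity] at h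
      exact ⟨Term.var c :: ts, by simp [← h, hts], by simp [Term.listEncode]⟩
    · simp only [arity] at h hle
      have hn : n ≤ ts.length := hts ▸ hle
      refine ⟨Term.func f (fun i => ts[i]'(i.2.trans_le hn)) :: ts.drop n, ?_, ?_⟩
      · simp [← h, hts]
      · rw [List.flatMap_cons, Term.listEncode, flatMap_finRange_take hn, List.cons_append,
          ← List.flatMap_append, List.take_append_drop]

theorem stackCount_listEncode (t : L.Term ℕ) (ns : List ℕ) {k : ℕ} (h : stackCount ns = some k) :
    stackCount (t.listEncode.map arity ++ ns) = some (k + 1) := by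
  induction t generalizing ns k with
  | var c =>
    simp only [Term.listEncode, List.map_cons, List.map_nil, List.cons_append, List.nil_append,
      stackCount, List.foldr_cons, arity] at h ⊢
    rw [h]
    simp [stackStep]
  | @func n f ts ih =>
    have key : ∀ l : List (Fin n), stackCount ((l.flatMap fun i =>
        (ts i).listEncode).map arity ++ ns) = some (l.length + k) := by
      intro l
      induction l with
      | nil => simpa using h
      | cons i l ihl =>
        rw [List.flatMap_cons, List.map_append, List.append_assoc, ih i _ ihl, List.length_cons]
        congr 1
        omega
    have := key (List.finRange n)
    simp only [stackCount, List.length_finRange] at this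
    simp only [Term.listEncode, List.map_cons, List.cons_append, stackCount, List.foldr_cons,
      arity, this, stackStep, Option.bind_some]
    simp

/-- A test for being the code of a term that needs only the arities of the symbols: exactly one term
must remain on the stack. -/
theorem exists_listEncode_iff {l : List (ℕ ⊕ (Σ n, L.Functions n))} :
    (∃ t : L.Term ℕ, t.listEncode = l) ↔ stackCount (l.map arity) = some 1 := by
  constructor
  · rintro ⟨t, rfl⟩
    simpa using stackCount_listEncode t [] (k := 0) rfl
  · intro h
    obtain ⟨ts, hts, rfl⟩ := exists_terms_of_stackCount h
    obtain ⟨t, rfl⟩ := List.length_eq_one_iff.1 hts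
    exact ⟨t, by simp⟩

/-- In Polish notation substitution replaces each constant by a word in place, so it is computable
symbol by symbol, without recursion on terms. -/
theorem listEncode_subst (t : L.Term ℕ) (σ : ℕ → L.Term ℕ) :
    (t.subst σ).listEncode = t.listEncode.flatMap
      (Sum.elim (fun c => (σ c).listEncode) fun f => [Sum.inr f]) := by
  induction t with
  | var c => simp [Term.listEncode, Term.subst]
  | func f ts ih =>
    simp only [Term.listEncode, Term.subst, List.flatMap_cons, Sum.elim_inr, ih,
      List.flatMap_assoc]
    rfl

theorem mem_listEncode_var {t : L.Term ℕ} {c : ℕ} :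
    Sum.inl c ∈ t.listEncode ↔ c ∈ constsIn (subterms t) := by
  induction t with
  | var d => simp [Term.listEncode, mem_consts_var]
  | func f ts ih => simp [Term.listEncode, mem_consts_func, ih]

theorem mem_listEncode_symbol {t : L.Term ℕ} {s : Σ n, L.Functions n} :
    Sum.inr s ∈ t.listEncode ↔ s ∈ symbolsIn (subterms t) := by
  induction t with
  | var d => simp [Term.listEncode, symbols_var]
  | func f ts ih => simp [Term.listEncode, mem_symbols_func, ih]

theorem listEncode_replacement (σ : List (ℕ × L.Term ℕ)) (c : ℕ) :
    (replacement σ c).listEncode =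
      ((σ.map fun p => (p.1, p.2.listEncode)).lookup c).getD [Sum.inl c] := by
  induction σ with
  | nil => rfl
  | cons p σ ih =>
    obtain ⟨d, t⟩ := p
    rw [replacement, List.map_cons, List.lookup_cons]
    by_cases h : c = d
    · simp [h]
    · have : (c == d) = false := by simpa using h
      simp only [h, if_false, this, ih]

/-- The constants of a term, in order. -/
def constList (t : L.Term ℕ) : List ℕ := t.listEncode.filterMap Sum.getLeft?

theorem mem_constList {t : L.Term ℕ} {c : ℕ} :
    c ∈ constList t ↔ c ∈ constsIn (subterms t) := by
  rw [← mem_listEncode_var, constList, List.mem_filterMap]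
  constructor
  · rintro ⟨s, hs, h⟩
    cases Sum.getLeft?_eq_some_iff.1 h
    exact hs
  · exact fun h => ⟨_, h, rfl⟩

/-- The arguments of an atom, as a list. -/
def argList : Atom L → List (L.Term ℕ)
  | Sum.inl (s, t) => [s, t]
  | Sum.inr ⟨_, ts⟩ => List.ofFn ts

theorem mem_argList {α : Atom L} {t : L.Term ℕ} : t ∈ argList α ↔ t ∈ α.args := by
  rcases α with ⟨s, t⟩ | ⟨R, ts⟩ <;> simp [argList, Atom.args]

end Polish

/-! ### Computability of operations on terms. -/

section TermCodes

variable {L : FirstOrder.Language.{0, 0}} [Primcodable (Σ n, L.Functions n)]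

theorem encode_listEncode (t : L.Term ℕ) : encode t.listEncode = encode t := rfl

theorem encode_list_map {X Y : Type} [Encodable X] [Encodable Y] {r : X → Y}
    (hr : ∀ x, encode (r x) = encode x) (l : List X) : encode (l.map r) = encode l := by
  rw [encode_list_eq, encode_list_eq l, List.map_map]
  congr 2
  exact funext hr

theorem computable_arity (hL : Computable fun s : Σ n, L.Functions n => s.1) :
    Computable (arity (L := L)) :=
  (Computable.sumCasesOn Computable.id (Computable.const 0).to₂
    (hL.comp Computable.snd).to₂).of_eq fun s => by cases s <;> rfl

theorem recognizable_term (hL : Computable fun s : Σ n, L.Functions n => s.1) :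
    Recognizable (L.Term ℕ) where
  re := by
    refine re_of_raw (r := Term.listEncode) encode_listEncode ?_
    -- The arity function is assumed to be computable, not primitive recursive. So a list of symbols
    -- paired with arities is guessed, each arity is verified, and the primitive recursive stack
    -- count is applied to the guessed arities.
    have h₁ : REPred fun x : List (ℕ ⊕ (Σ n, L.Functions n)) ×
        List ((ℕ ⊕ (Σ n, L.Functions n)) × ℕ) => x.2.map Prod.fst = x.1 :=
      rePred_eq (Primrec.list_map Primrec.snd (Primrec.fst.comp Primrec.snd).to₂).to_comp
        Computable.fst
    have h₂ : REPred fun x : List (ℕ ⊕ (Σ n, L.Functions n)) ×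
        List ((ℕ ⊕ (Σ n, L.Functions n)) × ℕ) => ∀ p ∈ x.2, arity p.1 = p.2 :=
      rePred_forall_list (p := fun x : List (ℕ ⊕ (Σ n, L.Functions n)) ×
        ((ℕ ⊕ (Σ n, L.Functions n)) × ℕ) => arity x.2.1 = x.2.2)
        (rePred_eq ((computable_arity hL).comp (Computable.fst.comp Computable.snd))
          (Computable.snd.comp Computable.snd))
    have h₃ : REPred fun x : List (ℕ ⊕ (Σ n, L.Functions n)) ×
        List ((ℕ ⊕ (Σ n, L.Functions n)) × ℕ) => stackCount (x.2.map Prod.snd) = some 1 :=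
      rePred_eq (primrec_stackCount.comp
        (Primrec.list_map Primrec.snd (Primrec.snd.comp Primrec.snd).to₂)).to_comp
        (Computable.const _)
    refine (rePred_exists (rePred_and h₁ (rePred_and h₂ h₃))).of_eq fun l => ?_
    simp only [and_true]
    rw [exists_listEncode_iff]
    constructor
    · rintro ⟨ps, rfl, h, hc⟩
      rw [List.map_map, ← hc]
      congr 1
      exact List.map_congr_left fun p hp => h p hp
    · intro h
      refine ⟨l.map fun s => (s, arity s), ?_, ?_, ?_⟩
      · simp [Function.comp_def]
      · intro p hp
        obtain ⟨s, -, rfl⟩ := List.mem_map.1 hp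
        rfl
      · simpa only [List.map_map, Function.comp_def] using h

theorem pr_var : PR fun c : ℕ => (Term.var c : L.Term ℕ) :=
  PR.of_primrec (r := fun c : ℕ => c) (s := Term.listEncode) (fun _ => rfl) encode_listEncode
    (g := fun c : ℕ => [Sum.inl c])
    (Primrec.list_cons.comp Primrec.sumInl (Primrec.const []))
    fun _ => rfl

theorem pr_subst : PR fun z : List (ℕ × L.Term ℕ) × L.Term ℕ => z.2.subst (replacement z.1) := by
  refine PR.of_primrec
    (r := fun z : List (ℕ × L.Term ℕ) × L.Term ℕ =>
      (z.1.map fun p => (p.1, p.2.listEncode), z.2.listEncode)) (s := Term.listEncode)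
    (fun z => ?_) encode_listEncode
    (g := fun z : List (ℕ × List (ℕ ⊕ (Σ n, L.Functions n))) × List (ℕ ⊕ (Σ n, L.Functions n)) =>
      z.2.flatMap fun s => Sum.casesOn s (fun c => (z.1.lookup c).getD [Sum.inl c])
        fun f => [Sum.inr f]) ?_ fun z => ?_
  · obtain ⟨σ, t⟩ := z
    rw [encode_prod_val, encode_prod_val, encode_list_map (fun p => ?_), encode_listEncode]
    obtain ⟨c, t⟩ := p
    rw [encode_prod_val, encode_prod_val, encode_listEncode]
  · have h : Primrec fun x : (List (ℕ × List (ℕ ⊕ (Σ n, L.Functions n))) ×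
        List (ℕ ⊕ (Σ n, L.Functions n))) × (ℕ ⊕ (Σ n, L.Functions n)) =>
        (Sum.casesOn x.2 (fun c => (x.1.1.lookup c).getD [Sum.inl c])
          fun f => [Sum.inr f] : List (ℕ ⊕ (Σ n, L.Functions n))) := by
      refine Primrec.sumCasesOn Primrec.snd ?_ ?_
      · exact (Primrec.option_getD.comp (Primrec.listLookup.comp Primrec.snd
        (Primrec.fst.comp (Primrec.fst.comp Primrec.fst)))
          (Primrec.list_cons.comp (Primrec.sumInl.comp Primrec.snd) (Primrec.const []))).to₂
      · exact (Primrec.list_cons.comp (Primrec.sumInr.comp Primrec.snd) (Primrec.const [])).to₂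
    exact Primrec.list_flatMap Primrec.snd h.to₂
  · rw [listEncode_subst]
    congr 1
    funext s
    rcases s with c | f
    · exact (listEncode_replacement z.1 c).symm
    · rfl

theorem pr_constList : PR (constList (L := L)) :=
  PR.of_primrec (r := Term.listEncode) (s := fun l : List ℕ => l) encode_listEncode (fun _ => rfl)
    (g := fun l : List (ℕ ⊕ (Σ n, L.Functions n)) =>
      l.filterMap fun s => Sum.casesOn s (fun c => some c) fun _ => none)
    (Primrec.listFilterMap Primrec.id (Primrec.sumCasesOn Primrec.snd
      (Primrec.option_some.comp Primrec.snd).to₂ (Primrec.const none).to₂).to₂) fun t => by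
    rw [constList]
    congr 1
    funext s
    cases s <;> rfl

end TermCodes

/-! ### Computability of operations on atoms. -/

section AtomCodes

variable {L L' : FirstOrder.Language.{0, 0}} [Primcodable (Σ n, L.Functions n)]

/-- The codes of the arguments of an atom, with their positions. -/
def argCodes {n : ℕ} (ts : Fin n → L.Term ℕ) : List ℕ :=
  List.ofFn fun i : Fin n => Nat.pair i (encode (ts i))

/-- A tuple is coded through its graph, hence the positions in `argCodes`; this brings tuples of
varying length under the coding of lists of numbers. -/
theorem encode_args {n : ℕ} (ts : Fin n → L.Term ℕ) :
    @encode _ (Encodable.finPi n fun _ => L.Term ℕ) ts = encode (argCodes ts) := by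
  have h : @encode _ (Encodable.finPi n fun _ => L.Term ℕ) ts =
      encode (List.Vector.ofFn fun i : Fin n => (⟨i, ts i⟩ : Σ _ : Fin n, L.Term ℕ)).toList := rfl
  rw [h, List.Vector.toList_ofFn, encode_list_eq]
  congr 1
  rw [List.map_ofFn]
  rfl

theorem decode_argCodes {n : ℕ} (ts : Fin n → L.Term ℕ) :
    decode (α := List ℕ) (encode (argCodes ts)) = some (argCodes ts) := encodek _

variable [Primcodable (Σ n, L.Relations n)] [Primcodable (Σ n, L'.Functions n)]
  [Primcodable (Σ n, L'.Relations n)]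

theorem encode_atom_inl (s t : L.Term ℕ) :
    encode (Sum.inl (s, t) : Atom L) = 2 * encode (s, t) := rfl

theorem encode_atom_inr (R : Σ n, L.Relations n) (ts : Fin R.1 → L.Term ℕ) :
    encode (Sum.inr ⟨R, ts⟩ : Atom L) =
      2 * Nat.pair (encode R) (encode (argCodes ts)) + 1 := by
  rw [← encode_args]
  rfl

/-- Definition by cases on atoms. -/
theorem pr_atomCases {X Y : Type} [Encodable X] [Encodable Y] {f : X × Atom L → Y}
    {g h : ℕ → ℕ → ℕ} (hg : Primrec₂ g) (hh : Primrec₂ h)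
    (hgf : ∀ x s t, g (encode x) (encode (s, t)) = encode (f (x, Sum.inl (s, t))))
    (hhf : ∀ x (R : Σ n, L.Relations n) ts,
      h (encode x) (Nat.pair (encode R) (encode (argCodes ts))) =
        encode (f (x, Sum.inr ⟨R, ts⟩))) : PR f := by
  -- The parity of the code separates equations from atoms of other predicate symbols.
  refine ⟨fun n => if n.unpair.2 % 2 = 0 then g n.unpair.1 (n.unpair.2 / 2)
    else h n.unpair.1 (n.unpair.2 / 2), ?_, ?_⟩
  · have h₁ : Primrec fun n : ℕ => n.unpair.1 := Primrec.fst.comp Primrec.unpair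
    have h₂ : Primrec fun n : ℕ => n.unpair.2 := Primrec.snd.comp Primrec.unpair
    have h₃ : Primrec fun n : ℕ => n.unpair.2 / 2 := Primrec.nat_div.comp h₂ (Primrec.const 2)
    exact Primrec.ite (Primrec.eq.comp (Primrec.nat_mod.comp h₂ (Primrec.const 2))
      (Primrec.const 0)) (hg.comp h₁ h₃) (hh.comp h₁ h₃)
  · rintro ⟨x, ⟨s, t⟩ | ⟨R, ts⟩⟩
    · simp only [encode_prod_val x, Nat.unpair_pair, encode_atom_inl]
      rw [if_pos (by omega), Nat.mul_div_cancel_left _ (by omega), hgf]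
    · simp only [encode_prod_val x, Nat.unpair_pair, encode_atom_inr]
      rw [if_neg (by omega), ← hhf]
      congr 1
      omega

theorem pr_argList : PR (argList (L := L)) := by
  have h : PR fun z : ℕ × Atom L => argList z.2 := by
    refine pr_atomCases
      (g := fun _ m => Nat.succ (Nat.pair m.unpair.1 (Nat.succ (Nat.pair m.unpair.2 0))))
      (h := fun _ m => encode (((decode (α := List ℕ) m.unpair.2).getD []).map fun k =>
        k.unpair.2)) ?_ ?_ ?_ ?_
    · have h₁ : Primrec fun x : ℕ × ℕ => x.2.unpair.1 :=
        Primrec.fst.comp (Primrec.unpair.comp Primrec.snd)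
      have h₂ : Primrec fun x : ℕ × ℕ => x.2.unpair.2 :=
        Primrec.snd.comp (Primrec.unpair.comp Primrec.snd)
      exact Primrec.succ.comp (Primrec₂.natPair.comp h₁
        (Primrec.succ.comp (Primrec₂.natPair.comp h₂ (Primrec.const 0))))
    · have h₂ : Primrec fun x : ℕ × ℕ => x.2.unpair.2 :=
        Primrec.snd.comp (Primrec.unpair.comp Primrec.snd)
      exact Primrec.encode.comp (Primrec.list_map
        (Primrec.option_getD.comp (Primrec.decode.comp h₂) (Primrec.const []))
        (Primrec.snd.comp (Primrec.unpair.comp Primrec.snd)).to₂)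
    · intro x s t
      simp only [encode_prod_val s, Nat.unpair_pair, argList, encode_list_cons, encode_list_nil]
    · intro x R ts
      simp only [Nat.unpair_pair, decode_argCodes, Option.getD_some, argList]
      rw [encode_list_eq (List.ofFn ts)]
      simp [argCodes, List.map_ofFn, Function.comp_def]
  exact h.comp ((PR.const 0).pair PR.id)

/-- Mapping the arguments of an atom, with the predicate symbol fixed up to coding. -/
theorem pr_atomMap {X : Type} [Encodable X] {φ : X × L.Term ℕ → L'.Term ℕ} (hφ : PR φ)
    {Φ : X × Atom L → Atom L'}
    (h₁ : ∀ x s t, Φ (x, Sum.inl (s, t)) = Sum.inl (φ (x, s), φ (x, t)))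
    (h₂ : ∀ x (R : Σ n, L.Relations n) (ts : Fin R.1 → L.Term ℕ),
      encode (Φ (x, Sum.inr ⟨R, ts⟩)) =
        2 * Nat.pair (encode R) (encode (argCodes fun i => φ (x, ts i))) + 1) : PR Φ := by
  obtain ⟨φ', hφ', h⟩ := hφ
  refine pr_atomCases
    (g := fun x m => 2 * Nat.pair (φ' (Nat.pair x m.unpair.1)) (φ' (Nat.pair x m.unpair.2)))
    (h := fun x m => 2 * Nat.pair m.unpair.1
      (encode (((decode (α := List ℕ) m.unpair.2).getD []).map fun k =>
        Nat.pair k.unpair.1 (φ' (Nat.pair x k.unpair.2)))) + 1) ?_ ?_ ?_ ?_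
  · have e₁ : Primrec fun x : ℕ × ℕ => x.2.unpair.1 :=
      Primrec.fst.comp (Primrec.unpair.comp Primrec.snd)
    have e₂ : Primrec fun x : ℕ × ℕ => x.2.unpair.2 :=
      Primrec.snd.comp (Primrec.unpair.comp Primrec.snd)
    exact Primrec.nat_mul.comp (Primrec.const 2) (Primrec₂.natPair.comp
      (hφ'.comp (Primrec₂.natPair.comp Primrec.fst e₁))
      (hφ'.comp (Primrec₂.natPair.comp Primrec.fst e₂)))
  · have e₁ : Primrec fun x : ℕ × ℕ => x.2.unpair.1 :=
      Primrec.fst.comp (Primrec.unpair.comp Primrec.snd)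
    have e₂ : Primrec fun x : ℕ × ℕ => x.2.unpair.2 :=
      Primrec.snd.comp (Primrec.unpair.comp Primrec.snd)
    have e₃ : Primrec fun x : (ℕ × ℕ) × ℕ => x.2.unpair.1 :=
      Primrec.fst.comp (Primrec.unpair.comp Primrec.snd)
    have e₄ : Primrec fun x : (ℕ × ℕ) × ℕ => x.2.unpair.2 :=
      Primrec.snd.comp (Primrec.unpair.comp Primrec.snd)
    refine Primrec.succ.comp (Primrec.nat_mul.comp (Primrec.const 2) (Primrec₂.natPair.comp e₁
      (Primrec.encode.comp (Primrec.list_map (Primrec.option_getD.comp (Primrec.decode.comp e₂)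
        (Primrec.const [])) ?_))))
    exact (Primrec₂.natPair.comp e₃ (hφ'.comp (Primrec₂.natPair.comp
      (Primrec.fst.comp Primrec.fst) e₄))).to₂
  · intro x s t
    rw [h₁, encode_atom_inl, encode_prod_val (φ _), ← h, ← h, encode_prod_val x,
      encode_prod_val x]
    simp only [encode_prod_val s, Nat.unpair_pair]
  · intro x R ts
    rw [h₂]
    simp only [Nat.unpair_pair, decode_argCodes, Option.getD_some]
    congr 4
    simp only [argCodes, List.map_ofFn, Function.comp_def, Nat.unpair_pair, ← h, encode_prod_val]

theorem recognizable_atom (hL : Computable fun s : Σ n, L.Functions n => s.1)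
    (hR : Computable fun s : Σ n, L.Relations n => s.1) : Recognizable (Atom L) where
  re := by
    have := recognizable_term hL
    have h₁ : REPred fun n : ℕ => ∃ m : ℕ, (∃ z : L.Term ℕ × L.Term ℕ, encode z = m ∧ True) ∧
        2 * m = n :=
      rePred_exists (p := fun x : ℕ × ℕ =>
          (∃ z : L.Term ℕ × L.Term ℕ, encode z = x.2 ∧ True) ∧ 2 * x.2 = x.1)
        (rePred_and (rePred_comp (Recognizable.re (X := L.Term ℕ × L.Term ℕ)) Computable.snd)
          (rePred_eq (Primrec.nat_mul.comp (Primrec.const 2) Primrec.snd).to_comp Computable.fst))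
    have hargs : REPred fun x : ℕ × ((Σ n, L.Relations n) × List ℕ) =>
        ∀ m ∈ x.2.2, ∃ t : L.Term ℕ, encode t = m.unpair.2 ∧ True :=
      rePred_comp (f := fun x : ℕ × ((Σ n, L.Relations n) × List ℕ) => (x.1, x.2.2))
        (p := fun x : ℕ × List ℕ => ∀ m ∈ x.2, ∃ t : L.Term ℕ, encode t = m.unpair.2 ∧ True)
        (rePred_forall_list (p := fun x : ℕ × ℕ => ∃ t : L.Term ℕ, encode t = x.2.unpair.2 ∧ True)
          (rePred_comp (Recognizable.re (X := L.Term ℕ))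
            (Primrec.snd.comp (Primrec.unpair.comp Primrec.snd)).to_comp))
        (Computable.fst.pair (Computable.snd.comp Computable.snd))
    -- The positions must be exactly 0, …, n-1 for the arity n of the predicate symbol; this fixes
    -- both the number and the order of the arguments.
    have hpos : REPred fun x : ℕ × ((Σ n, L.Relations n) × List ℕ) =>
        (x.2.2.map fun m => m.unpair.1) = List.range x.2.1.1 :=
      rePred_eq (Primrec.list_map (Primrec.snd.comp Primrec.snd)
        (Primrec.fst.comp (Primrec.unpair.comp Primrec.snd)).to₂).to_comp
        (Primrec.list_range.to_comp.comp (hR.comp (Computable.fst.comp Computable.snd)))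
    have hcode : REPred fun x : ℕ × ((Σ n, L.Relations n) × List ℕ) =>
        2 * Nat.pair (encode x.2.1) (encode x.2.2) + 1 = x.1 :=
      rePred_eq (Primrec.succ.comp (Primrec.nat_mul.comp (Primrec.const 2) (Primrec₂.natPair.comp
        (Primrec.encode.comp (Primrec.fst.comp Primrec.snd))
        (Primrec.encode.comp (Primrec.snd.comp Primrec.snd))))).to_comp Computable.fst
    refine (rePred_or h₁ (rePred_exists (rePred_and hargs (rePred_and hpos hcode)))).of_eq
      fun n => ?_
    constructor
    · rintro (⟨_, ⟨⟨s, t⟩, rfl, -⟩, rfl⟩ | ⟨⟨R, l⟩, hl, hp, hn⟩)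
      · exact ⟨Sum.inl (s, t), rfl, trivial⟩
      · dsimp only at hl hp hn
        subst hn
        have hlen : l.length = R.1 := by simpa using congrArg List.length hp
        have hget : ∀ i : Fin R.1, ∃ t : L.Term ℕ,
            Nat.pair i (encode t) = l[(i : ℕ)]'(i.2.trans_eq hlen.symm) := by
          intro i
          obtain ⟨t, ht, -⟩ := hl _ (List.getElem_mem (i.2.trans_eq hlen.symm : (i : ℕ) < l.length))
          refine ⟨t, ?_⟩
          have hi : (l[(i : ℕ)]'(i.2.trans_eq hlen.symm)).unpair.1 = i := by
            have := List.getElem_of_eq hp (i := i) (by simp [hlen])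
            simpa using this
          rw [ht]
          exact (congrArg (Nat.pair · _) hi.symm).trans (Nat.pair_unpair _)
        choose ts hts using hget
        refine ⟨Sum.inr ⟨R, ts⟩, ?_, trivial⟩
        rw [encode_atom_inr]
        congr 4
        apply List.ext_getElem
        · simp [argCodes, hlen]
        · intro i h₁ h₂
          simp only [argCodes, List.getElem_ofFn, hts]
    · rintro ⟨⟨s, t⟩ | ⟨R, ts⟩, rfl, -⟩
      · exact Or.inl ⟨_, ⟨(s, t), rfl, trivial⟩, rfl⟩
      · refine Or.inr ⟨(R, argCodes ts), fun m hm => ?_, ?_, (encode_atom_inr R ts).symm⟩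
        · obtain ⟨i, rfl⟩ := (List.mem_ofFn' _ _).1 hm
          exact ⟨ts i, by simp, trivial⟩
        · apply List.ext_getElem
          · simp [argCodes]
          · intro i h₁ h₂
            simp [argCodes]

end AtomCodes

/-! ### Lists of constants and extension functions of terms, atoms and clauses. -/

section ExtensionSymbols

variable {L : FirstOrder.Language.{0, 0}} {F : ℕ → Type}

theorem listEncode_onTerm (t : L.Term ℕ) : ((baseHom L F).onTerm t).listEncode =
    t.listEncode.map (Sum.map id fun f => ⟨f.1, Sum.inl f.2⟩) := by
  induction t with
  | var c => rfl
  | func f ts ih =>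
    simp only [Term.listEncode, LHom.onTerm, List.map_cons, List.map_flatMap, ih]
    rfl

/-- The extension function of a symbol. -/
def extSymbol? (s : ℕ ⊕ (Σ n, (extLang L F).Functions n)) : Option (Σ n, F n) :=
  s.getRight?.bind fun f => (Equiv.sigmaSumDistrib L.Functions F f).getRight?

theorem extSymbol?_eq_some {s : ℕ ⊕ (Σ n, (extLang L F).Functions n)} {g : Σ n, F n} :
    extSymbol? s = some g ↔ s = Sum.inr ⟨g.1, Sum.inr g.2⟩ := by
  rcases s with c | ⟨n, f | f⟩
  · simp [extSymbol?]
  · refine ⟨fun h => ?_, fun h => ?_⟩ <;> cases h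
  · obtain ⟨m, g⟩ := g
    refine ⟨fun h => ?_, fun h => ?_⟩ <;> cases h <;> rfl

/-- The extension functions of a term, in order. -/
def extSymbolList (t : (extLang L F).Term ℕ) : List (Σ n, F n) :=
  t.listEncode.filterMap extSymbol?

theorem mem_extSymbolList {t : (extLang L F).Term ℕ} {g : Σ n, F n} :
    g ∈ extSymbolList t ↔ g ∈ extSymbolsIn (subterms t) := by
  simp only [extSymbolList, List.mem_filterMap, extSymbol?_eq_some, exists_eq_right]
  exact mem_listEncode_symbol

/-- The constants of a conjunction of atoms, in order. -/
def atomsConsts (A : List (Atom L)) : List ℕ := A.flatMap fun α => (argList α).flatMap constList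

theorem mem_atomsConsts {A : List (Atom L)} {c : ℕ} :
    c ∈ atomsConsts A ↔ c ∈ constsIn (atomsTerms A) := by
  simp only [atomsConsts, List.mem_flatMap, mem_argList, mem_constList, constsIn,
    Set.mem_ofPred_eq, mem_atomsTerms, Atom.mem_terms]

/-- The extension functions of a conjunction of atoms, in order. -/
def atomsExtSymbols (A : List (Atom (extLang L F))) : List (Σ n, F n) :=
  A.flatMap fun α => (argList α).flatMap extSymbolList

theorem mem_extSymbolsIn {S : Set ((extLang L F).Term ℕ)} {g : Σ n, F n} :
    g ∈ extSymbolsIn S ↔ ∃ ts : Fin g.1 → (extLang L F).Term ℕ,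
      Term.func (L := extLang L F) (Sum.inr g.2) ts ∈ S := Iff.rfl

theorem mem_atomsExtSymbols {A : List (Atom (extLang L F))} {g : Σ n, F n} :
    g ∈ atomsExtSymbols A ↔ g ∈ extSymbolsIn (atomsTerms A) := by
  simp only [atomsExtSymbols, List.mem_flatMap, mem_argList, mem_extSymbolList,
    mem_extSymbolsIn, mem_atomsTerms, Atom.mem_terms]
  grind

/-- The extension functions of a clause, in order. -/
def clauseExtSymbols (D : Clause (extLang L F)) : List (Σ n, F n) :=
  atomsExtSymbols (D.map Prod.snd)

theorem mem_clauseExtSymbols {D : Clause (extLang L F)} {g : Σ n, F n} :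
    g ∈ clauseExtSymbols D ↔ g ∈ extSymbolsIn (clauseTerms D) := by
  simp only [clauseExtSymbols, mem_atomsExtSymbols, mem_extSymbolsIn, mem_atomsTerms,
    mem_clauseTerms, List.mem_map]
  grind

/-- Base symbols are always shared, so only the finite list of extension functions has to be
checked. -/
theorem subset_thetaSharing_iff {K : Set (Clause (extLang L F))} {A B : List (Atom (extLang L F))}
    {t : (extLang L F).Term ℕ} : symbolsIn (subterms t) ⊆ thetaSharing K A B ↔
      ∀ g ∈ extSymbolList t, g ∈ Theta K (extSymbolsIn (atomsTerms A)) ∧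
        g ∈ Theta K (extSymbolsIn (atomsTerms B)) := by
  simp only [mem_extSymbolList]
  constructor
  · rintro h ⟨n, g⟩ hg
    rcases h hg with ⟨m, f, hf⟩ | ⟨m, f, hf, h'⟩
    · cases hf
    · cases hf
      exact h'
  · rintro h ⟨n, f | f⟩ hf
    · exact Or.inl ⟨n, f, rfl⟩
    · exact Or.inr ⟨n, f, rfl, h ⟨n, f⟩ hf⟩

/-- The form `a R b` with an unspecified binary `R` can be tested on the argument list alone,
without searching for `R`. -/
theorem exists_atom_var_iff {β : Atom L} {a b : ℕ} :
    (∃ R : BinRel L, β = R.atom (Term.var a) (Term.var b)) ↔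
      argList β = [Term.var a, Term.var b] := by
  constructor
  · rintro ⟨_ | r, rfl⟩
    · rfl
    · simp [BinRel.atom, argList]
  · intro h
    rcases β with ⟨s, t⟩ | ⟨⟨n, R⟩, ts⟩
    · simp only [argList, List.cons.injEq, and_true] at h
      exact ⟨none, by rw [h.1, h.2]; rfl⟩
    · obtain rfl : n = 2 := by simpa [argList] using congrArg List.length h
      refine ⟨some R, ?_⟩
      simp only [argList, List.ofFn_succ, List.ofFn_zero, List.cons.injEq, and_true] at h
      simp only [BinRel.atom]
      congr 2
      funext i
      fin_cases i
      · exact h.1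
      · exact h.2

end ExtensionSymbols

/-! ### Computability of translations between the two signatures. -/

section SyntaxCodes

variable {L : FirstOrder.Language.{0, 0}} {F : ℕ → Type} [Primcodable (Σ n, L.Functions n)]
  [Primcodable (Σ n, F n)]

theorem computable_extArity (hL : Computable fun s : Σ n, L.Functions n => s.1)
    (hF : Computable fun s : Σ n, F n => s.1) :
    Computable fun s : Σ n, (extLang L F).Functions n => s.1 :=
  (Computable.sumCasesOn (Primrec.of_equiv (e := Equiv.sigmaSumDistrib L.Functions F)).to_comp
    (hL.comp Computable.snd).to₂ (hF.comp Computable.snd).to₂).of_eq fun s => by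
      rcases s with ⟨n, f | f⟩ <;> rfl

theorem primrec_baseSymbol : Primrec fun f : Σ n, L.Functions n =>
    (⟨f.1, Sum.inl f.2⟩ : Σ n, (extLang L F).Functions n) :=
  (Primrec.of_equiv_symm (e := Equiv.sigmaSumDistrib L.Functions F)).comp Primrec.sumInl

theorem primrec_extSymbol : Primrec fun f : Σ n, F n =>
    (⟨f.1, Sum.inr f.2⟩ : Σ n, (extLang L F).Functions n) :=
  (Primrec.of_equiv_symm (e := Equiv.sigmaSumDistrib L.Functions F)).comp Primrec.sumInr

theorem pr_onTerm : PR fun t : L.Term ℕ => (baseHom L F).onTerm t := by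
  refine PR.of_primrec (r := Term.listEncode) (s := Term.listEncode) encode_listEncode
    encode_listEncode (g := fun l => l.map (Sum.map id fun f => ⟨f.1, Sum.inl f.2⟩)) ?_
    fun t => (listEncode_onTerm t).symm
  have h : Primrec fun s : ℕ ⊕ (Σ n, L.Functions n) =>
      (Sum.map id (fun f => ⟨f.1, Sum.inl f.2⟩) s : ℕ ⊕ (Σ n, (extLang L F).Functions n)) :=
    (Primrec.sumCasesOn Primrec.id (Primrec.sumInl.comp Primrec.snd).to₂
      (Primrec.sumInr.comp (primrec_baseSymbol.comp Primrec.snd)).to₂).of_eq fun s => by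
        cases s <;> rfl
  exact Primrec.list_map Primrec.id (h.comp Primrec.snd).to₂

theorem pr_translate : PR fun z : List (ℕ × (extLang L F).Term ℕ) × L.Term ℕ =>
    translate z.1 z.2 :=
  pr_subst.comp (PR.fst.pair (pr_onTerm.comp PR.snd))

theorem pr_extSymbolList : PR (extSymbolList (L := L) (F := F)) := by
  refine PR.of_primrec (r := Term.listEncode) (s := fun l : List (Σ n, F n) => l) encode_listEncode
    (fun _ => rfl) (g := List.filterMap extSymbol?) ?_ fun t => rfl
  have h : Primrec fun s : ℕ ⊕ (Σ n, (extLang L F).Functions n) => extSymbol? s := by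
    refine (Primrec.sumCasesOn Primrec.id (Primrec.const none).to₂
      (Primrec.sumCasesOn ((Primrec.of_equiv (e := Equiv.sigmaSumDistrib L.Functions F)).comp
        Primrec.snd) (Primrec.const none).to₂
        (Primrec.option_some.comp Primrec.snd).to₂).to₂).of_eq fun s => ?_
    rcases s with c | ⟨n, f | f⟩ <;> rfl
  exact Primrec.listFilterMap Primrec.id (h.comp Primrec.snd).to₂

variable [Primcodable (Σ n, L.Relations n)]

theorem pr_atomsConsts : PR (atomsConsts (L := L)) :=
  PR.list_flatMap (PR.list_flatMap (pr_constList.comp PR.snd) (pr_argList.comp PR.snd)) PR.id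

theorem pr_atomsExtSymbols : PR (atomsExtSymbols (L := L) (F := F)) :=
  PR.list_flatMap (PR.list_flatMap (pr_extSymbolList.comp PR.snd) (pr_argList.comp PR.snd)) PR.id

theorem pr_clauseExtSymbols : PR (clauseExtSymbols (L := L) (F := F)) :=
  pr_atomsExtSymbols.comp (PR.list_map (PR.snd.comp PR.snd) PR.id)

theorem pr_lift : PR (Atom.lift (L := L) F) := by
  have h : PR fun z : ℕ × Atom L => z.2.lift F :=
    pr_atomMap (φ := fun z => (baseHom L F).onTerm z.2) (pr_onTerm.comp PR.snd)
      (fun _ _ _ => rfl) fun _ R ts => encode_atom_inr (L := extLang L F) R _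
  exact h.comp ((PR.const 0).pair PR.id)

theorem pr_atomSubst : PR fun z : List (ℕ × L.Term ℕ) × Atom L =>
    z.2.subst (replacement z.1) :=
  pr_atomMap pr_subst (fun _ _ _ => rfl) fun _ R _ => encode_atom_inr R _

theorem pr_atomTrans : PR fun z : List (ℕ × (extLang L F).Term ℕ) × Atom L =>
    z.2.trans (replacement z.1) :=
  pr_atomSubst.comp (PR.fst.pair (pr_lift.comp PR.snd))

theorem pr_clauseSubst : PR fun z : List (ℕ × L.Term ℕ) × Clause L =>
    z.2.subst (replacement z.1) :=
  PR.list_map ((PR.fst.comp PR.snd).pair (pr_atomSubst.comp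
    ((PR.fst.comp PR.fst).pair (PR.snd.comp PR.snd)))) PR.snd

theorem pr_clauseTrans : PR fun z : List (ℕ × (extLang L F).Term ℕ) × Clause L =>
    z.2.trans (replacement z.1) :=
  PR.list_map ((PR.fst.comp PR.snd).pair (pr_atomTrans.comp
    ((PR.fst.comp PR.fst).pair (PR.snd.comp PR.snd)))) PR.snd

/-- The predicate symbols are the same in both signatures and constants have the same codes, so the
atom `a R b` of a problem can be passed between the algorithms unchanged. -/
theorem encode_atom_var (R : BinRel L) (a b : ℕ) :
    encode ((BinRel.ext F R).atom (Term.var a) (Term.var b)) =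
      encode (R.atom (Term.var a) (Term.var b)) := by
  cases R with
  | none => rfl
  | some r =>
    refine (encode_atom_inr (L := extLang L F) ⟨2, r⟩ _).trans
      (Eq.trans ?_ (encode_atom_inr (L := L) ⟨2, r⟩ _).symm)
    simp only [argCodes, List.ofFn_succ, List.ofFn_zero]
    rfl

end SyntaxCodes

/-- Entailment of an atom as unsatisfiability of unit clauses. -/
theorem entails_iff_not_satisfiable {L : FirstOrder.Language.{0, 0}} {T : Models L}
    {Γ : List (Atom L)} {α : Atom L} :
    Entails T Γ α ↔ ¬ Satisfiable T {D | D ∈ [(false, α)] :: Γ.map fun γ => [(true, γ)]} := by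
  constructor
  · rintro h ⟨M, S, v, hM, hv⟩
    obtain ⟨l, hl, hα⟩ := hv [(false, α)] List.mem_cons_self
    rw [List.mem_singleton.1 hl] at hα
    simp only [Literal.Holds, Bool.false_eq_true, if_false] at hα
    refine hα (h M hM v fun γ hγ => ?_)
    obtain ⟨l, hl, h⟩ := hv [(true, γ)] (List.mem_cons_of_mem _ (List.mem_map.2 ⟨γ, hγ, rfl⟩))
    rw [List.mem_singleton.1 hl] at h
    simpa [Literal.Holds] using h
  · intro h M S hM v hv
    by_contra hα
    refine h ⟨M, S, v, hM, fun D hD => ?_⟩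
    rcases List.mem_cons.1 hD with rfl | hD
    · exact ⟨_, List.mem_singleton.2 rfl, by simpa [Literal.Holds] using hα⟩
    · obtain ⟨γ, hγ, rfl⟩ := List.mem_map.1 hD
      exact ⟨_, List.mem_singleton.2 rfl, by simpa [Literal.Holds] using hv γ hγ⟩

theorem pr_unitClauses {L : FirstOrder.Language.{0, 0}} [Encodable (Atom L)] :
    PR fun z : List (Atom L) × Atom L =>
      ([(false, z.2)] :: z.1.map fun γ => [(true, γ)] : List (Clause L)) :=
  PR.cons (((PR.const false).pair PR.snd).cons PR.nil)
    (PR.list_map (((PR.const true).pair PR.snd).cons PR.nil) PR.fst)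

/-! ### Θ-closure by finite paths. -/

section Linked

variable {L : FirstOrder.Language.{0, 0}} {F : ℕ → Type}

/-- Linking is symmetric, so the generated equivalence is reachability. A path is a list of edges,
and the equation between shifted lists expresses that consecutive edges meet and that the path leads
from `f` to `g`; for the empty list it says `f = g`. -/
theorem mem_theta_iff_exists_path {K : Set (Clause (extLang L F))} {S : Set (Σ n, F n)}
    {g : Σ n, F n} : g ∈ Theta K S ↔ ∃ f ∈ S, ∃ ps : List ((Σ n, F n) × (Σ n, F n)),
      (∀ p ∈ ps, Linked K p.1 p.2) ∧ f :: ps.map Prod.snd = ps.map Prod.fst ++ [g] := by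
  have hsymm : ∀ {f g : Σ n, F n}, Linked K f g → Linked K g f :=
    fun ⟨D, hD, h, h'⟩ => ⟨D, hD, h', h⟩
  have hrefl : ∀ {f g : Σ n, F n}, Relation.ReflTransGen (Linked K) f g →
      Relation.ReflTransGen (Linked K) g f := by
    intro f g h
    induction h with
    | refl => exact .refl
    | tail _ h ih => exact .head (hsymm h) ih
  refine exists_congr fun f => and_congr_right fun hf => ?_
  clear hf
  constructor
  · intro h
    have h' : Relation.ReflTransGen (Linked K) f g := by
      induction h with
      | rel _ _ h => exact .single h
      | refl => exact .refl
      | symm _ _ _ ih => exact hrefl ih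
      | trans _ _ _ _ _ ih ih' => exact ih.trans ih'
    clear h
    induction h' using Relation.ReflTransGen.head_induction_on with
    | refl => exact ⟨[], by simp, rfl⟩
    | @head a c hac _ ih =>
      obtain ⟨ps, hps, h⟩ := ih
      refine ⟨(a, c) :: ps, fun p hp => ?_, by simpa using h⟩
      rcases List.mem_cons.1 hp with rfl | hp
      exacts [hac, hps p hp]
  · rintro ⟨ps, hps, h⟩
    induction ps generalizing f with
    | nil =>
      obtain rfl : f = g := by simpa using h
      exact .refl _
    | cons p ps ih =>
      simp only [List.map_cons, List.cons_append, List.cons.injEq] at h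
      rw [h.1]
      exact .trans _ _ _ (.rel _ _ (hps p List.mem_cons_self))
        (ih _ (fun q hq => hps q (List.mem_cons_of_mem _ hq)) h.2)

end Linked

/-! ### Enumerability of inputs, refutations and entailment. -/

section Effective

variable {L : FirstOrder.Language.{0, 0}} {F : ℕ → Type} [Primcodable (Σ n, L.Functions n)]
  [Primcodable (Σ n, L.Relations n)] [Primcodable (Σ n, F n)]

theorem re_congClause (hF : Computable fun s : Σ n, F n => s.1) :
    RE fun D : Clause (extLang L F) => ∃ s : Σ n, F n, D = congClause L s.2 := by
  let W : Type := List (ℕ ⊕ (Σ n, (extLang L F).Functions n))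
  -- The functionality clause with terms written as words. The arity is a separate argument, so that
  -- `raw` is primitive recursive; the computable arity of the symbol is supplied afterwards.
  let raw : (Σ n, F n) × ℕ → List (Bool × ((W × W) ⊕ ℕ)) := fun z =>
    ((List.range z.2).map fun i => (false, Sum.inl ([Sum.inl i], [Sum.inl (z.2 + i)]))) ++
      [(true, Sum.inl (Sum.inr ⟨z.1.1, Sum.inr z.1.2⟩ :: (List.range z.2).map Sum.inl,
        Sum.inr ⟨z.1.1, Sum.inr z.1.2⟩ :: (List.range z.2).map fun i => Sum.inl (z.2 + i)))]
  have hraw : Primrec raw := by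
    have hrange : Primrec fun z : (Σ n, F n) × ℕ => List.range z.2 :=
      Primrec.list_range.comp Primrec.snd
    have hx : Primrec fun y : ((Σ n, F n) × ℕ) × ℕ =>
        (Sum.inl y.2 : ℕ ⊕ (Σ n, (extLang L F).Functions n)) := Primrec.sumInl.comp Primrec.snd
    have hy : Primrec fun y : ((Σ n, F n) × ℕ) × ℕ =>
        (Sum.inl (y.1.2 + y.2) : ℕ ⊕ (Σ n, (extLang L F).Functions n)) :=
      Primrec.sumInl.comp (Primrec.nat_add.comp (Primrec.snd.comp Primrec.fst) Primrec.snd)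
    have hf : Primrec fun z : (Σ n, F n) × ℕ =>
        (Sum.inr ⟨z.1.1, Sum.inr z.1.2⟩ : ℕ ⊕ (Σ n, (extLang L F).Functions n)) :=
      Primrec.sumInr.comp (primrec_extSymbol.comp Primrec.fst)
    refine Primrec.list_append.comp (Primrec.list_map hrange ?_)
      (Primrec.list_cons.comp ((Primrec.const true).pair (Primrec.sumInl.comp
        ((Primrec.list_cons.comp hf (Primrec.list_map hrange hx.to₂)).pair
          (Primrec.list_cons.comp hf (Primrec.list_map hrange hy.to₂))))) (Primrec.const []))
    exact ((Primrec.const false).pair (Primrec.sumInl.comp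
      ((Primrec.list_cons.comp hx (Primrec.const [])).pair
        (Primrec.list_cons.comp hy (Primrec.const []))))).to₂
  have hcode : ∀ s : Σ n, F n, encode (raw (s, s.1)) = encode (congClause L s.2) := by
    rintro ⟨n, f⟩
    rw [encode_list_eq, encode_list_eq (congClause L f)]
    congr 1
    simp only [raw, congClause, monClause, compClause, List.map_append, List.map_map,
      List.map_ofFn, List.map_cons, List.map_nil]
    congr 1
    · apply List.ext_getElem
      · simp
      · intro i h₁ h₂
        simp only [List.getElem_map, List.getElem_range, List.getElem_ofFn]
        rfl
    · have h : ∀ x : ℕ → ℕ, (Term.func (L := extLang L F) (Sum.inr f)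
          fun i : Fin n => Term.var (x i)).listEncode =
          Sum.inr ⟨n, Sum.inr f⟩ :: (List.range n).map fun i => Sum.inl (x i) := by
        intro x
        rw [Term.listEncode]
        congr 1
        rw [← List.map_coe_finRange_eq_range, List.map_map]
        simp only [Term.listEncode, Function.comp_def]
        exact List.flatMap_pure_eq_map _ _
      have h₁ := h fun i => i
      have h₂ := h fun i => n + i
      rw [← h₁, ← h₂]
      rfl
  refine REPred.of_eq (rePred_exists (p := fun y : ℕ × (Σ n, F n) =>
    encode (raw (y.2, y.2.1)) = y.1) (rePred_eq (Computable.encode.comp (hraw.to_comp.comp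
      (Computable.snd.pair (hF.comp Computable.snd)))) Computable.fst)) fun n => ?_
  constructor
  · rintro ⟨s, h⟩
    exact ⟨_, (hcode s).symm.trans h, s, rfl⟩
  · rintro ⟨_, rfl, s, rfl⟩
    exact ⟨s, hcode s⟩

variable {T₀ : L.Theory} {K : Set (Clause (extLang L F))}

theorem re_mem_of_recEnum (hK : RecEnum K) : RE fun D => D ∈ K :=
  REPred.of_eq hK fun n => by simp only [and_comm]

theorem re_axiomClauses (hF : Computable fun s : Σ n, F n => s.1) (hK : RecEnum K)
    [Recognizable (Atom (extLang L F))] : RE fun D => D ∈ axiomClauses K :=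
  (re_mem_of_recEnum hK).or ((re_congClause hF).or
    (RE.eq PR.id (PR.const (reflClause L F))))

theorem re_mem_theta (hK : RecEnum K) [Recognizable (Atom (extLang L F))] :
    RE fun z : List (Atom (extLang L F)) × (Σ n, F n) =>
      z.2 ∈ Theta K (extSymbolsIn (atomsTerms z.1)) := by
  have hlinked : RE fun p : (Σ n, F n) × (Σ n, F n) => Linked K p.1 p.2 := by
    refine (RE.exists (p := fun w : ((Σ n, F n) × (Σ n, F n)) × Clause (extLang L F) =>
      w.2 ∈ K ∧ w.1.1 ∈ clauseExtSymbols w.2 ∧ w.1.2 ∈ clauseExtSymbols w.2) ?_).of_iff fun p => by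
        simp only [Linked, mem_clauseExtSymbols]
    exact ((re_mem_of_recEnum hK).comp PR.snd).and
      ((RE.mem (PR.fst.comp PR.fst) (pr_clauseExtSymbols.comp PR.snd)).and
        (RE.mem (PR.snd.comp PR.fst) (pr_clauseExtSymbols.comp PR.snd)))
  refine (RE.exists (p := fun w : (List (Atom (extLang L F)) × (Σ n, F n)) ×
      ((Σ n, F n) × List ((Σ n, F n) × (Σ n, F n))) =>
      w.2.1 ∈ atomsExtSymbols w.1.1 ∧ (∀ p ∈ w.2.2, Linked K p.1 p.2) ∧
        w.2.1 :: w.2.2.map (fun p => p.2) = w.2.2.map (fun p => p.1) ++ [w.1.2]) ?_).of_iff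
    fun z => ?_
  · exact (RE.mem (PR.fst.comp PR.snd) (pr_atomsExtSymbols.comp (PR.fst.comp PR.fst))).and
      ((hlinked.list_all.comp (PR.snd.comp PR.snd)).and
        (RE.eq ((PR.fst.comp PR.snd).cons (PR.list_map (PR.snd.comp PR.snd) (PR.snd.comp PR.snd)))
          ((PR.list_map (PR.fst.comp PR.snd) (PR.snd.comp PR.snd)).append
            ((PR.snd.comp PR.fst).cons PR.nil))))
  · rw [mem_theta_iff_exists_path]
    simp only [mem_atomsExtSymbols, Prod.exists]
    grind

variable [Recognizable ((extLang L F).Term ℕ)] [Recognizable (Atom (extLang L F))]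

theorem re_isInput (hF : Computable fun s : Σ n, F n => s.1) (hK : RecEnum K) :
    RE fun z : List (Clause (extLang L F)) × Clause (extLang L F) => IsInput K z.1 z.2 :=
  (RE.mem PR.snd PR.fst).or ((RE.exists (p := fun w : (List (Clause (extLang L F)) ×
      Clause (extLang L F)) × (Clause (extLang L F) × List (ℕ × (extLang L F).Term ℕ)) =>
      w.2.1 ∈ axiomClauses K ∧ w.1.2 = w.2.1.subst (replacement w.2.2))
    (((re_axiomClauses hF hK).comp (PR.fst.comp PR.snd)).and
      (RE.eq (PR.snd.comp PR.fst) (pr_clauseSubst.comp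
        ((PR.snd.comp PR.snd).pair (PR.fst.comp PR.snd)))))).of_iff fun z => by simp)

variable [Recognizable (Atom L)]

theorem re_not_satisfiable {T : Models L} (hdec : DecidableGroundSat T) :
    RE fun C : List (Clause L) => ¬ Satisfiable T {D | D ∈ C} := by
  obtain ⟨f, hf, h⟩ := hdec
  refine REPred.of_eq (rePred_and (Recognizable.re (X := List (Clause L)))
    (rePred_eq hf (Computable.const false))) fun n => ?_
  constructor
  · rintro ⟨⟨C, rfl, -⟩, hC⟩
    exact ⟨C, rfl, by simp only [← h, hC, Bool.false_eq_true, not_false_eq_true]⟩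
  · rintro ⟨C, rfl, hC⟩
    simp only [← h] at hC
    exact ⟨⟨C, rfl, trivial⟩, by simpa using hC⟩

theorem re_entails_modelsOf (hdec : DecidableGroundSat (modelsOf T₀)) :
    RE fun z : List (Atom L) × Atom L => Entails (modelsOf T₀) z.1 z.2 :=
  ((re_not_satisfiable hdec).comp pr_unitClauses).of_iff fun _ => entails_iff_not_satisfiable

theorem re_isRefutation (hF : Computable fun s : Σ n, F n => s.1)
    (hdec : DecidableGroundSat (modelsOf T₀)) (hK : RecEnum K) :
    RE fun z : List (Clause (extLang L F)) ×
      (List (Clause L) × List (ℕ × (extLang L F).Term ℕ)) =>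
      IsRefutation T₀ K z.1 z.2.1 z.2.2 := by
  have h : RE fun w : (List (Clause (extLang L F)) × List (ℕ × (extLang L F).Term ℕ)) ×
      Clause L => IsInput K w.1.1 (w.2.trans (replacement w.1.2)) :=
    (re_isInput hF hK).comp ((PR.fst.comp PR.fst).pair
      (pr_clauseTrans.comp ((PR.snd.comp PR.fst).pair PR.snd)))
  exact (h.forall_list.comp ((PR.fst.pair (PR.snd.comp PR.snd)).pair (PR.fst.comp PR.snd))).and
    ((re_not_satisfiable hdec).comp (PR.fst.comp PR.snd))

/-- Finite refutations are recognizable, as inputs are enumerable and unsatisfiability in the base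
theory is decidable; entailment is the existence of one. -/
theorem re_entails_extModels (hF : Computable fun s : Σ n, F n => s.1)
    (hdec : DecidableGroundSat (modelsOf T₀)) (hK : RecEnum K)
    (hconv : ConvexTheory (modelsOf T₀))
    {Ψ : Set ((extLang L F).Term ℕ) → Set ((extLang L F).Term ℕ)} (hloc : PsiLocal T₀ K Ψ)
    {P : Set (BinRel L)} (hform : MonCompForm T₀ P K) :
    RE fun z : List (Atom (extLang L F)) × Atom (extLang L F) =>
      Entails (extModels T₀ K) z.1 z.2 := by
  have h := (re_isRefutation (L := L) hF hdec hK).exists.comp (pr_unitClauses (L := extLang L F))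
  refine h.of_iff fun z => ?_
  rw [entails_iff_isRefutation hconv hloc hform]
  simp

end Effective

/-! ### Search for reductions and computation of interpolating terms. -/

section Reduction

variable {L : FirstOrder.Language.{0, 0}} {F : ℕ → Type}

/-- `A₀`, `B₀`, `σ` is a reduction of the interpolation problem `A ∧ B ⊨ β`, where `β` is an
atom `a R b`. -/
def IsReductionOf (T₀ : L.Theory) (K : Set (Clause (extLang L F)))
    (A B : List (Atom (extLang L F))) (β : Atom L) (A₀ B₀ : List (Atom L))
    (σ : List (ℕ × (extLang L F).Term ℕ)) : Prop :=
  ∃ (R : BinRel L) (a b : ℕ), β = R.atom (Term.var a) (Term.var b) ∧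
    IsReduction T₀ K R A B a b A₀ B₀ σ

theorem BinRel.eq_of_atom_var {R R' : BinRel L} {a b a' b' : ℕ}
    (h : R.atom (Term.var a) (Term.var b) = R'.atom (Term.var a') (Term.var b')) :
    R = R' ∧ a = a' ∧ b = b' := by
  have hab : a = a' ∧ b = b' := by
    have := (exists_atom_var_iff.1 ⟨R, rfl⟩).symm.trans
      ((congrArg argList h).trans (exists_atom_var_iff.1 ⟨R', rfl⟩))
    simpa using this
  refine ⟨?_, hab⟩
  have := congrArg Atom.sym h
  rw [BinRel.sym_atom, BinRel.sym_atom] at this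
  rcases R with _ | r <;> rcases R' with _ | r' <;> simp_all [BinRel.sym]

theorem isReductionOf_atom {T₀ : L.Theory} {K : Set (Clause (extLang L F))} {R : BinRel L}
    {A B : List (Atom (extLang L F))} {a b : ℕ} {A₀ B₀ : List (Atom L)}
    {σ : List (ℕ × (extLang L F).Term ℕ)} :
    IsReductionOf T₀ K A B (R.atom (Term.var a) (Term.var b)) A₀ B₀ σ ↔
      IsReduction T₀ K R A B a b A₀ B₀ σ := by
  refine ⟨?_, fun h => ⟨R, a, b, rfl, h⟩⟩
  rintro ⟨R', a', b', h, hred⟩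
  obtain ⟨rfl, rfl, rfl⟩ := BinRel.eq_of_atom_var h
  exact hred

variable [Primcodable (Σ n, L.Functions n)] [Primcodable (Σ n, L.Relations n)]
  [Primcodable (Σ n, F n)] {T₀ : L.Theory} {K : Set (Clause (extLang L F))}

/-- Interpolating terms of the extension are computed from those of the base theory. -/
theorem effectivelyInterpolating_of_reduction {P : Set (BinRel L)} {r : ℕ →. ℕ}
    (hr : Nat.Partrec r) (hred : ReducesInterpolation T₀ K P r)
    (heff : EffectivelyInterpolating (modelsOf T₀) allShared (insert none P)) :
    EffectivelyInterpolating (extModels T₀ K) (thetaSharing K) (BinRel.ext F '' P) := by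
  obtain ⟨f, hf, hcomp⟩ := heff
  obtain ⟨g, hg, htr⟩ := pr_translate (L := L) (F := F)
  -- From the original problem and the code of the reduction, this forms the base problem with the
  -- two base conjunctions and the original atom; the replacements are kept for translating the
  -- answer.
  have h₁ : Computable fun x : ℕ × ℕ =>
      Nat.pair x.2.unpair.1 (Nat.pair x.2.unpair.2.unpair.1 x.1.unpair.2.unpair.2) :=
    (Primrec₂.natPair.comp (Primrec.fst.comp (Primrec.unpair.comp Primrec.snd))
      (Primrec₂.natPair.comp
        (Primrec.fst.comp (Primrec.unpair.comp (Primrec.snd.comp (Primrec.unpair.comp Primrec.snd))))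
        (Primrec.snd.comp (Primrec.unpair.comp (Primrec.snd.comp
          (Primrec.unpair.comp Primrec.fst)))))).to_comp
  have h₂ : Computable fun y : (ℕ × ℕ) × ℕ =>
      g (Nat.pair y.1.2.unpair.2.unpair.2 y.2) :=
    (hg.comp (Primrec₂.natPair.comp (Primrec.snd.comp (Primrec.unpair.comp (Primrec.snd.comp
      (Primrec.unpair.comp (Primrec.snd.comp Primrec.fst))))) Primrec.snd)).to_comp
  have h₃ : Partrec fun x : ℕ × ℕ => (f (Nat.pair x.2.unpair.1
      (Nat.pair x.2.unpair.2.unpair.1 x.1.unpair.2.unpair.2))).map fun t =>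
        g (Nat.pair x.2.unpair.2.unpair.2 t) :=
    ((Partrec.nat_iff.2 hf).comp h₁).map h₂.to₂
  refine ⟨_, Partrec.nat_iff.1 ((Partrec.nat_iff.2 hr).bind h₃.to₂), ?_⟩
  rintro _ ⟨R, hR, rfl⟩ A B a b hprob
  obtain ⟨A₀, B₀, σ, hrc, hprob₀, hint⟩ := hred R hR A B a b hprob
  obtain ⟨t₀, ht₀, htc⟩ := hcomp R (Set.mem_insert_of_mem _ hR) A₀ B₀ a b hprob₀
  refine ⟨translate σ t₀, hint t₀ ht₀, Part.mem_bind hrc ?_⟩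
  refine (Part.mem_map_iff _).2 ⟨encode t₀, ?_, ?_⟩
  · simp only [encode_prod_val, Nat.unpair_pair, encode_atom_var] at htc ⊢
    exact htc
  · have h := htr (σ, t₀)
    simp only [encode_prod_val, Nat.unpair_pair] at h ⊢
    exact h

theorem re_sharedTerm [Recognizable (Atom (extLang L F))] (hK : RecEnum K) {X : Type} [Encodable X] [Recognizable X]
    {A B : X → List (Atom (extLang L F))} (hA : PR A) (hB : PR B) {t : X → (extLang L F).Term ℕ}
    (ht : PR t) :
    RE fun x => constsIn (subterms (t x)) ⊆
        constsIn (atomsTerms (A x)) ∩ constsIn (atomsTerms (B x)) ∧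
      symbolsIn (subterms (t x)) ⊆ thetaSharing K (A x) (B x) := by
  have h₁ : RE fun w : X × ℕ => w.2 ∈ atomsConsts (A w.1) ∧ w.2 ∈ atomsConsts (B w.1) :=
    (RE.mem PR.snd (pr_atomsConsts.comp (hA.comp PR.fst))).and
      (RE.mem PR.snd (pr_atomsConsts.comp (hB.comp PR.fst)))
  have hAg : PR fun w : X × (Σ n, F n) => (A w.1, w.2) := (hA.comp PR.fst).pair PR.snd
  have hBg : PR fun w : X × (Σ n, F n) => (B w.1, w.2) := (hB.comp PR.fst).pair PR.snd
  have h₂ : RE fun w : X × (Σ n, F n) =>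
      w.2 ∈ Theta K (extSymbolsIn (atomsTerms (A w.1))) ∧
        w.2 ∈ Theta K (extSymbolsIn (atomsTerms (B w.1))) := by
    have h := (re_mem_theta hK).comp hAg
    have h' := (re_mem_theta hK).comp hBg
    exact h.and h'
  refine ((h₁.forall_list.comp (PR.id.pair (pr_constList.comp ht))).and
    (h₂.forall_list.comp (PR.id.pair (pr_extSymbolList.comp ht)))).of_iff fun x => ?_
  rw [subset_thetaSharing_iff]
  simp only [mem_atomsConsts, mem_constList, Set.subset_def, Set.mem_inter_iff]

variable [Recognizable (Atom L)] [Recognizable ((extLang L F).Term ℕ)]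
  [Recognizable (Atom (extLang L F))]

theorem re_isReductionOf (hF : Computable fun s : Σ n, F n => s.1)
    (hdec : DecidableGroundSat (modelsOf T₀)) (hK : RecEnum K)
    (hconv : ConvexTheory (modelsOf T₀))
    {Ψ : Set ((extLang L F).Term ℕ) → Set ((extLang L F).Term ℕ)} (hloc : PsiLocal T₀ K Ψ)
    {P : Set (BinRel L)} (hform : MonCompForm T₀ P K) {X : Type} [Encodable X] [Recognizable X]
    {A B : X → List (Atom (extLang L F))} (hA : PR A) (hB : PR B) {β : X → Atom L} (hβ : PR β)
    {A₀ B₀ : X → List (Atom L)} (hA₀ : PR A₀) (hB₀ : PR B₀)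
    {σ : X → List (ℕ × (extLang L F).Term ℕ)} (hσ : PR σ) :
    RE fun x => IsReductionOf T₀ K (A x) (B x) (β x) (A₀ x) (B₀ x) (σ x) := by
  have hrepl : PR fun y : List (ℕ × (extLang L F).Term ℕ) × ℕ => replacement y.1 y.2 :=
    pr_subst.comp (PR.fst.pair (pr_var.comp PR.snd))
  have hatom : RE fun w : X × (ℕ × ℕ) => argList (β w.1) = [Term.var w.2.1, Term.var w.2.2] :=
    RE.eq (pr_argList.comp (hβ.comp PR.fst))
      ((pr_var.comp (PR.fst.comp PR.snd)).cons ((pr_var.comp (PR.snd.comp PR.snd)).cons PR.nil))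
  have hprob : RE fun w : X × (ℕ × ℕ) =>
      w.2.1 ∈ atomsConsts (A₀ w.1) ∧ w.2.2 ∈ atomsConsts (B₀ w.1) ∧
        Entails (modelsOf T₀) (A₀ w.1 ++ B₀ w.1) (β w.1) :=
    (RE.mem (PR.fst.comp PR.snd) (pr_atomsConsts.comp (hA₀.comp PR.fst))).and
      ((RE.mem (PR.snd.comp PR.snd) (pr_atomsConsts.comp (hB₀.comp PR.fst))).and
        ((re_entails_modelsOf hdec).comp
          (((hA₀.comp PR.fst).append (hB₀.comp PR.fst)).pair (hβ.comp PR.fst))))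
  have hfix : RE fun w : X × (ℕ × ℕ) => replacement (σ w.1) w.2.1 = Term.var w.2.1 ∧
      replacement (σ w.1) w.2.2 = Term.var w.2.2 :=
    (RE.eq (hrepl.comp ((hσ.comp PR.fst).pair (PR.fst.comp PR.snd)))
      (pr_var.comp (PR.fst.comp PR.snd))).and
      (RE.eq (hrepl.comp ((hσ.comp PR.fst).pair (PR.snd.comp PR.snd)))
        (pr_var.comp (PR.snd.comp PR.snd)))
  -- The condition on common constants becomes one on each constant of the first conjunction: either
  -- it is absent from the second, which is decidable on lists, or its replacement is shared.
  have hshared : RE fun w : X × ℕ => w.2 ∉ atomsConsts (B₀ w.1) ∨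
      (constsIn (subterms (replacement (σ w.1) w.2)) ⊆
        constsIn (atomsTerms (A w.1)) ∩ constsIn (atomsTerms (B w.1)) ∧
      symbolsIn (subterms (replacement (σ w.1) w.2)) ⊆ thetaSharing K (A w.1) (B w.1)) :=
    (RE.not_mem PR.snd (pr_atomsConsts.comp (hB₀.comp PR.fst))).or
      (re_sharedTerm hK (hA.comp PR.fst) (hB.comp PR.fst)
        (hrepl.comp ((hσ.comp PR.fst).pair PR.snd)))
  have hent : RE fun w : X × Atom L =>
      Entails (extModels T₀ K) (A w.1 ++ B w.1) (w.2.trans (replacement (σ w.1))) :=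
    (re_entails_extModels hF hdec hK hconv hloc hform).comp
      (((hA.comp PR.fst).append (hB.comp PR.fst)).pair
        (pr_atomTrans.comp ((hσ.comp PR.fst).pair PR.snd)))
  refine (((hatom.and (hprob.and hfix)).exists).and
    ((hshared.forall_list.comp (PR.id.pair (pr_atomsConsts.comp hA₀))).and
    (hent.forall_list.comp (PR.id.pair (hA₀.append hB₀))))).of_iff fun x => ?_
  simp only [IsReductionOf, IsReduction, IsProblem, mem_atomsConsts, Prod.exists,
    ← exists_atom_var_iff, Set.mem_inter_iff, and_imp, ← imp_iff_not_or]
  constructor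
  · rintro ⟨R, a, b, hR, ⟨ha, hb, hp⟩, hf, hs, he⟩
    exact ⟨⟨a, b, ⟨R, hR⟩, ⟨ha, hb, hR ▸ hp⟩, hf⟩, hs, he⟩
  · rintro ⟨⟨a, b, ⟨R, hR⟩, ⟨ha, hb, hp⟩, hf⟩, hs, he⟩
    exact ⟨R, a, b, hR, ⟨ha, hb, hR ▸ hp⟩, hf, hs, he⟩

/-- Reductions of interpolation problems can be found by search. -/
theorem exists_partrec_isReduction (hF : Computable fun s : Σ n, F n => s.1)
    (hdec : DecidableGroundSat (modelsOf T₀)) (hK : RecEnum K)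
    (hconv : ConvexTheory (modelsOf T₀))
    {Ψ : Set ((extLang L F).Term ℕ) → Set ((extLang L F).Term ℕ)} (hloc : PsiLocal T₀ K Ψ)
    {P : Set (BinRel L)} (hform : MonCompForm T₀ P K) :
    ∃ r : ℕ →. ℕ, Nat.Partrec r ∧ ∀ (R : BinRel L) (A B : List (Atom (extLang L F))) (a b : ℕ),
      (∃ A₀ B₀ σ, IsReduction T₀ K R A B a b A₀ B₀ σ) →
      ∃ A₀ B₀ σ, IsReduction T₀ K R A B a b A₀ B₀ σ ∧
        encode (A₀, B₀, σ) ∈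
          r (encode (A, B, (BinRel.ext F R).atom (Term.var a) (Term.var b))) := by
  have h : RE fun z : (List (Atom (extLang L F)) × List (Atom (extLang L F)) × Atom L) ×
      (List (Atom L) × List (Atom L) × List (ℕ × (extLang L F).Term ℕ)) =>
      IsReductionOf T₀ K z.1.1 z.1.2.1 z.1.2.2 z.2.1 z.2.2.1 z.2.2.2 :=
    re_isReductionOf hF hdec hK hconv hloc hform (PR.fst.comp PR.fst)
      (PR.fst.comp (PR.snd.comp PR.fst)) (PR.snd.comp (PR.snd.comp PR.fst)) (PR.fst.comp PR.snd)
      (PR.fst.comp (PR.snd.comp PR.snd)) (PR.snd.comp (PR.snd.comp PR.snd))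
  obtain ⟨r, hr, hs⟩ := exists_search h
  refine ⟨r, hr, fun R A B a b ⟨A₀, B₀, σ, hred⟩ => ?_⟩
  -- The search may return a different reduction from the one known to exist; any reduction serves.
  obtain ⟨⟨A₁, B₁, τ⟩, hp, hc⟩ := hs (A, B, R.atom (Term.var a) (Term.var b))
    ⟨(A₀, B₀, σ), isReductionOf_atom.2 hred⟩
  refine ⟨A₁, B₁, τ, isReductionOf_atom.1 hp, ?_⟩
  simp only [encode_prod_val, encode_atom_var] at hc ⊢
  exact hc

end Reduction

end LocalInterp

/-! ### The interpolation theorem. -/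

theorem mainTheorem1 (L : FirstOrder.Language.{0, 0}) (F : ℕ → Type)
    [Primcodable (Σ n, L.Functions n)] [Primcodable (Σ n, L.Relations n)] [Primcodable (Σ n, F n)]
    (hL : Computable fun s : (Σ n, L.Functions n) => s.1)
    (hR : Computable fun s : (Σ n, L.Relations n) => s.1)
    (hF : Computable fun s : (Σ n, F n) => s.1)
    (T₀ : L.Theory) (P : Set (BinRel L)) (K : Set (Clause (extLang L F)))
    (Ψ : Set ((extLang L F).Term ℕ) → Set ((extLang L F).Term ℕ))
    (hconv : ConvexTheory (modelsOf T₀))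
    (hint : PInterpolating (modelsOf T₀) allShared P)
    (heq : RInterpolating (modelsOf T₀) allShared none)
    (hdec : DecidableGroundSat (modelsOf T₀))
    (heff : EffectivelyInterpolating (modelsOf T₀) allShared (insert none P))
    (hform : MonCompForm T₀ P K)
    (hmap : IsTermMap Ψ) (hsep : Separable K Ψ) (hloc : PsiLocal T₀ K Ψ) :
    PInterpolating (extModels T₀ K) (thetaSharing K) (BinRel.ext F '' P) ∧
    (RecEnum K →
      EffectivelyInterpolating (extModels T₀ K) (thetaSharing K) (BinRel.ext F '' P) ∧
      ∃ r : ℕ →. ℕ, Nat.Partrec r ∧ ReducesInterpolation T₀ K P r) := by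
  have hred : ∀ (R : BinRel L) (A B : List (Atom (extLang L F))) (a b : ℕ),
      IsProblem (extModels T₀ K) (BinRel.ext F R) A B a b →
      ∃ A₀ B₀ σ, IsReduction T₀ K R A B a b A₀ B₀ σ := fun _ _ _ _ _ =>
    exists_isReduction hconv hint heq hform hsep hloc
  refine ⟨pInterpolating_extModels hconv hint heq hform hsep hloc, fun hK => ?_⟩
  have : Recognizable (Atom L) := recognizable_atom hL hR
  have : Recognizable ((extLang L F).Term ℕ) := recognizable_term (computable_extArity hL hF)
  have : Recognizable (Atom (extLang L F)) := recognizable_atom (computable_extArity hL hF) hR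
  -- Existence of reductions guarantees that the search terminates on every interpolation problem.
  obtain ⟨r, hr, hfind⟩ := exists_partrec_isReduction hF hdec hK hconv hloc hform
  have hreduces : ReducesInterpolation T₀ K P r := by
    intro R _ A B a b hprob
    obtain ⟨A₀, B₀, σ, h, hmem⟩ := hfind R A B a b (hred R A B a b hprob)
    exact ⟨A₀, B₀, σ, hmem, h.1, fun _ => h.isInterpolatingTerm⟩
  exact ⟨effectivelyInterpolating_of_reduction hr hreduces heff, r, hr, hreduces⟩
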